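/- Let $G\le \mathrm{SL}_2(\mathbb C)$ be a finite subgroup, $N\trianglelefteq G$ a normal subgroup of even order, and $V=\mathbb C^2$ the standard module. All modules are complex. Consider one of the following families $(M_i)_{i\in I}$ of modules over a group $H$, with $H$-modules $S_k$ ($k\ge 0$), a special index $0\in I$, and a finite group $K$. * (Restriction) $H=K=N$. The $M_i=\check\rho_i$ are the pairwise non-isomorphic restrictions to $N$ of the irreducible $G$-modules, $M_0$ is the trivial module, and $S_k=S^k(V)|_N$. Here it is assumed that the restrictions to $N$ of two irreducible $G$-modules are isomorphic whenever they have a common constituent (so that multiplicities are well defined). * (Induction) $H=G$, $K=N$. The $M_i=\hat\phi_i$ are the pairwise non-isomorphic $G$-modules induced from the irreducible $N$-modules $\phi_i$, $M_0$ is induced from the trivial module, and $S_k=\mathrm{Ind}_N^G(S^k(V)|_N)$. * ($N=G$) $H=K=G$. The $M_i=\rho_i$ are the irreducible $G$-modules, $M_0$ is the trivial module, and $S_k=S^k(V)|_G$. The assumption in the first case holds for all distinguished pairs of the McKay–Slodowy correspondence, that is, for $N=G$ and for $D_n\lhd D_{2n}$ ($n\ge2$), $C_{2n}\lhd D_n$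 ($n\ge2$), $C_{2n}\lhd D_{2n}$ ($n\ge1$), $T\lhd O$ and $D_2\lhd T$, where $C_n$ is cyclic of order $n$, $D_n$ is binary dihedral of order $4n$, and $T$, $O$ are the binary tetrahedral and octahedral groups. There are unique non-negative integers $b_{ji}$ and $x_{k,i}$ with $$V\otimes M_j\cong\bigoplus_{i}b_{ji}M_i,\qquad S_k\cong\bigoplus_i x_{k,i}M_i .$$ Let $A=2I-(b_{ij})^{T}$, let $s_i$ be the linear map of the lattice $\bigoplus_i\mathbb Z\alpha_i$ with $s_i\alpha_j=\alpha_j-A_{ij}\alpha_i$, and let $X(t)_i=\sum_{k\ge0}x_{k,i}t^k$ be the Poincaré series of the multiplicities. Then $I\setminus\{0\}$ can be partitioned into sets $P_1$, $P_2$ such that $A_{ij}=0$ for all $i\ne j$ in $P_1$ and for all $i\neq j$ in $P_2\cup\{0\}$. For every such partition put $\mathcal C_j=\prod_{r\in P_j}s_r$; let $h$ be the Coxeter number, i.e. the order of the Coxeter element $\mathcal C_2\mathcal C_1$, put $a=2\max\{\dim\phi:\phi\text{ an irreducible }K\text{-module}\}$ and $b=h+2-a$, let $\mathcal C^{(k)}=\cdots\mathcal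 C_1\mathcal C_2\mathcal C_1$ ($k$ factors), and let $$z(t)=\sum_{k=0}^h z_kt^k,\qquad z_0=z_h=\alpha_0,\qquad z_k=\mathcal C^{(k)}\alpha_0-\mathcal C^{(k-1)}\alpha_0\quad(0<k<h).$$ Then, with $z(t)_i$ the coefficient of $\alpha_i$ in $z(t)$, for every $i\in I$ $$X(t)_i=\frac{z(t)_i}{(1-t^a)(1-t^b)},\qquad\text{and in particular}\qquad X(t)_0=\frac{1+t^h}{(1-t^a)(1-t^b)} .$$ -/

import Mathlib

open scoped MatrixGroups

noncomputable section

namespace McKaySlodowy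

/-! ### Modules and multiplicities -/

section Modules

variable {H : Type} [Group H]

/-- The standard module `V = ℂ²` of `SL(2, ℂ)`. -/
def stdRep : Representation ℂ SL(2, ℂ) (Fin 2 → ℂ) where
  toFun g := Matrix.toLin' g.1
  map_one' := Matrix.toLin'_one
  map_mul' g h := Matrix.toLin'_mul g.1 h.1

/-- The module obtained from `σ` by restriction to the subgroup `N`. -/
abbrev res (N : Subgroup H) {U : Type} [AddCommGroup U] [Module ℂ U]
    (σ : Representation ℂ H U) : Representation ℂ N U :=
  σ.comp N.subtype

/-- The module obtained from `φ` by induction from the subgroup `N`. -/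
abbrev ind (N : Subgroup H) {U : Type} [AddCommGroup U] [Module ℂ U]
    (φ : Representation ℂ N U) : Representation ℂ H (Representation.IndV N.subtype φ) :=
  Representation.ind N.subtype φ

/-- The action of `H` on the symmetric algebra `S(U)` by algebra homomorphisms. -/
def symAlgRep {U : Type} [AddCommGroup U] [Module ℂ U] (σ : Representation ℂ H U) :
    Representation ℂ H (SymmetricAlgebra ℂ U) where
  toFun g := (SymmetricAlgebra.lift (SymmetricAlgebra.ι ℂ U ∘ₗ σ g)).toLinearMap
  map_one' := by
    have : SymmetricAlgebra.lift (SymmetricAlgebra.ι ℂ U ∘ₗ σ 1) =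
        AlgHom.id ℂ (SymmetricAlgebra ℂ U) := by
      apply SymmetricAlgebra.algHom_ext
      ext x
      simp
    rw [this]
    rfl
  map_mul' g h := by
    have : SymmetricAlgebra.lift (SymmetricAlgebra.ι ℂ U ∘ₗ σ (g * h)) =
        (SymmetricAlgebra.lift (SymmetricAlgebra.ι ℂ U ∘ₗ σ g)).comp
          (SymmetricAlgebra.lift (SymmetricAlgebra.ι ℂ U ∘ₗ σ h)) := by
      apply SymmetricAlgebra.algHom_ext
      ext x
      simp
    rw [this]
    rfl

/-- The `k`-th symmetric power `S^k(U)`: the span of the products of `k` elements of `U` in the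
symmetric algebra `S(U)`. -/
def symPow (U : Type) [AddCommGroup U] [Module ℂ U] (k : ℕ) :
    Submodule ℂ (SymmetricAlgebra ℂ U) :=
  (LinearMap.range (SymmetricAlgebra.ι ℂ U)) ^ k

theorem symPow_le_comap {U : Type} [AddCommGroup U] [Module ℂ U] (σ : Representation ℂ H U)
    (k : ℕ) (g : H) : symPow U k ≤ (symPow U k).comap (symAlgRep σ g) := by
  rw [← Submodule.map_le_iff_le_comap]
  change ((LinearMap.range (SymmetricAlgebra.ι ℂ U)) ^ k).map
    (SymmetricAlgebra.lift (SymmetricAlgebra.ι ℂ U ∘ₗ σ g)).toLinearMap ≤ _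
  rw [Submodule.map_pow]
  refine pow_le_pow_left' ?_ k
  rintro _ ⟨_, ⟨x, rfl⟩, rfl⟩
  exact ⟨σ g x, by simp⟩

/-- The `H`-module `S^k(U)`. -/
def symPowRep {U : Type} [AddCommGroup U] [Module ℂ U] (σ : Representation ℂ H U) (k : ℕ) :
    Representation ℂ H (symPow U k) :=
  (symAlgRep σ).subrepresentation (symPow U k) (symPow_le_comap σ k)

/-- `σ ≅ ⨁ i, n i • M i`: the module `σ` is a direct sum of members of the family `M`, in which
`M i` occurs `n i` times. -/
def HasMultiplicities {I : Type} {U : I → Type} [∀ i, AddCommGroup (U i)] [∀ i, Module ℂ (U i)]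
    (M : ∀ i, Representation ℂ H (U i)) {X : Type} [AddCommGroup X] [Module ℂ X]
    (σ : Representation ℂ H X) (n : I → ℕ) : Prop :=
  Nonempty (σ.Equiv (Representation.directSum fun p : (Σ i, Fin (n i)) => M p.1))

/-- The largest dimension of an irreducible complex module of `H` (for finite `H`). -/
def maxIrrepDim (H : Type) [Group H] : ℕ :=
  sSup {d : ℕ | ∃ (U : Type) (_ : AddCommGroup U) (_ : Module ℂ U) (σ : Representation ℂ H U),
    σ.IsIrreducible ∧ Module.finrank ℂ U = d}

/-- `ρ i` (`i : I`) is a complete list of the irreducible `H`-modules up to isomorphism. -/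
structure IsIrreducibleSystem {I : Type} {W : I → Type} [∀ i, AddCommGroup (W i)]
    [∀ i, Module ℂ (W i)] (ρ : ∀ i, Representation ℂ H (W i)) : Prop where
  irreducible : ∀ i, (ρ i).IsIrreducible
  inequivalent : ∀ i j, Nonempty ((ρ i).Equiv (ρ j)) → i = j
  exhaustive : ∀ (U : Type) [AddCommGroup U] [Module ℂ U] (σ : Representation ℂ H U),
    σ.IsIrreducible → ∃ i, Nonempty (σ.Equiv (ρ i))

/-- The restrictions to `N` of the irreducible `H`-modules `ρ i` (`i : I`) form a complete list,
without repetition up to isomorphism, of the restrictions of irreducible `H`-modules. -/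
structure IsRestrictionSystem (N : Subgroup H) {I : Type} {W : I → Type}
    [∀ i, AddCommGroup (W i)] [∀ i, Module ℂ (W i)]
    (ρ : ∀ i, Representation ℂ H (W i)) : Prop where
  irreducible : ∀ i, (ρ i).IsIrreducible
  inequivalent : ∀ i j, Nonempty ((res N (ρ i)).Equiv (res N (ρ j))) → i = j
  exhaustive : ∀ (U : Type) [AddCommGroup U] [Module ℂ U] (σ : Representation ℂ H U),
    σ.IsIrreducible → ∃ i, Nonempty ((res N σ).Equiv (res N (ρ i)))

/-- The `H`-modules induced from the irreducible `N`-modules `φ i` (`i : I`) form a complete list,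
without repetition up to isomorphism, of the modules induced from irreducible `N`-modules. -/
structure IsInductionSystem (N : Subgroup H) {I : Type} {W : I → Type}
    [∀ i, AddCommGroup (W i)] [∀ i, Module ℂ (W i)]
    (φ : ∀ i, Representation ℂ N (W i)) : Prop where
  irreducible : ∀ i, (φ i).IsIrreducible
  inequivalent : ∀ i j, Nonempty ((ind N (φ i)).Equiv (ind N (φ j))) → i = j
  exhaustive : ∀ (U : Type) [AddCommGroup U] [Module ℂ U] (σ : Representation ℂ N U),
    σ.IsIrreducible → ∃ i, Nonempty ((ind N σ).Equiv (ind N (φ i)))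

/-- Two restrictions to `N` of irreducible `H`-modules either are isomorphic or have no common
constituent (that is, no nonzero `N`-map between them). -/
def RestrictionsSeparate (N : Subgroup H) : Prop :=
  ∀ (U U' : Type) [AddCommGroup U] [Module ℂ U] [AddCommGroup U'] [Module ℂ U']
    (σ : Representation ℂ H U) (σ' : Representation ℂ H U'),
    σ.IsIrreducible → σ'.IsIrreducible →
    (∃ f : (res N σ).IntertwiningMap (res N σ'), f ≠ 0) →
    Nonempty ((res N σ).Equiv (res N σ'))

/-- The distinguished pairs `N ⊴ H` of the McKay–Slodowy correspondence. With `C_n` cyclic of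
order `n`, `D_n` binary dihedral of order `4n` and `T`, `O` binary tetrahedral and octahedral, they
are `N = H`, `D_n ⊲ D_{2n}`, `C_{2n} ⊲ D_n`, `C_{2n} ⊲ D_{2n}`, `T ⊲ O` and `D_2 ⊲ T`.
Here `T ≅ SL(2, 𝔽₃)`, and a finite subgroup of `SL(2, ℂ)` that contains `T` with index two is
binary octahedral. -/
def IsDistinguishedPair (N : Subgroup H) : Prop :=
  N = ⊤ ∨
  (∃ n, 2 ≤ n ∧ Nonempty (N ≃* QuaternionGroup n) ∧ Nonempty (H ≃* QuaternionGroup (2 * n))) ∨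
  (∃ n, 2 ≤ n ∧ Nonempty (N ≃* Multiplicative (ZMod (2 * n))) ∧
    Nonempty (H ≃* QuaternionGroup n)) ∨
  (∃ n, 1 ≤ n ∧ Nonempty (N ≃* Multiplicative (ZMod (2 * n))) ∧
    Nonempty (H ≃* QuaternionGroup (2 * n))) ∨
  (Nonempty (N ≃* SL(2, ZMod 3)) ∧ N.index = 2) ∨
  (Nonempty (N ≃* QuaternionGroup 2) ∧ Nonempty (H ≃* SL(2, ZMod 3)))

end Modules

/-! ### The root lattice and the Coxeter element -/

section RootLattice

variable {I : Type} [Fintype I] [DecidableEq I]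

/-- The Cartan matrix `2I - bᵀ` of the digraph with adjacency matrix `b`. -/
def cartan (b : Matrix I I ℕ) : Matrix I I ℤ :=
  2 • (1 : Matrix I I ℤ) - (b.map fun n => (n : ℤ)).transpose

/-- The simple root `α i` in the root lattice `⨁ i, ℤ α i`. -/
def simpleRoot (i : I) : I → ℤ := Pi.single i 1

/-- The simple reflection `s i`, given by `s i (α j) = α j - A i j • α i`. -/
def simpleReflection (A : Matrix I I ℤ) (i : I) : Module.End ℤ (I → ℤ) :=
  Module.preReflection (simpleRoot i) (LinearMap.proj i ∘ₗ A.mulVecLin)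

theorem simpleReflection_simpleRoot (A : Matrix I I ℤ) (i j : I) :
    simpleReflection A i (simpleRoot j) = simpleRoot j - A i j • simpleRoot i := by
  simp [simpleReflection, simpleRoot, Module.preReflection_apply]

/-- The simple roots other than `α o` are split into two classes `P₁` and `P₂` such that the roots
of `P₁`, and likewise the roots of `P₂` together with `α o`, are mutually orthogonal. -/
structure IsBipartition (A : Matrix I I ℤ) (o : I) (P₁ P₂ : Finset I) : Prop where
  disjoint : Disjoint P₁ P₂
  union_eq : P₁ ∪ P₂ = Finset.univ.erase o
  orthogonal₁ : ∀ i ∈ P₁, ∀ j ∈ P₁, i ≠ j → A i j = 0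
  orthogonal₂ : ∀ i ∈ insert o P₂, ∀ j ∈ insert o P₂, i ≠ j → A i j = 0

/-- The product of the simple reflections `s r` over `r ∈ P`. It is only used for sets `P` of
mutually orthogonal roots, where the factors commute and their order does not matter. -/
def reflectionProd (A : Matrix I I ℤ) (P : Finset I) : Module.End ℤ (I → ℤ) :=
  (P.toList.map (simpleReflection A)).prod

/-- The Coxeter number: the order of the Coxeter element `𝒞 = 𝒞₂ 𝒞₁` of the finite Weyl group
generated by the simple reflections `s i`, `i ≠ o`. -/
def coxeterNumber (A : Matrix I I ℤ) (P₁ P₂ : Finset I) : ℕ :=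
  orderOf (reflectionProd A P₂ * reflectionProd A P₁)

/-- The alternating product `𝒞^(k) = ⋯ 𝒞₁ 𝒞₂ 𝒞₁` with `k` factors. -/
def altProd (A : Matrix I I ℤ) (P₁ P₂ : Finset I) : ℕ → Module.End ℤ (I → ℤ)
  | 0 => 1
  | k + 1 => reflectionProd A (if Odd (k + 1) then P₁ else P₂) * altProd A P₁ P₂ k

/-- The vectors `z_0 = z_h = α_o` and `z_k = 𝒞^(k) α_o - 𝒞^(k-1) α_o` for `0 < k < h`. -/
def zVec (A : Matrix I I ℤ) (o : I) (P₁ P₂ : Finset I) (k : ℕ) : I → ℤ :=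
  if k = 0 ∨ k = coxeterNumber A P₁ P₂ then simpleRoot o
  else altProd A P₁ P₂ k (simpleRoot o) - altProd A P₁ P₂ (k - 1) (simpleRoot o)

/-- The coefficient `z(t)_i` of `α i` in `z(t) = ∑_{k=0}^{h} z_k t^k`. -/
def zPoly (A : Matrix I I ℤ) (o : I) (P₁ P₂ : Finset I) (i : I) : Polynomial ℤ :=
  ∑ k ∈ Finset.range (coxeterNumber A P₁ P₂ + 1), Polynomial.monomial k (zVec A o P₁ P₂ k i)

end RootLattice

/-! ### The formula -/

section Formula

variable {H : Type} [Group H] {I : Type} [Fintype I] [DecidableEq I]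

/-- The Poincaré series `X(t)_i = ∑ₖ (x_k)_i t^k` of the multiplicities of the `i`-th module. -/
def poincareSeries (x : ℕ → I → ℕ) (i : I) : PowerSeries ℤ :=
  PowerSeries.mk fun k => (x k i : ℤ)

/-- The Poincaré series for the multiplicities of the modules `M i` in the sequence `S 0, S 1, …`
are given by Kostant's formula. In detail:
* the decompositions `V ⊗ M j ≅ ⨁ i, b j i • M i` and `S k ≅ ⨁ i, x k i • M i` exist and have
  unique multiplicities;
* the vertices other than the special vertex `o` of the digraph of `b` can be split into two classes
  as in `IsBipartition`;
* for each such splitting, with `h` the Coxeter number, `a = 2 d` and `c = h + 2 - a`,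
  `X(t)_i = z(t)_i / ((1 - t^a) (1 - t^c))` for all `i`, and
  `X(t)_o = (1 + t^h) / ((1 - t^a) (1 - t^c))`. -/
def KostantFormula {U : I → Type} [∀ i, AddCommGroup (U i)] [∀ i, Module ℂ (U i)]
    (V : Representation ℂ H (Fin 2 → ℂ)) (M : ∀ i, Representation ℂ H (U i))
    {Y : ℕ → Type} [∀ k, AddCommGroup (Y k)] [∀ k, Module ℂ (Y k)]
    (S : ∀ k, Representation ℂ H (Y k)) (o : I) (d : ℕ) : Prop :=
  ∃ (b : Matrix I I ℕ) (x : ℕ → I → ℕ),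
    (∀ j n, HasMultiplicities M (V.tprod (M j)) n ↔ n = b j) ∧
    (∀ k n, HasMultiplicities M (S k) n ↔ n = x k) ∧
    (∃ P₁ P₂, IsBipartition (cartan b) o P₁ P₂) ∧
    ∀ P₁ P₂, IsBipartition (cartan b) o P₁ P₂ →
      ∀ h a c : ℕ, h = coxeterNumber (cartan b) P₁ P₂ → a = 2 * d → c = h + 2 - a →
        (∀ i, poincareSeries x i * ((1 - PowerSeries.X ^ a) * (1 - PowerSeries.X ^ c)) =
          (zPoly (cartan b) o P₁ P₂ i : PowerSeries ℤ)) ∧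
        poincareSeries x o * ((1 - PowerSeries.X ^ a) * (1 - PowerSeries.X ^ c)) =
          1 + PowerSeries.X ^ h

end Formula

end McKaySlodowy

end

/-!
Write `T` for the operator `adjOp b` on the lattice `⨁ ℤ α i`, which describes multiplication by
the character of `V`, and `o` for the special index. Over the complex numbers everything about
multiplicities is a statement on characters (`nonempty_equiv_of_character_eq`,
`hasMultiplicities_iff`). An element of `SL(2, ℂ)` of finite order is diagonalizable with
eigenvalues `c, c⁻¹`, so the characters of the symmetric powers satisfy
`χ (k + 2) = χ_V χ (k + 1) - χ k` (`character_symPowRep_add_two`). Hence in all three cases the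
vectors `x k` of multiplicities satisfy `x 0 = α o`, `x 1 = T α o`, `x (k + 2) = T x (k + 1) - x k`,
that is, `(1 + t ^ 2 - t T) X(t) = α o`. Kostant's formula therefore says that `z(t)` solves
`(1 + t ^ 2 - t T) z(t) = (1 - t ^ a) (1 - t ^ c) α o`, where `c = h + 2 - a`; the coefficients of
the solution of this equation are called `kostantSeq`.

The increments of the orbit of a vector under the alternating products `𝒞^(k)` obey the Chebyshev
recursion `y (k + 2) = F y (k + 1) - y k`, where `F` is `T` with the coefficient of `α o` dropped
(`altDiff_add_two`). So two facts about the diagram suffice. First, `kostantSeq` has to be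
non-negative, of degree `h`, with `α o` only at both ends; then it agrees with `z`
(`altDiff_eq_kostantSeq`), and by non-negativity the orbit of `α o` does not close up early, which
bounds the order of the Coxeter element from below. Second, the Chebyshev polynomial `S_{h-1}` has
to vanish at `F`; then the increments have period `2 h`, and their sum over a period vanishes because
`S_{h-1}(2) = h ≠ 0`, so that the `h`-th power of the Coxeter element is `1`
(`coxeterNumber_eq`). The structure `IsKostant T o h d` records these two facts for `a = 2 d`, and
`poincareSeries_eq` is the formula for every diagram that satisfies them.

It remains to prove `IsKostant` with `d` the maximal dimension of an irreducible module. For the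
irreducible modules of a group of even order, `-1` lies in the group and acts by a sign on each of
them, `V` is faithful and self-dual, and the dimension `δ` satisfies `T δ = 2 δ`: the McKay graph is
connected and bipartite and `δ` is additive on it (`isAffineDiagram_mckay`). Following the weights
`1, 2, …` from the special vertex to the first branching determines such graphs up to type `A`, `D`
or `E` (`IsAffineDiagram.exists_isKostant`). A diagram of type `A` or `D` may have any length, so
`kostantSeq` is followed along it; its end is reached because the vectors met on the way would
otherwise be pairwise distinct. The three exceptional diagrams are finite computations.

The other two cases follow from the McKay graph of `N`. Induction maps the irreducible characters
of `N` onto the family of induced modules and commutes with multiplication by the character of `V`,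
and `IsKostant` descends along such a quotient (`IsKostant.push`). Restriction embeds the lattice of
the restricted modules into the lattice of irreducible characters of `N`, where distinct restricted
modules have disjoint supports, and `IsKostant` is inherited by such a sublattice
(`IsKostant.pull`).

For a distinguished pair the quotient has order at most four, hence is commutative. It acts on the
space of `N`-maps between two irreducible `G`-modules; a common eigenvector has `G`-stable kernel
and range, and so is an isomorphism as soon as there is a nonzero `N`-map at all
(`restrictionsSeparate_of_mul_comm`).
-/

noncomputable section

namespace McKaySlodowy

/-! ### The Coxeter element and Kostant's recursion -/

section Core

open Polynomial

variable {I : Type} [Fintype I] [DecidableEq I]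

/-- The operator on the root lattice with `α j ↦ ∑ i, b j i • α i`. For the matrix of
multiplicities in `V ⊗ M j ≅ ⨁ i, b j i • M i` it describes the effect of `V ⊗ -`. -/
def adjOp (b : Matrix I I ℕ) : Module.End ℤ (I → ℤ) :=
  (b.map fun n => (n : ℤ)).transpose.mulVecLin

theorem adjOp_apply (b : Matrix I I ℕ) (v : I → ℤ) (i : I) :
    adjOp b v i = ∑ j, (b j i : ℤ) * v j := by
  simp only [adjOp, Matrix.mulVecLin_apply, Matrix.mulVec, dotProduct, Matrix.transpose_apply,
    Matrix.map_apply]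

theorem adjOp_simpleRoot (b : Matrix I I ℕ) (i j : I) :
    adjOp b (simpleRoot j) i = b j i := by
  simp [adjOp_apply, simpleRoot, Pi.single_apply]

theorem cartan_mulVec (b : Matrix I I ℕ) (v : I → ℤ) (i : I) :
    (cartan b).mulVec v i = 2 * v i - adjOp b v i := by
  simp only [cartan, adjOp, Matrix.sub_mulVec, Matrix.mulVecLin_apply, Pi.sub_apply]
  congr 1
  simp

theorem cartan_apply (b : Matrix I I ℕ) (i j : I) :
    cartan b i j = (if i = j then 2 else 0) - (b j i : ℤ) := by
  rw [cartan, Matrix.sub_apply, Matrix.smul_apply, Matrix.one_apply]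
  split_ifs <;> simp

/-- The projection of the root lattice that kills the coefficient of `α o`. -/
def offProj (o : I) : Module.End ℤ (I → ℤ) :=
  LinearMap.id - (LinearMap.toSpanSingleton ℤ (I → ℤ) (simpleRoot o)) ∘ₗ LinearMap.proj o

theorem offProj_apply (o : I) (v : I → ℤ) (i : I) :
    offProj o v i = if i = o then 0 else v i := by
  by_cases h : i = o
  · subst h; simp [offProj, simpleRoot]
  · simp [offProj, simpleRoot, h]

theorem offProj_eq_self {o : I} {v : I → ℤ} (h : v o = 0) : offProj o v = v := by
  ext i
  rw [offProj_apply]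
  split_ifs with hi
  · rw [hi, h]
  · rfl

theorem offProj_simpleRoot (o : I) : offProj o (simpleRoot o) = 0 := by
  ext i
  rw [offProj_apply]
  split_ifs with hi <;> simp [simpleRoot, hi]

/-- The operator `T` cut down to the lattice spanned by the `α i` with `i ≠ o`. -/
def cutOp (T : Module.End ℤ (I → ℤ)) (o : I) : Module.End ℤ (I → ℤ) :=
  offProj o ∘ₗ T

theorem cutOp_apply_self (T : Module.End ℤ (I → ℤ)) (o : I) (v : I → ℤ) :
    cutOp T o v o = 0 := by
  simp [cutOp, offProj_apply]

/-- The coefficient of `t ^ k` in `(1 - t ^ a) * (1 - t ^ c)`. -/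
def kostantCoeff (a c k : ℕ) : ℤ :=
  (if k = 0 then 1 else 0) - (if k = a then 1 else 0) - (if k = c then 1 else 0) +
    (if k = a + c then 1 else 0)

/-- The coefficients of the solution `z` of `(1 + t ^ 2 - t T) z = (1 - t ^ a) (1 - t ^ c) α o`
(for `a, c ≥ 2`). -/
def kostantSeq (T : Module.End ℤ (I → ℤ)) (o : I) (a c : ℕ) : ℕ → (I → ℤ)
  | 0 => simpleRoot o
  | 1 => T (simpleRoot o)
  | k + 2 => T (kostantSeq T o a c (k + 1)) - kostantSeq T o a c k +
      kostantCoeff a c (k + 2) • simpleRoot o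

theorem kostantSeq_unique (T : Module.End ℤ (I → ℤ)) (o : I) (a c : ℕ) (z : ℕ → I → ℤ)
    (h0 : z 0 = simpleRoot o) (h1 : z 1 = T (simpleRoot o))
    (h2 : ∀ k, z (k + 2) = T (z (k + 1)) - z k + kostantCoeff a c (k + 2) • simpleRoot o) (k : ℕ) :
    kostantSeq T o a c k = z k := by
  induction k using Nat.twoStepInduction with
  | zero => rw [h0]; rfl
  | one => rw [h1]; rfl
  | more k ih1 ih2 => rw [h2, ← ih1, ← ih2]; rfl

/-- The arithmetic of an affine diagram, with operator `T` and special vertex `o`, that Kostant's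
formula with exponents `a = 2 d`, `c = h + 2 - 2 d` and `h` rests on: the series
`(1 - t ^ a) (1 - t ^ c) (1 + t ^ 2 - t T)⁻¹ α o` is a polynomial of degree `h` with
non-negative coefficients, in which `α o` occurs only at both ends; and the Chebyshev polynomial
`S_{h-1}` kills the diagram without `o`, that is, the eigenvalues of the latter are of the form
`2 cos (m π / h)`. -/
structure IsKostant (T : Module.End ℤ (I → ℤ)) (o : I) (h d : ℕ) : Prop where
  one_le : 1 ≤ d
  two_mul_le : 2 * d ≤ h
  nonneg : ∀ k i, 0 ≤ kostantSeq T o (2 * d) (h + 2 - 2 * d) k i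
  ne_zero : T (simpleRoot o) ≠ 0
  apply_special : ∀ k, 0 < k → k < h → kostantSeq T o (2 * d) (h + 2 - 2 * d) k o = 0
  top : kostantSeq T o (2 * d) (h + 2 - 2 * d) h = simpleRoot o
  beyond : ∀ k, h < k → kostantSeq T o (2 * d) (h + 2 - 2 * d) k = 0
  cheb : ∀ u : I → ℤ, u o = 0 → aeval (cutOp T o) (Chebyshev.S ℤ ((h : ℤ) - 1)) u = 0

theorem simpleReflection_apply (A : Matrix I I ℤ) (r : I) (v : I → ℤ) :
    simpleReflection A r v = v - A.mulVec v r • simpleRoot r := by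
  simp [simpleReflection, Module.preReflection_apply]

/-- The product of reflections in mutually orthogonal roots subtracts all their components at
once. -/
theorem reflectionProd_apply {A : Matrix I I ℤ} {P : Finset I}
    (hP : ∀ i ∈ P, ∀ j ∈ P, i ≠ j → A i j = 0) (v : I → ℤ) (i : I) :
    reflectionProd A P v i = if i ∈ P then v i - A.mulVec v i else v i := by
  have key : ∀ l : List I, l.Nodup → (∀ i ∈ l, ∀ j ∈ l, i ≠ j → A i j = 0) →
      (l.map (simpleReflection A)).prod v =
        fun i => if i ∈ l then v i - A.mulVec v i else v i := by
    intro l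
    induction l with
    | nil => intro _ _; simp
    | cons r l ih =>
      intro hnd horth
      rw [List.nodup_cons] at hnd
      have ih' := ih hnd.2 (fun i hi j hj => horth i (by simp [hi]) j (by simp [hj]))
      rw [List.map_cons, List.prod_cons, Module.End.mul_apply, ih', simpleReflection_apply]
      have hw : A.mulVec (fun i => if i ∈ l then v i - A.mulVec v i else v i) r =
          A.mulVec v r := by
        simp only [Matrix.mulVec, dotProduct]
        refine Finset.sum_congr rfl fun j _ => ?_
        by_cases hj : j ∈ l
        · rw [horth r (by simp) j (by simp [hj]) (by rintro rfl; exact hnd.1 hj)]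
          simp
        · simp [hj]
      rw [hw]
      ext i
      by_cases hir : i = r
      · subst hir; simp [hnd.1, simpleRoot]
      · simp [hir, simpleRoot]
  have := key P.toList P.nodup_toList (by simpa using hP)
  rw [reflectionProd, this]
  simp

section Bipartition

variable {b : Matrix I I ℕ} {o : I} {P₁ P₂ : Finset I}

/-- The class whose reflections form the `k`-th factor of the alternating product. -/
def altClass (P₁ P₂ : Finset I) (k : ℕ) : Finset I := if Odd k then P₁ else P₂

theorem IsBipartition.special_notMem (hP : IsBipartition (cartan b) o P₁ P₂) (k : ℕ) :
    o ∉ altClass P₁ P₂ k := by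
  have h : o ∉ P₁ ∪ P₂ := by rw [hP.union_eq]; simp
  rw [Finset.mem_union, not_or] at h
  unfold altClass
  split_ifs
  exacts [h.1, h.2]

theorem IsBipartition.orthogonal (hP : IsBipartition (cartan b) o P₁ P₂) (k : ℕ) :
    ∀ i ∈ altClass P₁ P₂ k, ∀ j ∈ altClass P₁ P₂ k, i ≠ j → cartan b i j = 0 := by
  unfold altClass
  split_ifs
  · exact hP.orthogonal₁
  · exact fun i hi j hj => hP.orthogonal₂ i (by simp [hi]) j (by simp [hj])

theorem altClass_add_two (k : ℕ) : altClass P₁ P₂ (k + 2) = altClass P₁ P₂ k := by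
  have : Odd (k + 2) ↔ Odd k := by grind
  simp [altClass, this]

theorem IsBipartition.mem_succ_iff (hP : IsBipartition (cartan b) o P₁ P₂) {k : ℕ} {i : I}
    (hi : i ≠ o) : i ∈ altClass P₁ P₂ (k + 1) ↔ i ∉ altClass P₁ P₂ k := by
  have h1 : i ∈ P₁ ∪ P₂ := by rw [hP.union_eq]; simp [hi]
  rw [Finset.mem_union] at h1
  have h2 : i ∈ P₁ → i ∉ P₂ := fun h h' => Finset.disjoint_left.1 hP.disjoint h h'
  have h3 : Odd (k + 1) ↔ ¬ Odd k := by grind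
  by_cases hk : Odd k <;> simp only [altClass, h3, hk] <;> grind

/-- Applying `T` to a vector supported on one class and dropping the coefficient of `α o` gives a
vector supported on the other class. -/
theorem IsBipartition.adjOp_eq_zero (hP : IsBipartition (cartan b) o P₁ P₂)
    (hb : ∀ i, b i i = 0) {k : ℕ} {y : I → ℤ} (hy : ∀ i, i ∉ altClass P₁ P₂ k → y i = 0) {i : I}
    (hi : i ∈ altClass P₁ P₂ k) : adjOp b y i = 0 := by
  rw [adjOp_apply]
  refine Finset.sum_eq_zero fun j _ => ?_
  by_cases hj : j ∈ altClass P₁ P₂ k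
  · by_cases hij : i = j
    · simp [hij, hb]
    · have := hP.orthogonal k i hi j hj hij
      rw [cartan_apply, if_neg hij] at this
      have h' : (b j i : ℤ) = 0 := by linarith
      simp [h']
  · simp [hy j hj]

/-- The increment `𝒞^(k+1) u - 𝒞^(k) u` of the orbit of `u` under the alternating products. -/
def altDiff (b : Matrix I I ℕ) (P₁ P₂ : Finset I) (u : I → ℤ) (k : ℕ) : I → ℤ :=
  altProd (cartan b) P₁ P₂ (k + 1) u - altProd (cartan b) P₁ P₂ k u

theorem altDiff_apply (hP : IsBipartition (cartan b) o P₁ P₂) (u : I → ℤ) (k : ℕ) (i : I) :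
    altDiff b P₁ P₂ u k i = if i ∈ altClass P₁ P₂ (k + 1) then
      adjOp b (altProd (cartan b) P₁ P₂ k u) i - 2 * altProd (cartan b) P₁ P₂ k u i else 0 := by
  have h := reflectionProd_apply (hP.orthogonal (k + 1)) (altProd (cartan b) P₁ P₂ k u) i
  simp only [altDiff, Pi.sub_apply, altProd, Module.End.mul_apply]
  change reflectionProd (cartan b) (altClass P₁ P₂ (k + 1)) _ i - _ = _
  rw [h, cartan_mulVec]
  split_ifs <;> ring

theorem altDiff_apply_special (hP : IsBipartition (cartan b) o P₁ P₂) (u : I → ℤ) (k : ℕ) :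
    altDiff b P₁ P₂ u k o = 0 := by
  rw [altDiff_apply hP, if_neg (hP.special_notMem _)]

theorem altProd_succ_apply (u : I → ℤ) (k : ℕ) :
    altProd (cartan b) P₁ P₂ (k + 1) u =
      altProd (cartan b) P₁ P₂ k u + altDiff b P₁ P₂ u k := by
  simp [altDiff]

/-- The increments of the alternating products satisfy the recursion of Chebyshev polynomials in
the diagram without `o`. -/
theorem altDiff_add_two (hP : IsBipartition (cartan b) o P₁ P₂) (hb : ∀ i, b i i = 0)
    (u : I → ℤ) (k : ℕ) :
    altDiff b P₁ P₂ u (k + 2) =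
      cutOp (adjOp b) o (altDiff b P₁ P₂ u (k + 1)) - altDiff b P₁ P₂ u k := by
  have hsupp : ∀ m i, i ∉ altClass P₁ P₂ (m + 1) → altDiff b P₁ P₂ u m i = 0 := fun m i hi => by
    rw [altDiff_apply hP, if_neg hi]
  ext i
  by_cases hio : i = o
  · subst hio
    simp [altDiff_apply_special hP, cutOp_apply_self]
  simp only [Pi.sub_apply, cutOp, LinearMap.comp_apply, offProj_apply, if_neg hio]
  by_cases hi : i ∈ altClass P₁ P₂ (k + 1)
  · have hi2 : i ∉ altClass P₁ P₂ (k + 1 + 1) := by rw [hP.mem_succ_iff hio]; simpa using hi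
    have hi3 : i ∈ altClass P₁ P₂ (k + 2 + 1) := by
      rw [show k + 2 + 1 = k + 1 + 2 by ring, altClass_add_two]; exact hi
    have e1 := altDiff_apply hP u k i
    rw [if_pos hi] at e1
    have e3 := altDiff_apply hP u (k + 2) i
    rw [if_pos hi3, show k + 2 = k + 1 + 1 by ring, altProd_succ_apply,
      altProd_succ_apply, map_add, map_add] at e3
    simp only [Pi.add_apply] at e3
    -- the reflections of the `k`-th factor flip the sign of their components
    have e4 : adjOp b (altDiff b P₁ P₂ u k) i = 0 := hP.adjOp_eq_zero hb (hsupp k) hi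
    rw [hsupp (k + 1) i hi2, e4] at e3
    rw [show k + 2 = k + 1 + 1 by ring, e3, e1]
    ring
  · have hi3 : i ∉ altClass P₁ P₂ (k + 2 + 1) := by
      rw [show k + 2 + 1 = k + 1 + 2 by ring, altClass_add_two]; exact hi
    have hi2 : i ∈ altClass P₁ P₂ (k + 1 + 1) := by rw [hP.mem_succ_iff hio]; exact hi
    rw [hsupp _ i hi3, hsupp _ i hi, hP.adjOp_eq_zero hb (hsupp (k + 1)) hi2]
    ring

theorem altDiff_eq_cheb (hP : IsBipartition (cartan b) o P₁ P₂) (hb : ∀ i, b i i = 0)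
    (u : I → ℤ) (k m : ℕ) :
    altDiff b P₁ P₂ u (m + 1 + k) =
      aeval (cutOp (adjOp b) o) (Chebyshev.S ℤ (k : ℤ)) (altDiff b P₁ P₂ u (m + 1)) -
      aeval (cutOp (adjOp b) o) (Chebyshev.S ℤ ((k : ℤ) - 1)) (altDiff b P₁ P₂ u m) := by
  induction k using Nat.twoStepInduction with
  | zero => simp
  | one => simp [altDiff_add_two hP hb]
  | more k ih1 ih2 =>
    rw [show m + 1 + (k + 2) = (m + 1 + k) + 2 by ring, altDiff_add_two hP hb,
      show m + 1 + k + 1 = m + 1 + (k + 1) by ring, ih1, ih2]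
    push_cast
    rw [show (k : ℤ) + 2 - 1 = ((k : ℤ) - 1) + 2 by ring, Chebyshev.S_add_two,
      Chebyshev.S_add_two, show (k : ℤ) - 1 + 1 = k + 1 - 1 by ring]
    simp only [map_sub, map_mul, aeval_X, LinearMap.sub_apply, Module.End.mul_apply]
    abel

theorem altProd_two_mul (k : ℕ) :
    altProd (cartan b) P₁ P₂ (2 * k) =
      (reflectionProd (cartan b) P₂ * reflectionProd (cartan b) P₁) ^ k := by
  induction k with
  | zero => rfl
  | succ k ih =>
    rw [show 2 * (k + 1) = 2 * k + 1 + 1 by ring, altProd, altProd, ih, pow_succ']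
    have h1 : ¬ Odd (2 * k + 1 + 1) := by grind
    have h2 : Odd (2 * k + 1) := by grind
    rw [if_neg h1, if_pos h2, mul_assoc]

theorem altProd_eq_add_sum (u : I → ℤ) (k : ℕ) :
    altProd (cartan b) P₁ P₂ k u = u + ∑ m ∈ Finset.range k, altDiff b P₁ P₂ u m := by
  simp only [altDiff]
  rw [Finset.sum_range_sub (fun m => altProd (cartan b) P₁ P₂ m u)]
  simp [altProd]

theorem coxeter_pow_eq_one {h d : ℕ} (hP : IsBipartition (cartan b) o P₁ P₂)
    (hb : ∀ i, b i i = 0) (hK : IsKostant (adjOp b) o h d) :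
    (reflectionProd (cartan b) P₂ * reflectionProd (cartan b) P₁) ^ h = 1 := by
  have h2 : 2 ≤ h := by have := hK.one_le; have := hK.two_mul_le; omega
  rw [← altProd_two_mul]
  refine LinearMap.ext fun u => ?_
  set F := cutOp (adjOp b) o
  set y := altDiff b P₁ P₂ u
  have hy0 : ∀ k, y k o = 0 := altDiff_apply_special hP u
  -- half a period: the operator `-S_{h-2}` is an involution modulo `S_{h-1}`
  have hhalf : ∀ m, y (m + h) = - aeval F (Chebyshev.S ℤ ((h : ℤ) - 2)) (y m) := by
    intro m
    obtain ⟨n, rfl⟩ : ∃ n, h = n + 1 := ⟨h - 1, by omega⟩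
    have := altDiff_eq_cheb hP hb u n m
    have hc := hK.cheb (y (m + 1)) (hy0 _)
    rw [show ((n + 1 : ℕ) : ℤ) - 1 = n by push_cast; ring] at hc
    rw [show m + (n + 1) = m + 1 + n by ring, show ((n + 1 : ℕ) : ℤ) - 2 = n - 1 by push_cast; ring]
    refine this.trans ?_
    rw [hc, zero_sub]
  have hper : ∀ m, y (m + 2 * h) = y m := by
    intro m
    rw [show m + 2 * h = m + h + h by ring, hhalf, hhalf, map_neg, neg_neg,
      ← Module.End.mul_apply, ← map_mul]
    have hsq := Chebyshev.S_sq_add_S_sq ℤ ((h : ℤ) - 2)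
    rw [show (h : ℤ) - 2 + 1 = h - 1 by ring] at hsq
    have : Chebyshev.S ℤ ((h : ℤ) - 2) * Chebyshev.S ℤ ((h : ℤ) - 2) =
        1 + (X * Chebyshev.S ℤ ((h : ℤ) - 2) - Chebyshev.S ℤ ((h : ℤ) - 1)) *
          Chebyshev.S ℤ ((h : ℤ) - 1) := by linear_combination hsq
    rw [this]
    simp [hK.cheb (y m) (hy0 m), F]
  set Y := ∑ m ∈ Finset.range (2 * h), y m with hY
  have hshift : ∀ j, ∑ m ∈ Finset.range (2 * h), y (m + j) = Y := by
    intro j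
    induction j with
    | zero => rfl
    | succ j ih =>
      rw [← ih]
      have := Finset.sum_range_succ' (fun m => y (m + j)) (2 * h)
      rw [Finset.sum_range_succ, show 2 * h + j = j + 2 * h by ring, hper, zero_add] at this
      have h' := add_right_cancel this
      rw [h']
      exact Finset.sum_congr rfl fun m _ => by ring_nf
  have hFY : F Y = (2 : ℤ) • Y := by
    have e : ∀ m, F (y (m + 1)) = y (m + 2) + y m := by
      intro m
      have := altDiff_add_two hP hb u m
      change y (m + 2) = F (y (m + 1)) - y m at this
      rw [this]; abel
    calc F Y = ∑ m ∈ Finset.range (2 * h), F (y (m + 1)) := by rw [← map_sum, hshift]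
      _ = _ := by simp_rw [e]; rw [Finset.sum_add_distrib, hshift, two_smul]
  have hY0 : Y o = 0 := by simp [hY, hy0]
  -- `S_{h-1}(2) = h`, so the diagram without `o` does not have the eigenvalue `2`
  have heig : ∀ p : ℤ[X], aeval F p Y = (p.eval 2) • Y := by
    intro p
    induction p using Polynomial.induction_on' with
    | add p q hp hq => rw [map_add, LinearMap.add_apply, hp, hq, eval_add, add_smul]
    | monomial n a =>
      rw [aeval_monomial, eval_monomial, Module.End.mul_apply]
      have : ∀ n, (F ^ n) Y = (2 ^ n : ℤ) • Y := by
        intro n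
        induction n with
        | zero => simp
        | succ n ih => rw [pow_succ', Module.End.mul_apply, ih, map_smul, hFY, smul_smul, pow_succ]
      rw [this]
      simp [mul_smul]
  have hYz : Y = 0 := by
    have h1 := hK.cheb Y hY0
    rw [heig, Chebyshev.S_eval_two] at h1
    simp only [Int.cast_sub, Int.cast_natCast, Int.cast_one, sub_add_cancel] at h1
    have : (h : ℤ) ≠ 0 := by omega
    exact (smul_eq_zero.1 h1).resolve_left this
  rw [altProd_eq_add_sum]
  change u + Y = u
  rw [hYz, add_zero]

/-- Below the Coxeter number the increments of the orbit of `α o` are the coefficients of `z`. -/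
theorem altDiff_eq_kostantSeq {h d : ℕ} (hP : IsBipartition (cartan b) o P₁ P₂)
    (hb : ∀ i, b i i = 0) (hK : IsKostant (adjOp b) o h d) (k : ℕ) (hk : k + 1 < h) :
    altDiff b P₁ P₂ (simpleRoot o) k = kostantSeq (adjOp b) o (2 * d) (h + 2 - 2 * d) (k + 1) := by
  have hz2 : ∀ k, k + 2 < h → kostantSeq (adjOp b) o (2 * d) (h + 2 - 2 * d) (k + 2) =
      cutOp (adjOp b) o (kostantSeq (adjOp b) o (2 * d) (h + 2 - 2 * d) (k + 1)) -
        offProj o (kostantSeq (adjOp b) o (2 * d) (h + 2 - 2 * d) k) := by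
    intro k hk
    rw [← offProj_eq_self (hK.apply_special (k + 2) (by omega) hk), kostantSeq]
    rw [map_add, map_sub, map_smul, offProj_simpleRoot, smul_zero, add_zero]
    rfl
  have horth : ∀ i, i ∉ altClass P₁ P₂ 1 → adjOp b (simpleRoot o) i = 0 := by
    intro i hi
    by_cases hio : i = o
    · rw [hio, adjOp_simpleRoot, hb]; rfl
    · have hi0 : i ∈ P₂ := by
        have : i ∉ altClass P₁ P₂ (1 + 1) → i ∈ altClass P₁ P₂ 1 := fun h => by
          have := hP.mem_succ_iff (k := 1) hio
          tauto
        have h2 : i ∈ altClass P₁ P₂ (1 + 1) := by tauto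
        rwa [altClass, if_neg (by decide)] at h2
      have := hP.orthogonal₂ i (by simp [hi0]) o (by simp) hio
      rw [cartan_apply, if_neg hio] at this
      rw [adjOp_simpleRoot]; linarith
  have hd0 : altDiff b P₁ P₂ (simpleRoot o) 0 = adjOp b (simpleRoot o) := by
    ext i
    rw [altDiff_apply hP]
    split_ifs with hi
    · have hio : i ≠ o := by rintro rfl; exact hP.special_notMem _ hi
      simp [altProd, simpleRoot, hio]
    · exact (horth i hi).symm
  induction k using Nat.twoStepInduction with
  | zero => rw [hd0]; rfl
  | one =>
    rw [hz2 0 hk, kostantSeq, kostantSeq, offProj_simpleRoot, sub_zero]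
    ext i
    rw [altDiff_apply hP, altProd_succ_apply, hd0]
    simp only [cutOp, LinearMap.comp_apply, offProj_apply]
    have hsupp : ∀ i, i ∉ altClass P₁ P₂ 1 → adjOp b (simpleRoot o) i = 0 := horth
    by_cases hio : i = o
    · rw [if_pos hio, hio, if_neg (hP.special_notMem _)]
    rw [if_neg hio]
    by_cases hi : i ∈ altClass P₁ P₂ (1 + 1)
    · have hi1 : i ∉ altClass P₁ P₂ 1 := (hP.mem_succ_iff hio).1 hi
      rw [if_pos hi]
      have h0 : simpleRoot o i = 0 := by simp [simpleRoot, hio]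
      simp [altProd, horth i hi1, h0]
    · have hi1 : i ∈ altClass P₁ P₂ 1 := by
        by_contra h'; exact hi ((hP.mem_succ_iff hio).2 h')
      rw [if_neg hi, hP.adjOp_eq_zero hb hsupp hi1]
  | more k ih1 ih2 =>
    rw [altDiff_add_two hP hb, ih1 (by omega), ih2 (by omega), hz2 (k + 1) hk,
      offProj_eq_self (hK.apply_special (k + 1) (by omega) (by omega))]

theorem coxeterNumber_eq {h d : ℕ} (hP : IsBipartition (cartan b) o P₁ P₂)
    (hb : ∀ i, b i i = 0) (hK : IsKostant (adjOp b) o h d) :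
    coxeterNumber (cartan b) P₁ P₂ = h := by
  have h2 : 2 ≤ h := by have := hK.one_le; have := hK.two_mul_le; omega
  have hpow := coxeter_pow_eq_one hP hb hK
  set cox := reflectionProd (cartan b) P₂ * reflectionProd (cartan b) P₁ with hcox
  -- the orbit of `α o` increases for `h - 1` steps
  have hne : ∀ n, 0 < n → n < h →
      ∑ m ∈ Finset.range n, altDiff b P₁ P₂ (simpleRoot o) m ≠ 0 := by
    intro n hn hnh hs
    apply hK.ne_zero
    have h1 : ∀ m ∈ Finset.range n, altDiff b P₁ P₂ (simpleRoot o) m =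
        kostantSeq (adjOp b) o (2 * d) (h + 2 - 2 * d) (m + 1) := fun m hm => by
      rw [Finset.mem_range] at hm
      exact altDiff_eq_kostantSeq hP hb hK m (by omega)
    rw [Finset.sum_congr rfl h1] at hs
    have hs0 := (Finset.sum_eq_zero_iff_of_nonneg
      (fun m _ => fun i => hK.nonneg (m + 1) i)).1 hs 0 (by simpa using hn)
    exact hs0
  have hlow : ∀ m, 0 < m → 2 * m ≤ h → cox ^ m ≠ 1 := by
    intro m hm hmh h1
    have e : altProd (cartan b) P₁ P₂ (2 * m) (simpleRoot o) = simpleRoot o := by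
      rw [altProd_two_mul, ← hcox, h1]; rfl
    rw [altProd_eq_add_sum, add_eq_left] at e
    rcases hmh.lt_or_eq with hlt | heq
    · exact hne _ (by omega) hlt e
    · obtain ⟨n, hn⟩ : ∃ n, h = n + 2 := ⟨h - 2, by omega⟩
      rw [heq, hn, Finset.sum_range_succ] at e
      -- the `h`-th step is trivial
      have hz : altDiff b P₁ P₂ (simpleRoot o) (n + 1) = 0 := by
        have hn' : n ≠ 0 := by
          rintro rfl
          obtain rfl : m = 1 := by omega
          rw [pow_one] at h1
          have h3 : cox (simpleRoot o) o = 1 := by rw [h1]; simp [simpleRoot]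
          have h4 : altProd (cartan b) P₁ P₂ 2 (simpleRoot o) = simpleRoot o := by
            have := altProd_two_mul (b := b) (P₁ := P₁) (P₂ := P₂) 1
            rw [mul_one, pow_one, ← hcox, h1] at this
            rw [this]; rfl
          have h5 := altProd_eq_add_sum (b := b) (P₁ := P₁) (P₂ := P₂) (simpleRoot o) 2
          rw [h4, left_eq_add, Finset.sum_range_succ, Finset.sum_range_one] at h5
          have h6 := altDiff_eq_kostantSeq hP hb hK 0 (by omega)
          apply hK.ne_zero
          change altDiff b P₁ P₂ (simpleRoot o) 0 = adjOp b (simpleRoot o) at h6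
          rw [← h6]
          ext i
          have h7 := congrFun h5 i
          simp only [Pi.add_apply, Pi.zero_apply] at h7 ⊢
          by_cases hio : i = o
          · rw [hio, altDiff_apply_special hP]
          by_cases hi : i ∈ altClass P₁ P₂ 1
          · have : altDiff b P₁ P₂ (simpleRoot o) 1 i = 0 := by
              rw [altDiff_apply hP, if_neg]
              rw [hP.mem_succ_iff hio]; simpa using hi
            linarith
          · rw [altDiff_apply hP, if_neg hi]
        obtain ⟨p, rfl⟩ : ∃ p, n = p + 1 := ⟨n - 1, by omega⟩
        have hp := hK.top
        rw [hn, kostantSeq] at hp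
        rw [altDiff_add_two hP hb, altDiff_eq_kostantSeq hP hb hK (p + 1) (by omega),
          altDiff_eq_kostantSeq hP hb hK p (by omega)]
        have hp' := congrArg (offProj o) hp
        rw [map_add, map_sub, map_smul, offProj_simpleRoot, smul_zero, add_zero] at hp'
        rw [← offProj_eq_self (hK.apply_special (p + 1) (by omega) (by omega))]
        subst hn
        exact hp'
      rw [hz, add_zero] at e
      exact hne (n + 1) (by omega) (by omega) e
  rw [coxeterNumber, ← hcox, orderOf_eq_iff (by omega)]
  refine ⟨hpow, fun m hmh hm h1 => ?_⟩
  rcases le_or_gt (2 * m) h with hle | hgt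
  · exact hlow m hm hle h1
  · refine hlow (h - m) (by omega) (by omega) ?_
    have : cox ^ (h - m) * cox ^ m = 1 := by rw [← pow_add, Nat.sub_add_cancel hmh.le, hpow]
    rwa [h1, mul_one] at this

theorem zVec_eq {h d : ℕ} (hP : IsBipartition (cartan b) o P₁ P₂)
    (hb : ∀ i, b i i = 0) (hK : IsKostant (adjOp b) o h d) (k : ℕ) (hk : k ≤ h) :
    zVec (cartan b) o P₁ P₂ k = kostantSeq (adjOp b) o (2 * d) (h + 2 - 2 * d) k := by
  rw [zVec, coxeterNumber_eq hP hb hK]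
  split_ifs with h1
  · rcases h1 with rfl | rfl
    · rfl
    · exact hK.top.symm
  · rw [not_or] at h1
    obtain ⟨m, rfl⟩ : ∃ m, k = m + 1 := ⟨k - 1, by omega⟩
    rw [← altDiff_eq_kostantSeq hP hb hK m (by omega)]
    rfl

end Bipartition

end Core

section Series

variable {I : Type} [Fintype I] [DecidableEq I]

/-- A sequence with `z (k + 2) = T (z (k + 1)) - z k + r (k + 2) • α o` solves
`(1 + t ^ 2 - t T) z = r α o` as a vector of power series. -/
theorem series_eq_of_recursion (b : Matrix I I ℕ) (o : I) (r : ℕ → ℤ) (z : ℕ → I → ℤ)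
    (hr0 : r 0 = 1) (hr1 : r 1 = 0) (h0 : z 0 = simpleRoot o) (h1 : z 1 = adjOp b (simpleRoot o))
    (h2 : ∀ k, z (k + 2) = adjOp b (z (k + 1)) - z k + r (k + 2) • simpleRoot o) (i : I) :
    (1 + PowerSeries.X ^ 2) * PowerSeries.mk (fun k => z k i) -
      PowerSeries.X * ∑ j, PowerSeries.C (b j i : ℤ) * PowerSeries.mk (fun k => z k j) =
      PowerSeries.C (simpleRoot o i) * PowerSeries.mk r := by
  ext n
  rw [add_mul, one_mul, map_sub, map_add, PowerSeries.coeff_C_mul]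
  match n with
  | 0 => simp [h0, hr0, PowerSeries.coeff_zero_X_mul]
  | 1 =>
    rw [PowerSeries.coeff_X_pow_mul', show (1 : ℕ) = 0 + 1 from rfl, PowerSeries.coeff_succ_X_mul]
    simp [h0, h1, hr1, adjOp_apply]
  | k + 2 =>
    rw [PowerSeries.coeff_X_pow_mul', if_pos (by omega), Nat.add_sub_cancel,
      show k + 2 = (k + 1) + 1 from rfl, PowerSeries.coeff_succ_X_mul]
    simp only [map_sum, PowerSeries.coeff_C_mul, PowerSeries.coeff_mk, h2, Pi.add_apply,
      Pi.sub_apply, Pi.smul_apply, adjOp_apply, smul_eq_mul]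
    ring

/-- The equation `(1 + t ^ 2 - t T) D = 0` has only the zero solution in power series. -/
theorem series_eq_zero (b : Matrix I I ℕ) (D : I → PowerSeries ℤ)
    (hD : ∀ i, (1 + PowerSeries.X ^ 2) * D i -
      PowerSeries.X * ∑ j, PowerSeries.C (b j i : ℤ) * D j = 0) (i : I) : D i = 0 := by
  have key : ∀ n i, PowerSeries.coeff n (D i) = 0 := by
    intro n
    induction n using Nat.strong_induction_on with
    | _ n ih =>
      intro i
      have h := congrArg (PowerSeries.coeff n) (hD i)
      rw [add_mul, one_mul, map_sub, map_add, PowerSeries.coeff_X_pow_mul', map_zero] at h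
      have h1 : (if 2 ≤ n then PowerSeries.coeff (n - 2) (D i) else 0) = 0 := by
        split_ifs
        · exact ih _ (by omega) i
        · rfl
      have h2 : PowerSeries.coeff n
          (PowerSeries.X * ∑ j, PowerSeries.C (b j i : ℤ) * D j) = 0 := by
        cases n with
        | zero => simp [PowerSeries.coeff_zero_X_mul]
        | succ n =>
          rw [PowerSeries.coeff_succ_X_mul, map_sum]
          refine Finset.sum_eq_zero fun j _ => ?_
          rw [PowerSeries.coeff_C_mul, ih n (by omega) j, mul_zero]
      rw [h1, h2] at h
      simpa using h
  ext n
  simp [key n i]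

theorem poincareSeries_eq {b : Matrix I I ℕ} {o : I} {h d : ℕ} {P₁ P₂ : Finset I}
    (hP : IsBipartition (cartan b) o P₁ P₂) (hb : ∀ i, b i i = 0)
    (hK : IsKostant (adjOp b) o h d) {x : ℕ → I → ℕ}
    (x0 : (fun i => (x 0 i : ℤ)) = simpleRoot o)
    (x1 : (fun i => (x 1 i : ℤ)) = adjOp b (simpleRoot o))
    (x2 : ∀ k, (fun i => (x (k + 2) i : ℤ)) =
      adjOp b (fun i => (x (k + 1) i : ℤ)) - fun i => (x k i : ℤ)) (i : I) :
    poincareSeries x i * ((1 - PowerSeries.X ^ (2 * d)) * (1 - PowerSeries.X ^ (h + 2 - 2 * d))) =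
      (zPoly (cartan b) o P₁ P₂ i : PowerSeries ℤ) := by
  have hd := hK.one_le
  have hdh := hK.two_mul_le
  set a := 2 * d with ha
  set c := h + 2 - a with hc
  set z := kostantSeq (adjOp b) o a c with hz
  have hzP : (zPoly (cartan b) o P₁ P₂ i : PowerSeries ℤ) = PowerSeries.mk (fun k => z k i) := by
    ext n
    rw [Polynomial.coeff_coe, zPoly, Polynomial.finsetSum_coeff, coxeterNumber_eq hP hb hK,
      PowerSeries.coeff_mk]
    simp only [Polynomial.coeff_monomial, Finset.sum_ite_eq', Finset.mem_range]
    split_ifs with hn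
    · rw [zVec_eq hP hb hK n (by omega)]
    · rw [hz, hK.beyond n (by omega)]; rfl
  have hE : (1 - PowerSeries.X ^ a) * (1 - PowerSeries.X ^ c) =
      PowerSeries.mk (kostantCoeff a c) := by
    ext n
    rw [show (1 - PowerSeries.X ^ a) * (1 - PowerSeries.X ^ c) =
      (1 : PowerSeries ℤ) - PowerSeries.X ^ a - PowerSeries.X ^ c + PowerSeries.X ^ (a + c) by ring]
    simp [kostantCoeff, PowerSeries.coeff_X_pow, PowerSeries.coeff_one]
  have hX := series_eq_of_recursion b o (fun k => if k = 0 then 1 else 0)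
    (fun k i => (x k i : ℤ)) rfl rfl x0 x1 (fun k => by rw [x2]; simp)
  have hZ := series_eq_of_recursion b o (kostantCoeff a c) z
    (by rw [kostantCoeff, if_pos rfl, if_neg (by omega), if_neg (by omega), if_neg (by omega)]; rfl)
    (by
      rw [kostantCoeff, if_neg (by omega), if_neg (by omega), if_neg (by omega),
        if_neg (by omega)]
      rfl)
    rfl rfl (fun k => rfl)
  have hone : PowerSeries.mk (fun k => if k = 0 then (1 : ℤ) else 0) = 1 := by
    ext n; simp [PowerSeries.coeff_one]
  rw [hzP, hE]
  rw [hone] at hX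
  have := series_eq_zero b (fun i => poincareSeries x i * PowerSeries.mk (kostantCoeff a c) -
    PowerSeries.mk (fun k => z k i)) (fun i => by
      have e1 := hX i
      have e2 := hZ i
      change (1 + PowerSeries.X ^ 2) * poincareSeries x i -
        PowerSeries.X * ∑ j, PowerSeries.C (b j i : ℤ) * poincareSeries x j = _ at e1
      have e3 : ∑ j, PowerSeries.C (b j i : ℤ) *
          (poincareSeries x j * PowerSeries.mk (kostantCoeff a c) -
            PowerSeries.mk (fun k => z k j)) =
          (∑ j, PowerSeries.C (b j i : ℤ) * poincareSeries x j) *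
            PowerSeries.mk (kostantCoeff a c) -
          ∑ j, PowerSeries.C (b j i : ℤ) * PowerSeries.mk (fun k => z k j) := by
        rw [Finset.sum_mul, ← Finset.sum_sub_distrib]
        exact Finset.sum_congr rfl fun j _ => by ring
      rw [e3]
      linear_combination PowerSeries.mk (kostantCoeff a c) * e1 - e2) i
  exact sub_eq_zero.1 this

theorem zPoly_special {b : Matrix I I ℕ} {o : I} {h d : ℕ} {P₁ P₂ : Finset I}
    (hP : IsBipartition (cartan b) o P₁ P₂) (hb : ∀ i, b i i = 0)
    (hK : IsKostant (adjOp b) o h d) :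
    (zPoly (cartan b) o P₁ P₂ o : PowerSeries ℤ) = 1 + PowerSeries.X ^ h := by
  have h2 : 0 < h := by have := hK.one_le; have := hK.two_mul_le; omega
  ext n
  rw [Polynomial.coeff_coe, zPoly, Polynomial.finsetSum_coeff, coxeterNumber_eq hP hb hK]
  simp only [Polynomial.coeff_monomial, Finset.sum_ite_eq', Finset.mem_range, map_add,
    PowerSeries.coeff_one, PowerSeries.coeff_X_pow]
  by_cases hn : n < h + 1
  · rw [if_pos hn, zVec_eq hP hb hK n (by omega)]
    rcases Nat.eq_zero_or_pos n with rfl | hn0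
    · simp [kostantSeq, simpleRoot, h2.ne]
    · rcases (Nat.lt_succ_iff.1 hn).lt_or_eq with hlt | rfl
      · rw [hK.apply_special n hn0 hlt, if_neg (by omega), if_neg (by omega), add_zero]
      · rw [hK.top, if_neg (by omega), if_pos rfl]; simp [simpleRoot]
  · rw [if_neg hn, if_neg (by omega), if_neg (by omega), add_zero]

end Series

/-! ### Passage between diagrams -/

section Transfer

open Polynomial

variable {I J : Type} [Fintype I] [DecidableEq I] [Fintype J] [DecidableEq J]

theorem kostantSeq_map {T : Module.End ℤ (J → ℤ)} {T' : Module.End ℤ (I → ℤ)} {o : J} {o' : I}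
    (f : (J → ℤ) →ₗ[ℤ] (I → ℤ)) (hT : ∀ v, f (T v) = T' (f v))
    (ho : f (simpleRoot o) = simpleRoot o') (a c k : ℕ) :
    f (kostantSeq T o a c k) = kostantSeq T' o' a c k := by
  refine (kostantSeq_unique T' o' a c (fun k => f (kostantSeq T o a c k)) ho ?_ ?_ k).symm
  · simp [kostantSeq, hT, ho]
  · intro k
    simp only [kostantSeq, map_add, map_sub, map_smul, hT, ho]

theorem aeval_cutOp_map {T : Module.End ℤ (J → ℤ)} {T' : Module.End ℤ (I → ℤ)} {o : J} {o' : I}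
    (f : (J → ℤ) →ₗ[ℤ] (I → ℤ)) (hT : ∀ v, f (T v) = T' (f v))
    (ho : f (simpleRoot o) = simpleRoot o') (hf : ∀ v, f v o' = v o) (p : ℤ[X]) (v : J → ℤ) :
    f (aeval (cutOp T o) p v) = aeval (cutOp T' o') p (f v) := by
  have hπ : ∀ v, f (offProj o v) = offProj o' (f v) := by
    intro v
    have h1 : offProj o v = v - v o • simpleRoot o := by simp [offProj]
    have h2 : offProj o' (f v) = f v - (f v) o' • simpleRoot o' := by simp [offProj]
    rw [h1, h2, hf, map_sub, map_smul, ho]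
  have hF : ∀ v, f (cutOp T o v) = cutOp T' o' (f v) := fun v => by
    simp only [cutOp, LinearMap.comp_apply, hπ, hT]
  induction p using Polynomial.induction_on' with
  | add p q hp hq => simp only [map_add, LinearMap.add_apply, hp, hq]
  | monomial n a =>
    have : ∀ n v, f ((cutOp T o ^ n) v) = (cutOp T' o' ^ n) (f v) := by
      intro n
      induction n with
      | zero => simp
      | succ n ih => intro v; rw [pow_succ, pow_succ, Module.End.mul_apply, ih, hF]; rfl
    rw [aeval_monomial, aeval_monomial, Module.End.mul_apply, Module.End.mul_apply, ← this,
      Module.algebraMap_end_apply, Module.algebraMap_end_apply, map_smul]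

/-- Kostant's arithmetic descends along a surjection of diagrams. -/
theorem IsKostant.push {T : Module.End ℤ (J → ℤ)} {T' : Module.End ℤ (I → ℤ)} {o : J} {o' : I}
    {h d : ℕ} (hK : IsKostant T o h d) (p : J → I) (hp : Function.Surjective p)
    (hT : ∀ j, T' (simpleRoot (p j)) = ∑ j', T (simpleRoot j) j' • simpleRoot (p j'))
    (ho : ∀ j, p j = o' ↔ j = o) : IsKostant T' o' h d := by
  set f : (J → ℤ) →ₗ[ℤ] (I → ℤ) := Fintype.linearCombination ℤ (fun j => simpleRoot (p j)) with hf
  have hfv : ∀ v, f v = ∑ j, v j • simpleRoot (p j) := fun v => by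
    rw [hf, Fintype.linearCombination_apply]
  have hfs : ∀ j, f (simpleRoot j) = simpleRoot (p j) := fun j => by
    rw [hfv, Finset.sum_eq_single j]
    · simp [simpleRoot]
    · intro j' _ hj'; simp [simpleRoot, hj']
    · simp
  have hfT : ∀ v, f (T v) = T' (f v) := by
    intro v
    have : f ∘ₗ T = T' ∘ₗ f := by
      refine (Pi.basisFun ℤ J).ext fun j => ?_
      have hj : Pi.basisFun ℤ J j = simpleRoot j := by simp [simpleRoot]
      rw [LinearMap.comp_apply, LinearMap.comp_apply, hj, hfs, hT, hfv]
    exact LinearMap.congr_fun this v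
  have hfo : f (simpleRoot o) = simpleRoot o' := by rw [hfs, (ho o).2 rfl]
  have hfa : ∀ v i, f v i = ∑ j, if p j = i then v j else 0 := by
    intro v i
    rw [hfv, Finset.sum_apply]
    refine Finset.sum_congr rfl fun j _ => ?_
    simp [simpleRoot, Pi.single_apply, eq_comm]
  have hfvo : ∀ v, f v o' = v o := by
    intro v
    rw [hfa]
    simp [ho]
  have hpos : ∀ v, (∀ j, 0 ≤ v j) → ∀ i, 0 ≤ f v i := fun v hv i => by
    rw [hfa]
    refine Finset.sum_nonneg fun j _ => ?_
    split_ifs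
    exacts [hv j, le_rfl]
  have hmap := kostantSeq_map f hfT hfo (2 * d) (h + 2 - 2 * d)
  refine ⟨hK.one_le, hK.two_mul_le, ?_, ?_, ?_, ?_, ?_, ?_⟩
  · intro k i
    rw [← hmap]
    exact hpos _ (hK.nonneg k) i
  · intro h0
    apply hK.ne_zero
    rw [← hfo, ← hfT] at h0
    have hnn : ∀ j, 0 ≤ T (simpleRoot o) j := fun j => hK.nonneg 1 j
    ext j
    have := congrFun h0 (p j)
    rw [hfa] at this
    have h1 := (Finset.sum_eq_zero_iff_of_nonneg (fun j' _ => by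
      split_ifs
      exacts [hnn j', le_rfl])).1 this j (Finset.mem_univ j)
    simpa using h1
  · intro k h1 h2
    rw [← hmap, hfvo, hK.apply_special k h1 h2]
  · rw [← hmap, hK.top, hfo]
  · intro k hk
    rw [← hmap, hK.beyond k hk, map_zero]
  · intro u hu
    choose s hs using hp
    -- a section of the surjection lifts vectors
    have hlift : f (∑ i, u i • simpleRoot (s i)) = u := by
      rw [map_sum]
      simp only [map_smul, hfs, hs]
      ext i
      simp [simpleRoot, Finset.sum_apply, Pi.single_apply]
    rw [← hlift, ← aeval_cutOp_map f hfT hfo hfvo, hK.cheb, map_zero]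
    rw [← hu, ← hlift, hfvo, hlift]

/-- Kostant's arithmetic restricts to an invariant sublattice that contains `α o`. -/
theorem IsKostant.pull {T : Module.End ℤ (J → ℤ)} {T' : Module.End ℤ (I → ℤ)} {o : J} {o' : I}
    {h d : ℕ} (hK : IsKostant T o h d) (f : (I → ℤ) →ₗ[ℤ] (J → ℤ))
    (hT : ∀ v, f (T' v) = T (f v)) (ho : f (simpleRoot o') = simpleRoot o)
    (hf : ∀ v, f v o = v o') (hpos : ∀ v, (∀ j, 0 ≤ f v j) → ∀ i, 0 ≤ v i) :
    IsKostant T' o' h d := by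
  have hinj : ∀ v, f v = 0 → v = 0 := by
    intro v hv
    ext i
    refine le_antisymm ?_ (hpos v (by simp [hv]) i)
    have := hpos (-v) (by simp [hv]) i
    simpa using this
  have hmap := kostantSeq_map f hT ho (2 * d) (h + 2 - 2 * d)
  refine ⟨hK.one_le, hK.two_mul_le, ?_, ?_, ?_, ?_, ?_, ?_⟩
  · exact fun k => hpos _ fun j => by rw [hmap]; exact hK.nonneg k j
  · intro h0
    apply hK.ne_zero
    rw [← ho, ← hT, h0, map_zero]
  · intro k h1 h2
    rw [← hf (kostantSeq T' o' (2 * d) (h + 2 - 2 * d) k), hmap, hK.apply_special k h1 h2]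
  · rw [← sub_eq_zero]
    apply hinj
    rw [map_sub, hmap, hK.top, ho, sub_self]
  · intro k hk
    apply hinj
    rw [hmap, hK.beyond k hk]
  · intro u hu
    apply hinj
    rw [aeval_cutOp_map f hT ho hf, hK.cheb]
    exact (hf u).trans hu

end Transfer

/-! ### Chebyshev polynomials of the diagram without the special vertex -/

section Cheb

open Polynomial

variable {J : Type} [Fintype J] [DecidableEq J] {T : Module.End ℤ (J → ℤ)} {o : J} {h : ℕ}

/-- The kernel of `S_{h-1}` evaluated at the diagram without `o`. -/
def chebKer (T : Module.End ℤ (J → ℤ)) (o : J) (h : ℕ) : Submodule ℤ (J → ℤ) :=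
  LinearMap.ker (aeval (cutOp T o) (Chebyshev.S ℤ ((h : ℤ) - 1)))

theorem cheb_eq_of_recursion_le (F : Module.End ℤ (J → ℤ)) (h : ℕ) (y : ℕ → J → ℤ) (h0 : y 0 = 0)
    (h2 : ∀ k, k + 2 ≤ h → y (k + 2) = F (y (k + 1)) - y k) (k : ℕ) (hk : k ≤ h) :
    aeval F (Chebyshev.S ℤ ((k : ℤ) - 1)) (y 1) = y k := by
  induction k using Nat.twoStepInduction with
  | zero => simp [h0]
  | one => simp
  | more k ih1 ih2 =>
    rw [h2 k hk, ← ih1 (by omega), ← ih2 (by omega)]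
    push_cast
    rw [show (k : ℤ) + 2 - 1 = ((k : ℤ) - 1) + 2 by ring, Chebyshev.S_add_two,
      show (k : ℤ) - 1 + 1 = k + 1 - 1 by ring]
    simp only [map_sub, map_mul, aeval_X, LinearMap.sub_apply, Module.End.mul_apply]

theorem mem_chebKer_of_recursion (y : ℕ → J → ℤ) (h0 : y 0 = 0)
    (h2 : ∀ k, k + 2 ≤ h → y (k + 2) = cutOp T o (y (k + 1)) - y k) (hh : y h = 0) :
    y 1 ∈ chebKer T o h :=
  (cheb_eq_of_recursion_le _ h y h0 h2 h le_rfl).trans hh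

theorem cutOp_mem_chebKer {u : J → ℤ} (hu : u ∈ chebKer T o h) :
    cutOp T o u ∈ chebKer T o h := by
  set F := cutOp T o
  set p := Chebyshev.S ℤ ((h : ℤ) - 1)
  have : aeval F p * F = F * aeval F p := by
    have h1 : aeval F (X * p) = aeval F (p * X) := by rw [mul_comm]
    simpa using h1.symm
  change aeval F p (F u) = 0
  have h2 := LinearMap.congr_fun this u
  rw [Module.End.mul_apply, Module.End.mul_apply, show aeval F p u = 0 from hu, map_zero] at h2
  exact h2

theorem mem_chebKer_of_smul {n : ℤ} (hn : n ≠ 0) {u : J → ℤ} (hu : n • u ∈ chebKer T o h) :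
    u ∈ chebKer T o h := by
  have h1 : aeval (cutOp T o) (Chebyshev.S ℤ ((h : ℤ) - 1)) (n • u) = 0 := hu
  rw [map_smul] at h1
  exact (smul_eq_zero.1 h1).resolve_left hn

theorem mem_chebKer_of_cutOp_eq_zero {u : J → ℤ} (hu : cutOp T o u = 0) (hh : 2 ∣ h) :
    u ∈ chebKer T o h := by
  obtain ⟨m, rfl⟩ := hh
  -- the recursion has period four: `0, u, 0, -u`
  have key : ∀ m, aeval (cutOp T o) (Chebyshev.S ℤ (((2 * m : ℕ) : ℤ) - 1)) u = 0 := by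
    intro m
    induction m with
    | zero => simp
    | succ m ih =>
      rw [show ((2 * (m + 1) : ℕ) : ℤ) - 1 = ((2 * m : ℕ) : ℤ) - 1 + 2 by push_cast; ring,
        Chebyshev.S_add_two, mul_comm, map_sub, map_mul, aeval_X, LinearMap.sub_apply,
        Module.End.mul_apply, hu, map_zero, ih, sub_zero]
  exact key m

theorem mem_chebKer_of_cutOp_sq {u : J → ℤ} (hu : cutOp T o (cutOp T o u) = u) (hh : 3 ∣ h) :
    u ∈ chebKer T o h := by
  obtain ⟨m, rfl⟩ := hh
  -- the recursion has period six: `0, u, F u, 0, -u, -F u`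
  have key : ∀ m u, cutOp T o (cutOp T o u) = u →
      aeval (cutOp T o) (Chebyshev.S ℤ (((3 * m : ℕ) : ℤ) - 1)) u = 0 := by
    intro m
    induction m with
    | zero => simp
    | succ m ih =>
      intro u hu
      rw [show ((3 * (m + 1) : ℕ) : ℤ) - 1 = ((3 * m : ℕ) : ℤ) - 1 + 1 + 2 by push_cast; ring,
        Chebyshev.S_add_two, show ((3 * m : ℕ) : ℤ) - 1 + 1 + 1 = ((3 * m : ℕ) : ℤ) - 1 + 2 by ring,
        Chebyshev.S_add_two]
      rw [show (X : ℤ[X]) * (X * Chebyshev.S ℤ (((3 * m : ℕ) : ℤ) - 1 + 1) -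
        Chebyshev.S ℤ (((3 * m : ℕ) : ℤ) - 1)) - Chebyshev.S ℤ (((3 * m : ℕ) : ℤ) - 1 + 1) =
        Chebyshev.S ℤ (((3 * m : ℕ) : ℤ) - 1 + 1) * (X * X - 1) -
          Chebyshev.S ℤ (((3 * m : ℕ) : ℤ) - 1) * X by ring]
      simp only [map_sub, map_mul, aeval_X, map_one, LinearMap.sub_apply, Module.End.mul_apply,
        Module.End.one_apply, hu, sub_self, map_zero, zero_sub, neg_eq_zero]
      exact ih _ (by rw [hu])
  exact key m u hu

theorem mem_chebKer_of_forall (hK : ∀ i, i ≠ o → simpleRoot i ∈ chebKer T o h) (u : J → ℤ)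
    (hu : u o = 0) : u ∈ chebKer T o h := by
  have : u = ∑ i, u i • simpleRoot i := by
    ext i; simp [simpleRoot, Finset.sum_apply, Pi.single_apply]
  rw [this]
  refine Submodule.sum_mem _ fun i _ => ?_
  by_cases hi : i = o
  · rw [hi, hu, zero_smul]; exact Submodule.zero_mem _
  · exact Submodule.smul_mem _ _ (hK i hi)

/-- If the series of Kostant's formula is a polynomial of degree `h` with `α o` only at both ends,
then `S_{h-1}` kills the neighbours of `α o`. -/
theorem apply_special_mem_chebKer {a c : ℕ} (hT : T (simpleRoot o) o = 0)
    (h0 : ∀ k, 0 < k → k < h → kostantSeq T o a c k o = 0)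
    (htop : kostantSeq T o a c h = simpleRoot o) : T (simpleRoot o) ∈ chebKer T o h := by
  have := mem_chebKer_of_recursion (T := T) (o := o) (h := h)
    (fun k => offProj o (kostantSeq T o a c k)) ?_ ?_ ?_
  · rw [kostantSeq, offProj_eq_self hT] at this
    exact this
  · exact offProj_simpleRoot o
  · intro k hk
    rw [offProj_eq_self (h0 (k + 1) (by omega) (by omega)), kostantSeq, map_add, map_sub, map_smul,
      offProj_simpleRoot, smul_zero, add_zero]
    rfl
  · rw [htop, offProj_simpleRoot]

end Cheb

/-! ### Affine diagrams -/

/-- A connected bipartite graph with multiplicities `b`, a positive function `δ` that is additive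
(`2 δ j` is the sum of `δ` over the neighbours of `j`) and a vertex `o` with `δ o = 1`. The McKay
graph of a finite subgroup of `SL(2, ℂ)` of even order, with `δ` the dimension, is of this kind. -/
structure IsAffineDiagram {J : Type} [Fintype J] (b : Matrix J J ℕ) (δ : J → ℕ) (o : J) :
    Prop where
  symm : ∀ i j, b i j = b j i
  bipartite : ∃ ε : J → ZMod 2, ∀ i j, b i j ≠ 0 → ε j = ε i + 1
  pos : ∀ j, 0 < δ j
  additive : ∀ j, ∑ i, b j i * δ i = 2 * δ j
  special : δ o = 1
  connected : ∀ S : Set J, o ∈ S → (∀ j ∈ S, ∀ i, b j i ≠ 0 → i ∈ S) → ∀ i, i ∈ S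

section Diagram

variable {J : Type} [Fintype J] [DecidableEq J]

/-- The weight of a vector with respect to `δ`. -/
def weight (δ : J → ℕ) (v : J → ℤ) : ℤ := ∑ i, (δ i : ℤ) * v i

theorem weight_add (δ : J → ℕ) (v w : J → ℤ) : weight δ (v + w) = weight δ v + weight δ w := by
  simp [weight, mul_add, Finset.sum_add_distrib]

theorem weight_simpleRoot (δ : J → ℕ) (i : J) : weight δ (simpleRoot i) = δ i := by
  simp [weight, simpleRoot, Pi.single_apply]

theorem simpleRoot_nonneg (i : J) : 0 ≤ simpleRoot i := by
  intro j
  simp only [simpleRoot, Pi.single_apply, Pi.zero_apply]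
  split_ifs <;> simp

theorem simpleRoot_injective {i j : J} (h : simpleRoot i = simpleRoot j) : i = j := by
  by_contra hij
  have := congrFun h i
  simp [simpleRoot, hij] at this

theorem simpleRoot_self (i : J) : simpleRoot i i = 1 := by simp [simpleRoot]

theorem simpleRoot_of_ne {i j : J} (h : j ≠ i) : simpleRoot i j = 0 := by simp [simpleRoot, h]

theorem eq_of_simpleRoot_ne_zero {i j : J} (h : simpleRoot i j ≠ 0) : j = i := by
  by_contra h'; exact h (simpleRoot_of_ne h')

theorem exists_eq_simpleRoot_add {v : J → ℤ} (hv : 0 ≤ v) (hne : v ≠ 0) :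
    ∃ (i : J) (w : J → ℤ), v = simpleRoot i + w ∧ 0 ≤ w := by
  obtain ⟨i, hi⟩ := Function.ne_iff.1 hne
  refine ⟨i, v - simpleRoot i, by abel, fun j => ?_⟩
  have h1 := hv j
  by_cases hj : j = i
  · subst hj
    simp only [Pi.zero_apply, Pi.sub_apply, simpleRoot_self] at *
    omega
  · simpa [simpleRoot_of_ne hj] using h1

namespace IsAffineDiagram

variable {b : Matrix J J ℕ} {δ : J → ℕ} {o : J}

theorem no_loop (hA : IsAffineDiagram b δ o) (i : J) : b i i = 0 := by
  obtain ⟨ε, hε⟩ := hA.bipartite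
  by_contra h
  have := hε i i h
  simp at this

theorem weight_nonneg (_ : IsAffineDiagram b δ o) {v : J → ℤ} (hv : 0 ≤ v) : 0 ≤ weight δ v :=
  Finset.sum_nonneg fun i _ => mul_nonneg (by positivity) (hv i)

theorem eq_zero_of_weight (hA : IsAffineDiagram b δ o) {v : J → ℤ} (hv : 0 ≤ v)
    (h : weight δ v = 0) : v = 0 := by
  ext i
  have := (Finset.sum_eq_zero_iff_of_nonneg fun i _ => mul_nonneg (by positivity) (hv i)).1 h i
    (Finset.mem_univ i)
  have hp := hA.pos i
  rcases mul_eq_zero.1 this with h1 | h1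
  · omega
  · exact h1

theorem ne_zero_of_weight {v : J → ℤ} (h : weight δ v ≠ 0) : v ≠ 0 := by
  rintro rfl
  simp [weight] at h

theorem adjOp_nonneg {v : J → ℤ} (hv : 0 ≤ v) : 0 ≤ adjOp b v := by
  intro i
  rw [adjOp_apply]
  exact Finset.sum_nonneg fun j _ => mul_nonneg (by positivity) (hv j)

theorem weight_adjOp (hA : IsAffineDiagram b δ o) (v : J → ℤ) :
    weight δ (adjOp b v) = 2 * weight δ v := by
  simp only [weight, adjOp_apply, Finset.mul_sum]
  rw [Finset.sum_comm]
  refine Finset.sum_congr rfl fun j _ => ?_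
  have := hA.additive j
  have h' : ∑ i, (b j i : ℤ) * δ i = 2 * δ j := by exact_mod_cast this
  rw [← mul_assoc, ← h', Finset.sum_mul]
  exact Finset.sum_congr rfl fun i _ => by ring

theorem adjOp_dotProduct (hA : IsAffineDiagram b δ o) (v w : J → ℤ) :
    adjOp b v ⬝ᵥ w = v ⬝ᵥ adjOp b w := by
  simp only [dotProduct, adjOp_apply, Finset.mul_sum, Finset.sum_mul]
  rw [Finset.sum_comm]
  refine Finset.sum_congr rfl fun j _ => Finset.sum_congr rfl fun i _ => ?_
  rw [hA.symm i j]
  ring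

/-- Adjacency is symmetric, with multiplicities. -/
theorem adjOp_eq_smul_add (hA : IsAffineDiagram b δ o) {i j : J} {n : ℤ} {w : J → ℤ}
    (h : adjOp b (simpleRoot j) = n • simpleRoot i + w) (hw : 0 ≤ w) :
    ∃ w', adjOp b (simpleRoot i) = n • simpleRoot j + w' ∧ 0 ≤ w' ∧
      weight δ w' = 2 * δ i - n * δ j := by
  refine ⟨adjOp b (simpleRoot i) - n • simpleRoot j, by abel, fun k => ?_, ?_⟩
  · by_cases hk : k = j
    · subst hk
      have h1 := congrFun h i
      have h2 := hw i
      rw [adjOp_simpleRoot] at h1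
      simp only [Pi.add_apply, Pi.smul_apply, simpleRoot_self, smul_eq_mul, mul_one,
        Pi.zero_apply] at h1 h2
      simp only [Pi.zero_apply, Pi.sub_apply, adjOp_simpleRoot, Pi.smul_apply, simpleRoot_self,
        smul_eq_mul, mul_one]
      rw [hA.symm] at h1
      omega
    · have := adjOp_nonneg (b := b) (simpleRoot_nonneg i) k
      simpa [simpleRoot_of_ne hk] using this
  · have h1 := weight_add δ (adjOp b (simpleRoot i) - n • simpleRoot j) (n • simpleRoot j)
    rw [sub_add_cancel, hA.weight_adjOp, weight_simpleRoot] at h1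
    have h2 : weight δ (n • simpleRoot j) = n * weight δ (simpleRoot j) := by
      simp only [weight, Pi.smul_apply, smul_eq_mul, Finset.mul_sum]
      exact Finset.sum_congr rfl fun i _ => by ring
    rw [h2, weight_simpleRoot] at h1
    linarith

theorem adjOp_eq_add (hA : IsAffineDiagram b δ o) {i j : J} {w : J → ℤ}
    (h : adjOp b (simpleRoot j) = simpleRoot i + w) (hw : 0 ≤ w) :
    ∃ w', adjOp b (simpleRoot i) = simpleRoot j + w' ∧ 0 ≤ w' ∧ weight δ w' = 2 * δ i - δ j := by
  simpa using hA.adjOp_eq_smul_add (n := 1) (by simpa using h) hw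

/-- A double neighbour of `j` has at least the weight of `j`. -/
theorem le_of_double (hA : IsAffineDiagram b δ o) {i j : J} {w : J → ℤ}
    (h : adjOp b (simpleRoot j) = simpleRoot i + (simpleRoot i + w)) (hw : 0 ≤ w) :
    δ j ≤ δ i := by
  obtain ⟨w', -, h2, h3⟩ := hA.adjOp_eq_smul_add (n := 2) (i := i) (w := w)
    (by rw [h, two_smul]; abel) hw
  have := hA.weight_nonneg h2
  omega

theorem eq_simpleRoot_of_weight_one (hA : IsAffineDiagram b δ o) {v : J → ℤ} (hv : 0 ≤ v)
    (h : weight δ v = 1) : ∃ i, v = simpleRoot i ∧ δ i = 1 := by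
  obtain ⟨i, w, rfl, hw⟩ := exists_eq_simpleRoot_add hv (ne_zero_of_weight (by rw [h]; simp))
  rw [weight_add, weight_simpleRoot] at h
  have h1 := hA.weight_nonneg hw
  have h2 := hA.pos i
  have h3 := hA.eq_zero_of_weight hw (by omega)
  exact ⟨i, by rw [h3, add_zero], by omega⟩

theorem eq_of_weight_two (hA : IsAffineDiagram b δ o) {v : J → ℤ} (hv : 0 ≤ v)
    (h : weight δ v = 2) : (∃ i, v = simpleRoot i ∧ δ i = 2) ∨
      ∃ i j, v = simpleRoot i + simpleRoot j ∧ δ i = 1 ∧ δ j = 1 := by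
  obtain ⟨i, w, rfl, hw⟩ := exists_eq_simpleRoot_add hv (ne_zero_of_weight (by rw [h]; simp))
  rw [weight_add, weight_simpleRoot] at h
  have h1 := hA.weight_nonneg hw
  have h2 := hA.pos i
  rcases (show δ i = 2 ∨ δ i = 1 by omega) with h3 | h3
  · left
    have h3' := hA.eq_zero_of_weight hw (by omega)
    exact ⟨i, by rw [h3', add_zero], h3⟩
  · right
    obtain ⟨j, rfl, hj⟩ := hA.eq_simpleRoot_of_weight_one hw (by omega)
    exact ⟨i, j, rfl, h3, hj⟩

/-- The wave equation: inner products in a sequence with `V (k + 2) = T (V (k + 1)) - V k` that is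
symmetric about `0` depend on those with `V 0` only. -/
theorem wave (hA : IsAffineDiagram b δ o) {V : ℕ → J → ℤ} (h1 : adjOp b (V 0) = (2 : ℤ) • V 1)
    (h2 : ∀ k, V (k + 2) = adjOp b (V (k + 1)) - V k) (i j : ℕ) (hij : i ≤ j) :
    2 * (V i ⬝ᵥ V j) = V 0 ⬝ᵥ V (i + j) + V 0 ⬝ᵥ V (j - i) := by
  have h2' : ∀ k, adjOp b (V (k + 1)) = V (k + 2) + V k := fun k => by rw [h2]; abel
  induction i using Nat.twoStepInduction generalizing j with
  | zero => rw [zero_add, Nat.sub_zero, two_mul]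
  | one =>
    obtain ⟨j, rfl⟩ : ∃ k, j = k + 1 := ⟨j - 1, by omega⟩
    have : 2 * (V 1 ⬝ᵥ V (j + 1)) = adjOp b (V 0) ⬝ᵥ V (j + 1) := by
      rw [h1, smul_dotProduct, smul_eq_mul]
    rw [this, hA.adjOp_dotProduct, h2', dotProduct_add, Nat.add_sub_cancel,
      show 1 + (j + 1) = j + 2 by ring]
  | more i ih1 ih2 =>
    obtain ⟨j, rfl⟩ : ∃ k, j = k + 1 := ⟨j - 1, by omega⟩
    have e1 := ih1 (j + 1) (by omega)
    have e2 := ih2 (j + 2) (by omega)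
    have e3 := ih2 j (by omega)
    rw [h2, sub_dotProduct, hA.adjOp_dotProduct, h2', dotProduct_add]
    rw [show i + 1 + (j + 2) = i + 2 + (j + 1) by ring,
      show j + 2 - (i + 1) = j + 1 - i by omega] at e2
    rw [show i + 1 + j = i + (j + 1) by ring,
      show j - (i + 1) = j + 1 - (i + 2) by omega] at e3
    linear_combination e2 + e3 - e1

theorem dotProduct_simpleRoot (v : J → ℤ) (i : J) : simpleRoot i ⬝ᵥ v = v i := by
  simp [simpleRoot]

theorem mem_of_adjOp_add {S : Set J} {j : J} {l : List J}
    (h : adjOp b (simpleRoot j) = (l.map simpleRoot).sum) (hl : ∀ i ∈ l, i ∈ S) :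
    ∀ i, b j i ≠ 0 → i ∈ S := by
  intro i hi
  have h1 := congrFun h i
  rw [adjOp_simpleRoot] at h1
  by_contra hS
  have : ∀ l : List J, (∀ i ∈ l, i ∈ S) → (l.map simpleRoot).sum i = 0 := by
    intro l
    induction l with
    | nil => intro _; rfl
    | cons k l ih =>
      intro hl
      rw [List.map_cons, List.sum_cons, Pi.add_apply, ih (fun i hi => hl i (by simp [hi])),
        simpleRoot_of_ne, add_zero]
      rintro rfl
      exact hS (hl i (by simp))
  rw [this l hl] at h1
  exact hi (by exact_mod_cast h1)

end IsAffineDiagram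

end Diagram

section Diagram

variable {J : Type} [Fintype J] [DecidableEq J]

/-- The sequence `V` with given `V 0`, `V 1` and `V (k + 2) = T (V (k + 1)) - V k`. -/
def walk (T : Module.End ℤ (J → ℤ)) (u v : J → ℤ) : ℕ → (J → ℤ)
  | 0 => u
  | 1 => v
  | k + 2 => T (walk T u v (k + 1)) - walk T u v k

theorem apply_walk (T : Module.End ℤ (J → ℤ)) (u v : J → ℤ) (k : ℕ) :
    T (walk T u v (k + 1)) = walk T u v (k + 2) + walk T u v k := by
  simp [walk]

theorem walk_add (T : Module.End ℤ (J → ℤ)) (u v u' v' : J → ℤ) (k : ℕ) :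
    walk T (u + u') (v + v') k = walk T u v k + walk T u' v' k := by
  induction k using Nat.twoStepInduction with
  | zero => rfl
  | one => rfl
  | more k ih1 ih2 => simp only [walk, ih1, ih2, map_add]; abel

namespace IsAffineDiagram

variable {b : Matrix J J ℕ} {δ : J → ℕ} {o : J}

theorem parity_walk (_ : IsAffineDiagram b δ o) {ε : J → ZMod 2}
    (hε : ∀ i j, b i j ≠ 0 → ε j = ε i + 1) {u v : J → ℤ} {e : ZMod 2}
    (hu : ∀ j, u j ≠ 0 → ε j = e) (hv : ∀ j, v j ≠ 0 → ε j = e + 1) (k : ℕ) (j : J)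
    (hj : walk (adjOp b) u v k j ≠ 0) : ε j = e + k := by
  induction k using Nat.twoStepInduction generalizing j with
  | zero => simpa using hu j hj
  | one => simpa using hv j hj
  | more k ih1 ih2 =>
    have h2 : (2 : ZMod 2) = 0 := rfl
    by_cases h : walk (adjOp b) u v k j = 0
    · simp only [walk, Pi.sub_apply, h, sub_zero, adjOp_apply] at hj
      obtain ⟨i, -, hi⟩ := Finset.exists_ne_zero_of_sum_ne_zero hj
      rw [hε i j (by intro h'; simp [h'] at hi), ih2 i (right_ne_zero_of_mul hi)]
      push_cast
      ring
    · rw [ih1 j h]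
      push_cast
      linear_combination -h2

/-- Walking along vertices of weight one never branches. -/
theorem walk_unit (hA : IsAffineDiagram b δ o) {p : J} {w : J → ℤ} (hp : δ p = 1)
    (hT : adjOp b (simpleRoot o) = simpleRoot p + w) (hw : 0 ≤ w) (k : ℕ) :
    ∃ j, walk (adjOp b) (simpleRoot o) (simpleRoot p) k = simpleRoot j ∧ δ j = 1 := by
  have key : ∀ k, ∃ j j' w, walk (adjOp b) (simpleRoot o) (simpleRoot p) k = simpleRoot j ∧
      walk (adjOp b) (simpleRoot o) (simpleRoot p) (k + 1) = simpleRoot j' ∧ δ j = 1 ∧ δ j' = 1 ∧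
      adjOp b (simpleRoot j') = simpleRoot j + w ∧ 0 ≤ w := by
    intro k
    induction k with
    | zero =>
      obtain ⟨w', h1, h2, -⟩ := hA.adjOp_eq_add hT hw
      exact ⟨o, p, w', rfl, rfl, hA.special, hp, h1, h2⟩
    | succ k ih =>
      obtain ⟨j, j', w, h1, h2, h3, h4, h5, h6⟩ := ih
      have h7 : weight δ w = 1 := by
        have := hA.weight_adjOp (simpleRoot j')
        rw [h5, weight_add, weight_simpleRoot, weight_simpleRoot, h3, h4] at this
        push_cast at this
        linarith
      obtain ⟨j'', rfl, h8⟩ := hA.eq_simpleRoot_of_weight_one h6 h7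
      have h5' := h5
      rw [add_comm] at h5'
      obtain ⟨w', h9, h10, -⟩ := hA.adjOp_eq_add h5' (simpleRoot_nonneg j)
      exact ⟨j', j'', w', h2, by rw [walk, h2, h5, h1]; abel, h4, h8, h9, h10⟩
  obtain ⟨j, -, -, h1, -, h3, -⟩ := key k
  exact ⟨j, h1, h3⟩

/-- A walk from `α o` that first returns to `α o` after `h` steps lies in the kernel of
`S_{h-1}`. -/
theorem walk_mem_chebKer {T : Module.End ℤ (J → ℤ)} {p : J → ℤ} {h : ℕ} (hh : 2 ≤ h)
    (h0 : ∀ k, 0 < k → k < h → walk T (simpleRoot o) p k o = 0)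
    (hret : walk T (simpleRoot o) p h = simpleRoot o) (k : ℕ) (hk0 : 0 < k) (hk : k < h) :
    walk T (simpleRoot o) p k ∈ chebKer T o h := by
  have hF : ∀ k, k + 2 ≤ h → offProj o (walk T (simpleRoot o) p (k + 2)) =
      cutOp T o (offProj o (walk T (simpleRoot o) p (k + 1))) -
        offProj o (walk T (simpleRoot o) p k) := by
    intro k hk
    rw [walk, map_sub, offProj_eq_self (h0 (k + 1) (by omega) (by omega))]
    rfl
  have h1 : walk T (simpleRoot o) p 1 ∈ chebKer T o h := by
    have := mem_chebKer_of_recursion (T := T) (o := o) (h := h)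
      (fun k => offProj o (walk T (simpleRoot o) p k)) (offProj_simpleRoot o) hF
      (by rw [hret, offProj_simpleRoot])
    rwa [offProj_eq_self (h0 1 (by omega) (by omega))] at this
  have key : ∀ k, k < h → offProj o (walk T (simpleRoot o) p k) ∈ chebKer T o h := by
    intro k
    induction k using Nat.twoStepInduction with
    | zero => intro _; rw [walk, offProj_simpleRoot]; exact Submodule.zero_mem _
    | one => intro _; rwa [offProj_eq_self (h0 1 (by omega) (by omega))]
    | more k ih1 ih2 =>
      intro hk
      rw [hF k (by omega)]
      exact Submodule.sub_mem _ (cutOp_mem_chebKer (ih2 (by omega))) (ih1 (by omega))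
  rw [← offProj_eq_self (h0 k hk0 hk)]
  exact key k hk

/-- The diagrams of cyclic groups: all weights are one, and the diagram is a cycle of even length
`h` (a double edge for `h = 2`). -/
theorem isKostant_of_cycle (hA : IsAffineDiagram b δ o) {p q : J} (hp : δ p = 1) (hq : δ q = 1)
    (hT : adjOp b (simpleRoot o) = simpleRoot p + simpleRoot q) :
    (∃ h, IsKostant (adjOp b) o h 1) ∧ ∀ j, δ j = 1 := by
  set W := walk (adjOp b) (simpleRoot o) (simpleRoot p) with hW
  set W' := walk (adjOp b) (simpleRoot o) (simpleRoot q) with hW'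
  set V := walk (adjOp b) (simpleRoot o + simpleRoot o) (simpleRoot p + simpleRoot q) with hV
  have hVW : ∀ k, V k = W k + W' k := walk_add _ _ _ _ _
  have hWu : ∀ k, ∃ j, W k = simpleRoot j ∧ δ j = 1 :=
    hA.walk_unit hp hT (simpleRoot_nonneg q)
  have hWu' : ∀ k, ∃ j, W' k = simpleRoot j ∧ δ j = 1 :=
    hA.walk_unit hq (by rw [hT, add_comm]) (simpleRoot_nonneg p)
  have hWn : ∀ k, 0 ≤ W k := fun k => by
    obtain ⟨j, h, -⟩ := hWu k; rw [h]; exact simpleRoot_nonneg j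
  have hWn' : ∀ k, 0 ≤ W' k := fun k => by
    obtain ⟨j, h, -⟩ := hWu' k; rw [h]; exact simpleRoot_nonneg j
  have hVn : ∀ k, 0 ≤ V k := fun k => by rw [hVW]; exact add_nonneg (hWn k) (hWn' k)
  have hT0 : adjOp b (V 0) = (2 : ℤ) • V 1 := by
    simp only [hV, walk, map_add, hT, two_smul]
  have hV2 : ∀ k, V (k + 2) = adjOp b (V (k + 1)) - V k := fun k => rfl
  have hwave := hA.wave hT0 hV2
  have hg : ∀ k, V 0 ⬝ᵥ V k = 2 * V k o := by
    intro k
    change (simpleRoot o + simpleRoot o) ⬝ᵥ V k = _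
    rw [add_dotProduct, dotProduct_simpleRoot]; ring
  have hdot : ∀ v w : J → ℤ, 0 ≤ v → 0 ≤ w → 0 ≤ v ⬝ᵥ w := fun v w hv hw =>
    Finset.sum_nonneg fun i _ => mul_nonneg (hv i) (hw i)
  -- by the wave equation, a walk that never returns would visit infinitely many vertices
  have hex : ∃ k, 0 < k ∧ V k o ≠ 0 := by
    by_contra hno
    push Not at hno
    choose w hw _ using hWu
    have hne : ∀ i j, i < j → w i ≠ w j := by
      intro i j hij heq
      have h1 := hwave i j hij.le
      rw [hg, hg, hno _ (by omega), hno _ (by omega)] at h1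
      have h2 : V i ⬝ᵥ V j = W i ⬝ᵥ W j + W i ⬝ᵥ W' j + W' i ⬝ᵥ W j + W' i ⬝ᵥ W' j := by
        rw [hVW, hVW, add_dotProduct, dotProduct_add, dotProduct_add]; ring
      have h3 : W i ⬝ᵥ W j = 1 := by
        rw [hw i, hw j, heq, dotProduct_simpleRoot, simpleRoot_self]
      have h4 := hdot _ _ (hWn i) (hWn' j)
      have h5 := hdot _ _ (hWn' i) (hWn j)
      have h6 := hdot _ _ (hWn' i) (hWn' j)
      omega
    have hinj : Function.Injective w := by
      intro i j hij
      rcases lt_trichotomy i j with h | h | h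
      · exact absurd hij (hne i j h)
      · exact h
      · exact absurd hij.symm (hne j i h)
    exact not_injective_infinite_finite w hinj
  classical
  set h := Nat.find hex with hh
  obtain ⟨hpos, hVh⟩ := Nat.find_spec hex
  rw [← hh] at hpos hVh
  have hmin : ∀ k, 0 < k → k < h → V k o = 0 := by
    intro k hk hkh
    have := Nat.find_min hex hkh
    push Not at this
    exact this hk
  have heven : Even h := by
    obtain ⟨ε, hε⟩ := hA.bipartite
    have h1 := hA.parity_walk hε (u := simpleRoot o + simpleRoot o)
      (v := simpleRoot p + simpleRoot q) (e := ε o) ?_ ?_ h o hVh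
    · rw [left_eq_add, ZMod.natCast_eq_zero_iff] at h1
      exact even_iff_two_dvd.2 h1
    · intro j hj
      by_contra hne
      rw [Pi.add_apply, simpleRoot_of_ne (by rintro rfl; exact hne rfl)] at hj
      exact hj rfl
    · intro j hj
      rw [← hT, adjOp_simpleRoot] at hj
      exact hε o j (by exact_mod_cast hj)
  obtain ⟨m, hm⟩ := heven
  have hh2 : 2 ≤ h := by omega
  -- the return is simultaneous for both directions, as seen half way
  have hWle : ∀ k, W k o ≤ 1 := fun k => by
    obtain ⟨j, hj, -⟩ := hWu k
    rw [hj]; simp only [simpleRoot, Pi.single_apply]; split_ifs <;> simp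
  have hWle' : ∀ k, W' k o ≤ 1 := fun k => by
    obtain ⟨j, hj, -⟩ := hWu' k
    rw [hj]; simp only [simpleRoot, Pi.single_apply]; split_ifs <;> simp
  have hVo : V h o = 2 := by
    have h1 := hwave m m le_rfl
    rw [← hm, Nat.sub_self, hg, hg] at h1
    have h2 : V 0 o = 2 := by
      change (simpleRoot o + simpleRoot o) o = 2
      simp [simpleRoot_self]
    obtain ⟨i, hi, -⟩ := hWu m
    obtain ⟨j, hj, -⟩ := hWu' m
    have h3 : V m ⬝ᵥ V m = 2 ∨ V m ⬝ᵥ V m = 4 := by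
      rw [hVW, hi, hj, add_dotProduct, dotProduct_simpleRoot, dotProduct_simpleRoot]
      by_cases hij : i = j
      · subst hij; right; simp [simpleRoot_self]
      · left
        simp [simpleRoot_self, simpleRoot_of_ne hij, simpleRoot_of_ne (Ne.symm hij)]
    have h4 := hVW h
    have h5 : V h o = W h o + W' h o := by rw [h4]; rfl
    have h6 := hWle h
    have h7 := hWle' h
    rcases h3 with h3 | h3 <;> omega
  have hsplit : W h o = 1 ∧ W' h o = 1 := by
    have h5 : V h o = W h o + W' h o := by rw [hVW]; rfl
    have h6 := hWle h
    have h7 := hWle' h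
    omega
  have hWh : W h = simpleRoot o := by
    obtain ⟨j, hj, -⟩ := hWu h
    have := hsplit.1
    rw [hj] at this ⊢
    rw [eq_of_simpleRoot_ne_zero (by rw [this]; simp : simpleRoot j o ≠ 0)]
  have hWh' : W' h = simpleRoot o := by
    obtain ⟨j, hj, -⟩ := hWu' h
    have := hsplit.2
    rw [hj] at this ⊢
    rw [eq_of_simpleRoot_ne_zero (by rw [this]; simp : simpleRoot j o ≠ 0)]
  have hVhe : V h = V 0 := by rw [hVW, hWh, hWh']; rfl
  have hVh1 : V (h - 1) = V 1 := by
    have e1 := hwave 1 1 le_rfl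
    have e2 := hwave 1 (h - 1) (by omega)
    have e3 := hwave (h - 1) (h - 1) le_rfl
    have e4 := hwave (h - 2) h (by omega)
    rw [show 1 + (h - 1) = h by omega, show h - 1 - 1 = h - 2 by omega, hVhe] at e2
    rw [show h - 1 + (h - 1) = 2 * h - 2 by omega, Nat.sub_self] at e3
    rw [show h - 2 + h = 2 * h - 2 by omega, show h - (h - 2) = 2 by omega, hVhe,
      dotProduct_comm (V (h - 2))] at e4
    rw [show 1 + 1 = 2 from rfl, Nat.sub_self] at e1
    rw [← sub_eq_zero, ← dotProduct_self_eq_zero, sub_dotProduct, dotProduct_sub, dotProduct_sub,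
      dotProduct_comm (V (h - 1)) (V 1)]
    linarith
  have hW0 : ∀ k, 0 < k → k < h → W k o = 0 ∧ W' k o = 0 := by
    intro k hk hkh
    have h1 := hmin k hk hkh
    rw [hVW, Pi.add_apply] at h1
    have h2 : 0 ≤ W k o := hWn k o
    have h3 : 0 ≤ W' k o := hWn' k o
    omega
  -- the whole diagram consists of the vertices visited
  set S : Set J := {i | ∃ k, k ≤ h ∧ (W k = simpleRoot i ∨ W' k = simpleRoot i)} with hS
  have hSall : ∀ i, i ∈ S := by
    have hclosed : ∀ U : ℕ → J → ℤ, (∀ k, adjOp b (U (k + 1)) = U (k + 2) + U k) →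
        (∀ k, ∃ j, U k = simpleRoot j ∧ δ j = 1) → U 0 = simpleRoot o → U h = simpleRoot o →
        (∀ k ≤ h, ∀ i, U k = simpleRoot i → i ∈ S) →
        ∀ k ≤ h, ∀ j, U k = simpleRoot j → ∀ i, b j i ≠ 0 → i ∈ S := by
      intro U hU hUu hU0 hUh hUS k hk j hj
      by_cases hjo : j = o
      · subst hjo
        refine mem_of_adjOp_add (l := [p, q]) (by simpa using hT) ?_
        intro i hi
        rcases List.mem_pair.1 hi with rfl | rfl
        · exact ⟨1, by omega, Or.inl rfl⟩
        · exact ⟨1, by omega, Or.inr rfl⟩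
      · have hk0 : k ≠ 0 := by
          rintro rfl; exact hjo (simpleRoot_injective (hj.symm.trans hU0))
        have hkh : k ≠ h := by
          rintro rfl; exact hjo (simpleRoot_injective (hj.symm.trans hUh))
        obtain ⟨k, rfl⟩ : ∃ l, k = l + 1 := ⟨k - 1, by omega⟩
        obtain ⟨i1, h1, -⟩ := hUu k
        obtain ⟨i2, h2, -⟩ := hUu (k + 2)
        have := hU k
        rw [hj, h1, h2] at this
        refine mem_of_adjOp_add (l := [i2, i1]) (by simpa using this) ?_
        intro i hi
        rcases List.mem_pair.1 hi with rfl | rfl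
        · exact hUS (k + 2) (by omega) _ h2
        · exact hUS k (by omega) _ h1
    refine hA.connected S ⟨0, by omega, Or.inl rfl⟩ ?_
    rintro j ⟨k, hk, hj | hj⟩
    · exact hclosed W (apply_walk _ _ _) hWu rfl hWh (fun k hk i hi => ⟨k, hk, Or.inl hi⟩) k hk j hj
    · exact hclosed W' (apply_walk _ _ _) hWu' rfl hWh' (fun k hk i hi => ⟨k, hk, Or.inr hi⟩)
        k hk j hj
  refine ⟨⟨h, ?_⟩, ?_⟩
  · have hZ : ∀ k, kostantSeq (adjOp b) o (2 * 1) (h + 2 - 2 * 1) k =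
        if k = 0 ∨ k = h then simpleRoot o else if k < h then V k else 0 := by
      rw [show h + 2 - 2 * 1 = h by omega, mul_one]
      refine kostantSeq_unique _ _ _ _ _ ?_ ?_ ?_
      · simp
      · rw [if_neg (by omega), if_pos (by omega), hT]; rfl
      · have hV0 : V 0 = (2 : ℤ) • simpleRoot o := by rw [two_smul]; rfl
        have hV1 : V 1 = adjOp b (simpleRoot o) := hT.symm
        have hVr : ∀ k, adjOp b (V (k + 1)) = V (k + 2) + V k := apply_walk _ _ _
        intro k
        have hcoef : kostantCoeff 2 h (k + 2) = (if k = 0 then -1 else 0) +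
            (if k + 2 = h then -1 else 0) + (if k = h then 1 else 0) := by
          unfold kostantCoeff
          split_ifs <;> first | contradiction | omega
        rw [hcoef]
        rcases lt_trichotomy (k + 1) h with hlt | heq | hgt
        · rw [if_neg (show ¬ (k + 1 = 0 ∨ k + 1 = h) by omega), if_pos hlt, hVr,
            if_neg (show ¬ k = h by omega)]
          rcases Nat.eq_zero_or_pos k with rfl | hk0
          · rw [if_pos (show (0 : ℕ) = 0 ∨ 0 = h from Or.inl rfl), if_pos rfl, hV0]
            by_cases hk2 : 0 + 2 = h
            · rw [if_pos (Or.inr hk2), if_pos hk2, hk2, hVhe, hV0]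
              module
            · rw [if_neg (by omega), if_pos (by omega), if_neg hk2]
              module
          · rw [if_neg (show ¬ (k = 0 ∨ k = h) by omega), if_pos (show k < h by omega),
              if_neg (show ¬ k = 0 by omega)]
            by_cases hk2 : k + 2 = h
            · rw [if_pos (Or.inr hk2), if_pos hk2, hk2, hVhe, hV0]
              module
            · rw [if_neg (by omega), if_pos (by omega), if_neg hk2]
              module
        · rw [if_neg (by omega), if_neg (by omega), if_pos (Or.inr heq), if_neg (by omega),
            if_pos (by omega), if_neg (show ¬ k = 0 by omega), if_neg (show ¬ k + 2 = h by omega),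
            if_neg (show ¬ k = h by omega), ← hV1, show k = h - 1 by omega, hVh1]
          simp
        · rw [if_neg (by omega), if_neg (by omega), if_neg (by omega), if_neg (by omega), map_zero,
            if_neg (show ¬ k = 0 by omega), if_neg (show ¬ k + 2 = h by omega)]
          by_cases hkh : k = h
          · rw [if_pos (Or.inr hkh), if_pos hkh]; simp
          · rw [if_neg (by omega), if_neg (by omega), if_neg hkh]; simp
    refine ⟨le_rfl, by omega, ?_, ?_, ?_, ?_, ?_, ?_⟩
    · intro k i
      rw [hZ]
      split_ifs
      exacts [simpleRoot_nonneg o i, hVn k i, le_rfl]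
    · rw [hT]
      refine ne_zero_of_weight (δ := δ) ?_
      rw [weight_add, weight_simpleRoot, weight_simpleRoot, hp, hq]
      simp
    · intro k hk hkh
      rw [hZ, if_neg (by omega), if_pos hkh, hmin k hk hkh]
    · rw [hZ, if_pos (Or.inr rfl)]
    · intro k hk
      rw [hZ, if_neg (by omega), if_neg (by omega)]
    · refine mem_chebKer_of_forall fun i hi => ?_
      obtain ⟨k, hk, hki⟩ := hSall i
      have hk0 : k ≠ 0 := by
        rintro rfl
        rcases hki with h1 | h1 <;> exact hi (simpleRoot_injective h1).symm
      have hkh : k ≠ h := by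
        rintro rfl
        rcases hki with h1 | h1
        · exact hi (simpleRoot_injective (hWh.symm.trans h1)).symm
        · exact hi (simpleRoot_injective (hWh'.symm.trans h1)).symm
      rcases hki with h1 | h1
      · rw [← h1]
        exact walk_mem_chebKer hh2 (fun k h1 h2 => (hW0 k h1 h2).1) hWh k (by omega) (by omega)
      · rw [← h1]
        exact walk_mem_chebKer hh2 (fun k h1 h2 => (hW0 k h1 h2).2) hWh' k (by omega) (by omega)
  · intro j
    obtain ⟨k, -, hj | hj⟩ := hSall j
    · obtain ⟨i, hi, hi1⟩ := hWu k
      rw [simpleRoot_injective (hj.symm.trans hi), hi1]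
    · obtain ⟨i, hi, hi1⟩ := hWu' k
      rw [simpleRoot_injective (hj.symm.trans hi), hi1]

end IsAffineDiagram

end Diagram

section Diagram

variable {J : Type} [Fintype J] [DecidableEq J]

namespace IsAffineDiagram

variable {b : Matrix J J ℕ} {δ : J → ℕ} {o : J}

set_option maxHeartbeats 1000000 in
/-- The diagrams of binary dihedral groups: a chain of vertices of weight two with a fork of two
vertices of weight one at each end. -/
theorem isKostant_of_fork (hA : IsAffineDiagram b δ o) {v o' : J} {R : J → ℤ}
    (hT : adjOp b (simpleRoot o) = simpleRoot v)
    (hv : adjOp b (simpleRoot v) = simpleRoot o + (simpleRoot o' + R)) (hR : 0 ≤ R)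
    (ho' : δ o' = 1) :
    (∃ h, IsKostant (adjOp b) o h 2) ∧ (∀ j, δ j ≤ 2) ∧ ∃ j, δ j = 2 := by
  have hδo := hA.special
  have hδv : δ v = 2 := by
    have := hA.weight_adjOp (simpleRoot o)
    rw [hT, weight_simpleRoot, weight_simpleRoot, hδo] at this
    exact_mod_cast this
  have hoo' : o' ≠ o := by
    rintro rfl
    have := hA.le_of_double hv hR
    omega
  have hTo' : adjOp b (simpleRoot o') = simpleRoot v := by
    obtain ⟨w, h1, h2, h3⟩ := hA.adjOp_eq_add (i := o') (j := v) (w := simpleRoot o + R)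
      (by rw [hv]; abel) (add_nonneg (simpleRoot_nonneg o) hR)
    rw [h1, hA.eq_zero_of_weight h2 (by rw [h3, ho', hδv]; norm_num), add_zero]
  set V := walk (adjOp b) (simpleRoot o + simpleRoot o') (simpleRoot v) with hV
  have hV0 : V 0 = simpleRoot o + simpleRoot o' := rfl
  have hV1 : V 1 = simpleRoot v := rfl
  have hTV : ∀ k, adjOp b (V (k + 1)) = V (k + 2) + V k := apply_walk _ _ _
  have hV2 : V 2 = R := by
    have : V 2 = adjOp b (V 1) - V 0 := rfl
    rw [this, hV1, hv, hV0]; abel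
  have hT0 : adjOp b (V 0) = (2 : ℤ) • V 1 := by
    rw [hV0, map_add, hT, hTo', two_smul, hV1]
  have hwave := hA.wave hT0 (fun k => rfl)
  have hg : ∀ k, V 0 ⬝ᵥ V k = V k o + V k o' := by
    intro k
    rw [hV0, add_dotProduct, dotProduct_simpleRoot, dotProduct_simpleRoot]
  have hwt : ∀ k, weight δ (V k) = 2 := by
    intro k
    induction k using Nat.twoStepInduction with
    | zero => rw [hV0, weight_add, weight_simpleRoot, weight_simpleRoot, hδo, ho']; rfl
    | one => rw [hV1, weight_simpleRoot, hδv]; rfl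
    | more k ih1 ih2 =>
      have := hA.weight_adjOp (V (k + 1))
      rw [hTV, weight_add, ih1, ih2] at this
      linarith
  have hδ2 : ∀ k j, V k = simpleRoot j → δ j = 2 := by
    intro k j hj
    have := hwt k
    rw [hj, weight_simpleRoot] at this
    exact_mod_cast this
  have hsimple0 : ∀ k j, V k = simpleRoot j → V k o = 0 ∧ V k o' = 0 := by
    intro k j hj
    have h1 := hδ2 k j hj
    rw [hj]
    exact ⟨simpleRoot_of_ne (by rintro rfl; omega), simpleRoot_of_ne (by rintro rfl; omega)⟩
  -- a chain without end would visit infinitely many vertices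
  have hex : ∃ n, 0 < n ∧ ¬ ∃ j, V n = simpleRoot j := by
    by_contra hno
    push Not at hno
    have hw : ∀ k, ∃ j, V (k + 1) = simpleRoot j := fun k => hno (k + 1) (by omega)
    choose w hw using hw
    have hne : ∀ i j, i < j → w i ≠ w j := by
      intro i j hij heq
      have h1 := hwave (i + 1) (j + 1) (by omega)
      obtain ⟨j1, h2⟩ := hno (i + 1 + (j + 1)) (by omega)
      obtain ⟨j2, h3⟩ := hno (j + 1 - (i + 1)) (by omega)
      rw [hg, hg, (hsimple0 _ _ h2).1, (hsimple0 _ _ h2).2, (hsimple0 _ _ h3).1,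
        (hsimple0 _ _ h3).2, hw, hw, heq, dotProduct_simpleRoot, simpleRoot_self] at h1
      omega
    have hinj : Function.Injective w := by
      intro i j hij
      rcases lt_trichotomy i j with h | h | h
      · exact absurd hij (hne i j h)
      · exact h
      · exact absurd hij.symm (hne j i h)
    exact not_injective_infinite_finite w hinj
  classical
  obtain ⟨n, ⟨hn0, hnot⟩, hmin'⟩ : ∃ n, (0 < n ∧ ¬ ∃ j, V n = simpleRoot j) ∧
      ∀ k < n, ¬ (0 < k ∧ ¬ ∃ j, V k = simpleRoot j) :=
    ⟨Nat.find hex, Nat.find_spec hex, fun k hk => Nat.find_min hex hk⟩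
  have hsimple : ∀ k, 0 < k → k < n → ∃ j, V k = simpleRoot j := by
    intro k hk hkn
    have := hmin' k hkn
    push Not at this
    exact this hk
  have hn2 : 2 ≤ n := by
    by_contra hlt
    obtain rfl : n = 1 := by omega
    exact hnot ⟨v, rfl⟩
  have hnn : ∀ k, k ≤ n → 0 ≤ V k := by
    intro k hk
    match k with
    | 0 => rw [hV0]; exact add_nonneg (simpleRoot_nonneg _) (simpleRoot_nonneg _)
    | 1 => rw [hV1]; exact simpleRoot_nonneg _
    | 2 => rw [hV2]; exact hR
    | k + 3 =>
      obtain ⟨i, hi⟩ := hsimple (k + 1) (by omega) (by omega)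
      obtain ⟨j, hj⟩ := hsimple (k + 2) (by omega) (by omega)
      have h1 := hTV k
      rw [hi, hj] at h1
      have h0 : 0 ≤ V k := by
        rcases Nat.eq_zero_or_pos k with rfl | hk0
        · rw [hV0]; exact add_nonneg (simpleRoot_nonneg _) (simpleRoot_nonneg _)
        · obtain ⟨l, hl⟩ := hsimple k hk0 (by omega)
          rw [hl]; exact simpleRoot_nonneg _
      obtain ⟨w, h2, h3, -⟩ := hA.adjOp_eq_add h1 h0
      have h4 : V (k + 3) = adjOp b (V (k + 2)) - V (k + 1) := rfl
      rw [h4, hj, hi, h2, add_sub_cancel_left]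
      exact h3
  obtain ⟨u, u', hu, hδu, hδu'⟩ : ∃ u u', V n = simpleRoot u + simpleRoot u' ∧
      δ u = 1 ∧ δ u' = 1 := by
    rcases hA.eq_of_weight_two (hnn n le_rfl) (hwt n) with ⟨i, hi, -⟩ | h
    · exact absurd ⟨i, hi⟩ hnot
    · exact h
  obtain ⟨w, hw⟩ := hsimple (n - 1) (by omega) (by omega)
  have hδw := hδ2 _ _ hw
  have hTw : adjOp b (simpleRoot w) = simpleRoot u + simpleRoot u' + V (n - 2) := by
    have := hTV (n - 2)
    rwa [show n - 2 + 1 = n - 1 by omega, show n - 2 + 2 = n by omega, hw, hu] at this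
  have hTu : adjOp b (simpleRoot u) = V (n - 1) := by
    obtain ⟨x, h1, h2, h3⟩ := hA.adjOp_eq_add (i := u) (j := w) (w := simpleRoot u' + V (n - 2))
      (by rw [hTw]; abel) (add_nonneg (simpleRoot_nonneg _) (hnn _ (by omega)))
    rw [h1, hA.eq_zero_of_weight h2 (by rw [h3, hδu, hδw]; norm_num), add_zero, hw]
  have hTu' : adjOp b (simpleRoot u') = V (n - 1) := by
    obtain ⟨x, h1, h2, h3⟩ := hA.adjOp_eq_add (i := u') (j := w) (w := simpleRoot u + V (n - 2))
      (by rw [hTw]; abel) (add_nonneg (simpleRoot_nonneg _) (hnn _ (by omega)))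
    rw [h1, hA.eq_zero_of_weight h2 (by rw [h3, hδu', hδw]; norm_num), add_zero, hw]
  -- beyond the far fork the sequence runs back
  have hrefl' : ∀ j, j ≤ n → V (n + j) = V (n - j) := by
    intro j
    induction j using Nat.twoStepInduction with
    | zero => intro _; rfl
    | one =>
      intro _
      have := hTV (n - 1)
      rw [show n - 1 + 1 = n by omega, show n - 1 + 2 = n + 1 by omega, hu, map_add, hTu,
        hTu'] at this
      exact (add_right_cancel this).symm
    | more j ih1 ih2 =>
      intro hj
      have h1 := hTV (n + j)
      have h2 := hTV (n - (j + 2))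
      rw [add_assoc n j 1, ih2 (by omega), ih1 (by omega),
        show n - (j + 1) = n - (j + 2) + 1 by omega, h2, add_comm (V (n + j + 2)),
        show n - (j + 2) + 2 = n - j by omega] at h1
      exact (add_left_cancel h1).symm
  have hrefl : ∀ i j, i + j = 2 * n → V i = V j := by
    intro i j hij
    rcases le_total i j with h | h
    · have := hrefl' (n - i) (by omega)
      rw [show n + (n - i) = j by omega, show n - (n - i) = i by omega] at this
      exact this.symm
    · have := hrefl' (n - j) (by omega)
      rwa [show n + (n - j) = i by omega, show n - (n - j) = j by omega] at this
  have hnn2 : ∀ k, k ≤ 2 * n → 0 ≤ V k := by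
    intro k hk
    rcases le_total k n with h | h
    · exact hnn k h
    · rw [hrefl k (2 * n - k) (by omega)]; exact hnn _ (by omega)
  -- the far fork does not contain the special vertex, as seen half way
  have hgn : V n o + V n o' = 0 := by
    rw [← hg]
    rcases Nat.even_or_odd' n with ⟨i, hi | hi⟩
    · have h1 := hwave i i le_rfl
      obtain ⟨j, hj⟩ := hsimple i (by omega) (by omega)
      rw [hj, dotProduct_simpleRoot, simpleRoot_self, Nat.sub_self, hg 0, hV0, ← hV0,
        show i + i = n by omega, hV0] at h1
      simp only [Pi.add_apply, simpleRoot_self, simpleRoot_of_ne hoo',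
        simpleRoot_of_ne hoo'.symm] at h1
      rw [hV0]
      linarith
    · have h1 := hwave i (i + 1) (by omega)
      obtain ⟨j, hj⟩ := hsimple i (by omega) (by omega)
      obtain ⟨j', hj'⟩ := hsimple (i + 1) (by omega) (by omega)
      have hjj : simpleRoot j ⬝ᵥ simpleRoot j' = 0 := by
        rw [dotProduct_simpleRoot]
        refine simpleRoot_of_ne ?_
        rintro rfl
        have h2 := hTV (i - 1)
        rw [show i - 1 + 1 = i by omega, show i - 1 + 2 = i + 1 by omega, hj, hj'] at h2
        have h3 := congrFun h2 j
        rw [adjOp_simpleRoot, hA.no_loop, Pi.add_apply, simpleRoot_self] at h3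
        have h4 : 0 ≤ V (i - 1) j := hnn (i - 1) (by omega) j
        push_cast at h3
        linarith
      rw [hj, hj', hjj, show i + 1 - i = 1 by omega, show i + (i + 1) = n by omega, hg 1,
        (hsimple0 1 v rfl).1, (hsimple0 1 v rfl).2] at h1
      linarith
  have hVo : ∀ k, 0 < k → k < 2 * n → V k o = 0 := by
    intro k h1 h2
    rcases lt_trichotomy k n with h | h | h
    · obtain ⟨j, hj⟩ := hsimple k h1 h
      exact (hsimple0 k j hj).1
    · subst h
      have h3 : 0 ≤ V k o := hnn k le_rfl o
      have h4 : 0 ≤ V k o' := hnn k le_rfl o'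
      omega
    · rw [hrefl k (2 * n - k) (by omega)]
      obtain ⟨j, hj⟩ := hsimple (2 * n - k) (by omega) (by omega)
      exact (hsimple0 _ j hj).1
  -- the vertices found make up the whole diagram
  set S : Set J := {i | i = o ∨ i = o' ∨ i = u ∨ i = u' ∨ ∃ k, 0 < k ∧ k < n ∧ V k = simpleRoot i}
    with hS
  have hlist : ∀ m, m ≤ n → ∃ l : List J, V m = (l.map simpleRoot).sum ∧ ∀ i ∈ l, i ∈ S := by
    intro m hm
    rcases Nat.eq_zero_or_pos m with rfl | hm0
    · exact ⟨[o, o'], by simp [hV0], by simp [hS]⟩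
    · rcases hm.lt_or_eq with hlt | rfl
      · obtain ⟨j, hj⟩ := hsimple m hm0 hlt
        exact ⟨[j], by simp [hj], by
          intro i hi
          rw [List.mem_singleton] at hi
          subst hi
          exact Or.inr (Or.inr (Or.inr (Or.inr ⟨m, hm0, hlt, hj⟩)))⟩
      · exact ⟨[u, u'], by simp [hu], by simp [hS]⟩
  have hSall : ∀ i, i ∈ S := by
    refine hA.connected S (Or.inl rfl) ?_
    have hlist1 : ∀ j m, m ≤ n → adjOp b (simpleRoot j) = V m → ∀ i, b j i ≠ 0 → i ∈ S := by
      intro j m hm hj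
      obtain ⟨l, h1, h2⟩ := hlist m hm
      exact mem_of_adjOp_add (hj.trans h1) h2
    rintro j (rfl | rfl | rfl | rfl | ⟨k, hk0, hk, hj⟩)
    · exact hlist1 _ 1 (by omega) hT
    · exact hlist1 _ 1 (by omega) hTo'
    · exact hlist1 _ (n - 1) (by omega) hTu
    · exact hlist1 _ (n - 1) (by omega) hTu'
    · obtain ⟨l, h1, h2⟩ := hlist (k + 1) (by omega)
      obtain ⟨l', h1', h2'⟩ := hlist (k - 1) (by omega)
      have h3 := hTV (k - 1)
      rw [show k - 1 + 1 = k by omega, show k - 1 + 2 = k + 1 by omega, hj, h1, h1'] at h3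
      refine mem_of_adjOp_add (l := l ++ l') (by simpa using h3) ?_
      intro i hi
      rcases List.mem_append.1 hi with hi | hi
      exacts [h2 i hi, h2' i hi]
  refine ⟨⟨2 * n + 2, ?_⟩, ?_, v, hδv⟩
  · set Z : ℕ → J → ℤ := fun k => if k = 0 ∨ k = 2 * n + 2 then simpleRoot o else
      if k = 1 ∨ k = 2 * n + 1 then V 1 else if k = 2 ∨ k = 2 * n then V 2 + simpleRoot o' else
      if k < 2 * n then V k + V (k - 2) else 0 with hZdef
    have hZe : ∀ k, Z k = if k = 0 ∨ k = 2 * n + 2 then simpleRoot o else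
      if k = 1 ∨ k = 2 * n + 1 then V 1 else if k = 2 ∨ k = 2 * n then V 2 + simpleRoot o' else
      if k < 2 * n then V k + V (k - 2) else 0 := fun k => rfl
    have z0 : Z 0 = simpleRoot o := by simp [hZdef]
    have z1 : Z 1 = V 1 := by simp [hZdef]
    have z2 : Z 2 = V 2 + simpleRoot o' := by
      rw [hZe, if_neg (by omega), if_neg (by omega), if_pos (by omega)]
    have zmid : ∀ k, 3 ≤ k → k < 2 * n → Z k = V k + V (k - 2) := by
      intro k h1 h2
      rw [hZe, if_neg (by omega), if_neg (by omega), if_neg (by omega), if_pos (by omega)]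
    have zN : Z (2 * n) = V 2 + simpleRoot o' := by
      rw [hZe, if_neg (by omega), if_neg (by omega), if_pos (by omega)]
    have zN1 : Z (2 * n + 1) = V 1 := by
      rw [hZe, if_neg (by omega), if_pos (by omega)]
    have zN2 : Z (2 * n + 2) = simpleRoot o := by simp [hZdef]
    have zbig : ∀ k, 2 * n + 2 < k → Z k = 0 := by
      intro k hk
      rw [hZe, if_neg (by omega), if_neg (by omega), if_neg (by omega), if_neg (by omega)]
    have hZ : ∀ k, kostantSeq (adjOp b) o (2 * 2) (2 * n + 2 + 2 - 2 * 2) k = Z k := by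
      rw [show 2 * n + 2 + 2 - 2 * 2 = 2 * n by omega, show 2 * 2 = 4 from rfl]
      refine kostantSeq_unique _ _ _ _ _ z0 (by rw [z1, hT, hV1]) ?_
      intro k
      have hcoef : kostantCoeff 4 (2 * n) (k + 2) = (if k = 2 then -1 else 0) +
          (if k + 2 = 2 * n then -1 else 0) + (if k = 2 * n + 2 then 1 else 0) := by
        unfold kostantCoeff
        split_ifs <;> first | contradiction | omega
      have hTo : adjOp b (simpleRoot o) = V 1 := hT
      have hTo2 : adjOp b (simpleRoot o') = V 1 := hTo'
      rw [hcoef]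
      rcases (show k = 0 ∨ k = 1 ∨ k = 2 ∨ 3 ≤ k by omega) with rfl | rfl | rfl | hk3
      · rw [if_neg (by omega), if_neg (by omega), if_neg (by omega), z1, z2, z0, hTV 0, hV0]
        module
      · rw [if_neg (by omega), if_neg (by omega), if_neg (by omega), z1, z2,
          zmid 3 (by omega) (by omega), map_add, hTV 1, hTo2]
        module
      · rw [if_pos rfl, if_neg (show ¬ 2 = 2 * n + 2 by omega), z2,
          zmid (2 + 1) (by omega) (by omega), map_add, hTV 2, show 2 + 1 - 2 = 0 + 1 from rfl,
          hTV 0, show 0 + 2 = 2 from rfl, show 2 + 2 = 4 from rfl]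
        by_cases hn : 4 = 2 * n
        · rw [if_pos hn, hrefl 4 0 (by omega), hn, zN, hV0]
          module
        · rw [if_neg hn, zmid 4 (by omega) (by omega), hV0]
          module
      · rw [if_neg (by omega)]
        obtain ⟨l, rfl⟩ : ∃ l, k = l + 3 := ⟨k - 3, by omega⟩
        rcases lt_trichotomy (l + 3 + 1) (2 * n) with hlt | heq | hgt
        · rw [zmid (l + 3 + 1) (by omega) hlt, zmid (l + 3) (by omega) (by omega), map_add,
            hTV (l + 3), show l + 3 + 1 - 2 = l + 1 + 1 by omega, hTV (l + 1),
            show l + 1 + 2 = l + 3 by ring, show l + 3 - 2 = l + 1 by omega,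
            if_neg (show ¬ l + 3 = 2 * n + 2 by omega)]
          by_cases hN : l + 3 + 2 = 2 * n
          · rw [if_pos hN, hN, zN, hrefl (2 * n) 0 (by omega), hrefl (l + 3) 2 (by omega), hV0]
            module
          · rw [if_neg hN, zmid (l + 3 + 2) (by omega) (by omega),
              show l + 3 + 2 - 2 = l + 3 by omega]
            module
        · rw [heq, zN, zmid (l + 3) (by omega) (by omega), show l + 3 + 2 = 2 * n + 1 by omega,
            zN1, map_add, hTV 1, hTo2, hrefl (l + 3) 1 (by omega), if_neg (by omega),
            if_neg (by omega), hrefl (l + 3 - 2) 3 (by omega)]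
          module
        · rw [if_neg (show ¬ l + 3 + 2 = 2 * n by omega)]
          rcases (show l + 3 = 2 * n ∨ l + 3 = 2 * n + 1 ∨ l + 3 = 2 * n + 2 ∨ 2 * n + 2 < l + 3 by
            omega) with h | h | h | h
          · rw [h, zN, zN1, zN2, if_neg (by omega), hTV 0, hV0]
            module
          · rw [h, zN1, show 2 * n + 1 + 1 = 2 * n + 2 by ring, zN2, zbig _ (by omega),
              if_neg (by omega), hTo]
            module
          · rw [h, zN2, zbig _ (by omega), zbig _ (by omega), if_pos rfl, map_zero]
            module
          · rw [zbig _ h, zbig _ (by omega), zbig _ (by omega), if_neg (by omega), map_zero]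
            module
    have hZo : ∀ k, 0 < k → k < 2 * n + 2 → Z k o = 0 := by
      intro k h1 h2
      rw [hZe, if_neg (by omega)]
      split_ifs with h3 h4 h5
      · exact hVo 1 (by omega) (by omega)
      · rw [Pi.add_apply, hVo 2 (by omega) (by omega), simpleRoot_of_ne hoo'.symm, add_zero]
      · rw [Pi.add_apply, hVo k h1 h5, hVo (k - 2) (by omega) (by omega), add_zero]
      · rfl
    have hcut : ∀ k, 0 < k → k + 2 < 2 * n → V (k + 2) = cutOp (adjOp b) o (V (k + 1)) - V k := by
      intro k h1 h2
      rw [← offProj_eq_self (hVo (k + 2) (by omega) h2), ← offProj_eq_self (hVo k h1 (by omega)),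
        cutOp, LinearMap.comp_apply, hTV, map_add, offProj_eq_self (hVo k h1 (by omega))]
      abel
    have hoo1 : offProj o (simpleRoot o') = simpleRoot o' :=
      offProj_eq_self (simpleRoot_of_ne hoo'.symm)
    have hp1 : offProj o (V 1) = V 1 := offProj_eq_self (hVo 1 (by omega) (by omega))
    have hp2 : offProj o (V 2) = V 2 := offProj_eq_self (hVo 2 (by omega) (by omega))
    have hcut0 : cutOp (adjOp b) o (simpleRoot o') = V 1 := by
      rw [cutOp, LinearMap.comp_apply, hTo']; exact hp1
    have hcut1 : cutOp (adjOp b) o (V 1) = V 2 + simpleRoot o' := by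
      rw [cutOp, LinearMap.comp_apply, hTV 0, map_add, hp2, hV0, map_add, hoo1, offProj_simpleRoot,
        zero_add]
    have ho'K : simpleRoot o' ∈ chebKer (adjOp b) o (2 * n + 2) := by
      have := mem_chebKer_of_recursion (T := adjOp b) (o := o) (h := 2 * n + 2)
        (fun k => if k = 0 ∨ k = 2 * n + 2 then 0 else
          if k = 1 ∨ k = 2 * n + 1 then simpleRoot o' else V (k - 1)) (by simp) ?_ (by simp)
      · simpa using this
      · intro k hk
        have hcutn : cutOp (adjOp b) o (V (2 * n - 1)) = V (2 * n - 2) + simpleRoot o' := by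
          rw [hrefl (2 * n - 1) 1 (by omega), hrefl (2 * n - 2) 2 (by omega), hcut1]
        rcases (show k = 0 ∨ k = 1 ∨ 2 ≤ k by omega) with rfl | rfl | hk2
        · rw [if_neg (by omega), if_neg (by omega), if_neg (by omega), if_pos (by omega),
            if_pos (by omega), hcut0, sub_zero]
        · rw [if_neg (by omega), if_neg (by omega), if_neg (by omega), if_neg (by omega),
            if_neg (by omega), if_pos (by omega)]
          change V 2 = cutOp (adjOp b) o (V 1) - simpleRoot o'
          rw [hcut1, add_sub_cancel_right]
        · rcases (show k + 2 < 2 * n + 1 ∨ k + 2 = 2 * n + 1 ∨ k = 2 * n by omega) with h | h | h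
          · rw [if_neg (by omega), if_neg (by omega), if_neg (by omega), if_neg (by omega),
              if_neg (by omega), if_neg (by omega), show k + 2 - 1 = k - 1 + 2 by omega,
              show k + 1 - 1 = k - 1 + 1 by omega]
            exact hcut (k - 1) (by omega) (by omega)
          · rw [if_neg (by omega), if_pos (by omega), if_neg (by omega), if_neg (by omega),
              if_neg (by omega), if_neg (by omega), show k + 1 - 1 = 2 * n - 1 by omega, hcutn,
              show k - 1 = 2 * n - 2 by omega, add_sub_cancel_left]
          · rw [if_pos (by omega), if_neg (by omega), if_pos (by omega), if_neg (by omega),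
              if_neg (by omega), h, hcut0, hrefl (2 * n - 1) 1 (by omega), sub_self]
    have hVK : ∀ k, 0 < k → k < 2 * n → V k ∈ chebKer (adjOp b) o (2 * n + 2) := by
      intro k
      induction k using Nat.twoStepInduction with
      | zero => intro h; omega
      | one => intro _ _; rw [← hcut0]; exact cutOp_mem_chebKer ho'K
      | more k ih1 ih2 =>
        intro _ hk
        rcases Nat.eq_zero_or_pos k with rfl | hk0
        · have : V (0 + 2) = cutOp (adjOp b) o (V 1) - simpleRoot o' := by
            rw [hcut1, add_sub_cancel_right]
          rw [this]
          exact Submodule.sub_mem _ (cutOp_mem_chebKer (ih2 (by omega) (by omega))) ho'K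
        · rw [hcut k hk0 hk]
          exact Submodule.sub_mem _ (cutOp_mem_chebKer (ih2 (by omega) (by omega)))
            (ih1 hk0 (by omega))
    have huu : simpleRoot u + simpleRoot u' ∈ chebKer (adjOp b) o (2 * n + 2) := by
      rw [← hu]; exact hVK n hn0 (by omega)
    have huu' : simpleRoot u - simpleRoot u' ∈ chebKer (adjOp b) o (2 * n + 2) := by
      refine mem_chebKer_of_cutOp_eq_zero ?_ ⟨n + 1, by ring⟩
      rw [cutOp, LinearMap.comp_apply, map_sub, hTu, hTu', sub_self, map_zero]
    have hc : 2 * n + 2 + 2 - 2 * 2 = 2 * n := by omega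
    refine ⟨by omega, by omega, ?_, ?_, ?_, ?_, ?_, ?_⟩
    · intro k i
      rw [hZ, hZe]
      split_ifs with h1 h2 h3 h4
      · exact simpleRoot_nonneg o i
      · exact hnn2 1 (by omega) i
      · exact add_nonneg (hnn2 2 (by omega)) (simpleRoot_nonneg o') i
      · exact add_nonneg (hnn2 k (by omega)) (hnn2 (k - 2) (by omega)) i
      · exact le_rfl
    · rw [hT]
      exact ne_zero_of_weight (δ := δ) (by rw [weight_simpleRoot, hδv]; norm_num)
    · intro k h1 h2
      rw [hZ, hZo k h1 h2]
    · rw [hZ, zN2]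
    · intro k hk
      rw [hZ, zbig k hk]
    · refine mem_chebKer_of_forall fun i hi => ?_
      rcases hSall i with rfl | rfl | rfl | rfl | ⟨k, hk0, hk, hj⟩
      · exact absurd rfl hi
      · exact ho'K
      · refine mem_chebKer_of_smul two_ne_zero ?_
        have := Submodule.add_mem _ huu huu'
        convert this using 1
        module
      · refine mem_chebKer_of_smul two_ne_zero ?_
        have := Submodule.sub_mem _ huu huu'
        convert this using 1
        module
      · rw [← hj]; exact hVK k hk0 (by omega)
  · intro j
    rcases hSall j with rfl | rfl | rfl | rfl | ⟨k, -, -, hj⟩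
    · omega
    · omega
    · omega
    · omega
    · exact (hδ2 k j hj).le

end IsAffineDiagram

end Diagram

/-! ### The three exceptional diagrams -/

section Exceptional

/-- The adjacency matrix of the graph on `Fin n` with the given edges. -/
def edgeMatrix (n : ℕ) (l : List (ℕ × ℕ)) : Matrix (Fin n) (Fin n) ℕ :=
  Matrix.of fun i j => if (i.1, j.1) ∈ l ∨ (j.1, i.1) ∈ l then 1 else 0

/-- The affine diagram of type `E₆`, with special vertex `0` and central vertex `2`. -/
def affineE6 : Matrix (Fin 7) (Fin 7) ℕ :=
  edgeMatrix 7 [(0, 1), (1, 2), (2, 3), (2, 4), (3, 5), (4, 6)]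

/-- The affine diagram of type `E₇`, with special vertex `0` and central vertex `3`. -/
def affineE7 : Matrix (Fin 8) (Fin 8) ℕ :=
  edgeMatrix 8 [(0, 1), (1, 2), (2, 3), (3, 4), (3, 5), (5, 6), (6, 7)]

/-- The affine diagram of type `E₈`, with special vertex `0` and central vertex `5`. -/
def affineE8 : Matrix (Fin 9) (Fin 9) ℕ :=
  edgeMatrix 9 [(0, 1), (1, 2), (2, 3), (3, 4), (4, 5), (5, 6), (5, 7), (7, 8)]

/-- The sequence `z 0, …, z h` with the given first half and `z (h - k) = z k`, continued by
zero. -/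
def palindrome {n : ℕ} (h : ℕ) (l : List (Fin n → ℤ)) (k : ℕ) : Fin n → ℤ :=
  if k ≤ h then l.getD (min k (h - k)) 0 else 0

/-- A finite check for the first conditions of `IsKostant`. -/
theorem isKostant_of_table {n h d : ℕ} (M : Matrix (Fin (n + 1)) (Fin (n + 1)) ℕ)
    (l : List (Fin (n + 1) → ℤ)) (hd : 1 ≤ d) (hdh : 2 * d ≤ h)
    (h0 : ∀ i, palindrome h l 0 i = if i = 0 then 1 else 0)
    (h1 : ∀ i, palindrome h l 1 i = M 0 i)
    (h2 : ∀ k < h + 3, ∀ i, palindrome h l (k + 2) i =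
      ∑ j, (M j i : ℤ) * palindrome h l (k + 1) j - palindrome h l k i +
        kostantCoeff (2 * d) (h + 2 - 2 * d) (k + 2) * if i = 0 then 1 else 0)
    (hnn : ∀ k < h + 1, ∀ i, 0 ≤ palindrome h l k i)
    (hsp : ∀ k < h, 0 < k → palindrome h l k 0 = 0)
    (htop : ∀ i, palindrome h l h i = if i = 0 then 1 else 0)
    (hM : M 0 0 = 0) (hM1 : M 0 1 = 1)
    (hK : adjOp M (simpleRoot 0) ∈ chebKer (adjOp M) 0 h →
      ∀ i, i ≠ 0 → simpleRoot i ∈ chebKer (adjOp M) 0 h) :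
    IsKostant (adjOp M) 0 h d := by
  have hs : ∀ i : Fin (n + 1), (simpleRoot 0 : Fin (n + 1) → ℤ) i = if i = 0 then 1 else 0 :=
    fun i => by simp [simpleRoot, Pi.single_apply]
  have hbig : ∀ k, h < k → palindrome h l k = 0 := fun k hk => by
    rw [palindrome, if_neg (by omega)]
  have hZ : ∀ k, kostantSeq (adjOp M) 0 (2 * d) (h + 2 - 2 * d) k = palindrome h l k := by
    refine kostantSeq_unique _ _ _ _ _ ?_ ?_ ?_
    · ext i; rw [h0, hs]
    · ext i; rw [h1, adjOp_simpleRoot]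
    · intro k
      rcases lt_or_ge k (h + 3) with hk | hk
      · ext i
        rw [h2 k hk i, Pi.add_apply, Pi.sub_apply, Pi.smul_apply, hs, adjOp_apply, smul_eq_mul]
      · have hc : kostantCoeff (2 * d) (h + 2 - 2 * d) (k + 2) = 0 := by
          unfold kostantCoeff
          split_ifs <;> first | contradiction | omega
        rw [hbig _ (by omega), hbig _ (by omega), hbig _ (by omega), hc]
        simp
  have hZo : ∀ k, 0 < k → k < h → kostantSeq (adjOp M) 0 (2 * d) (h + 2 - 2 * d) k 0 = 0 :=
    fun k hk hkh => by rw [hZ, hsp k hkh hk]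
  have hZh : kostantSeq (adjOp M) 0 (2 * d) (h + 2 - 2 * d) h = simpleRoot 0 := by
    rw [hZ]; ext i; rw [htop, hs]
  refine ⟨hd, hdh, ?_, ?_, hZo, hZh, ?_, ?_⟩
  · intro k i
    rw [hZ]
    rcases lt_or_ge k (h + 1) with hk | hk
    · exact hnn k hk i
    · rw [hbig k (by omega)]; exact le_rfl
  · intro h'
    have := congrFun h' 1
    rw [adjOp_simpleRoot, hM1] at this
    simp at this
  · intro k hk
    rw [hZ, hbig k hk]
  · exact mem_chebKer_of_forall (hK (apply_special_mem_chebKer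
      (by rw [adjOp_simpleRoot, hM]; rfl) hZo hZh))

theorem cutOp_simpleRoot {n : ℕ} (M : Matrix (Fin (n + 1)) (Fin (n + 1)) ℕ) (j : Fin (n + 1))
    (v : Fin (n + 1) → ℤ) (h : ∀ i, (if i = 0 then 0 else (M j i : ℤ)) = v i) :
    cutOp (adjOp M) 0 (simpleRoot j) = v := by
  ext i
  rw [← h, cutOp, LinearMap.comp_apply, offProj_apply, adjOp_simpleRoot]

theorem isKostant_affineE6 : IsKostant (adjOp affineE6) 0 12 3 := by
  refine isKostant_of_table (n := 6) affineE6 [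
    ![1, 0, 0, 0, 0, 0, 0],
    ![0, 1, 0, 0, 0, 0, 0],
    ![0, 0, 1, 0, 0, 0, 0],
    ![0, 0, 0, 1, 1, 0, 0],
    ![0, 0, 1, 0, 0, 1, 1],
    ![0, 1, 0, 1, 1, 0, 0],
    ![0, 0, 2, 0, 0, 0, 0]] (by decide) (by decide)
    (by decide +kernel) (by decide +kernel) (by decide +kernel) (by decide +kernel)
    (by decide +kernel) (by decide +kernel) (by decide +kernel) (by decide +kernel) fun hK => ?_
  have c0 : adjOp affineE6 (simpleRoot 0) = simpleRoot 1 := by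
    ext i; rw [adjOp_simpleRoot]; revert i; decide +kernel
  have c1 := cutOp_simpleRoot affineE6 1 (simpleRoot 2) (by decide +kernel)
  have c2 := cutOp_simpleRoot affineE6 2 (simpleRoot 1 + simpleRoot 3 + simpleRoot 4)
    (by decide +kernel)
  have c3 := cutOp_simpleRoot affineE6 3 (simpleRoot 2 + simpleRoot 5) (by decide +kernel)
  have c4 := cutOp_simpleRoot affineE6 4 (simpleRoot 2 + simpleRoot 6) (by decide +kernel)
  have c5 := cutOp_simpleRoot affineE6 5 (simpleRoot 3) (by decide +kernel)
  have c6 := cutOp_simpleRoot affineE6 6 (simpleRoot 4) (by decide +kernel)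
  set K := chebKer (adjOp affineE6) 0 12
  have k1 : simpleRoot 1 ∈ K := by rwa [c0] at hK
  have k2 : simpleRoot 2 ∈ K := by rw [← c1]; exact cutOp_mem_chebKer k1
  have s1 : simpleRoot 3 + simpleRoot 4 ∈ K := by
    have := Submodule.sub_mem _ (cutOp_mem_chebKer k2) k1
    rw [c2] at this
    convert this using 1
    abel
  -- on the difference of the two arms the diagram has eigenvalues `±1`
  have s2 : simpleRoot 3 - simpleRoot 4 ∈ K := by
    refine mem_chebKer_of_cutOp_sq ?_ (by decide)
    rw [map_sub, c3, c4, map_sub, map_add, map_add, c5, c6]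
    abel
  have k3 : simpleRoot 3 ∈ K := by
    refine mem_chebKer_of_smul two_ne_zero ?_
    convert Submodule.add_mem _ s1 s2 using 1
    module
  have k4 : simpleRoot 4 ∈ K := by
    convert Submodule.sub_mem _ s1 k3 using 1
    abel
  have k5 : simpleRoot 5 ∈ K := by
    convert Submodule.sub_mem _ (cutOp_mem_chebKer k3) k2 using 1
    rw [c3]; abel
  have k6 : simpleRoot 6 ∈ K := by
    convert Submodule.sub_mem _ (cutOp_mem_chebKer k4) k2 using 1
    rw [c4]; abel
  intro i hi
  fin_cases i
  exacts [absurd rfl hi, k1, k2, k3, k4, k5, k6]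

theorem isKostant_affineE7 : IsKostant (adjOp affineE7) 0 18 4 := by
  refine isKostant_of_table (n := 7) affineE7 [
    ![1, 0, 0, 0, 0, 0, 0, 0],
    ![0, 1, 0, 0, 0, 0, 0, 0],
    ![0, 0, 1, 0, 0, 0, 0, 0],
    ![0, 0, 0, 1, 0, 0, 0, 0],
    ![0, 0, 0, 0, 1, 1, 0, 0],
    ![0, 0, 0, 1, 0, 0, 1, 0],
    ![0, 0, 1, 0, 0, 1, 0, 1],
    ![0, 1, 0, 1, 0, 0, 1, 0],
    ![0, 0, 1, 0, 1, 1, 0, 0],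
    ![0, 0, 0, 2, 0, 0, 0, 0]] (by decide) (by decide)
    (by decide +kernel) (by decide +kernel) (by decide +kernel) (by decide +kernel)
    (by decide +kernel) (by decide +kernel) (by decide +kernel) (by decide +kernel) fun hK => ?_
  have c0 : adjOp affineE7 (simpleRoot 0) = simpleRoot 1 := by
    ext i; rw [adjOp_simpleRoot]; revert i; decide +kernel
  have c1 := cutOp_simpleRoot affineE7 1 (simpleRoot 2) (by decide +kernel)
  have c2 := cutOp_simpleRoot affineE7 2 (simpleRoot 1 + simpleRoot 3) (by decide +kernel)
  have c3 := cutOp_simpleRoot affineE7 3 (simpleRoot 2 + simpleRoot 4 + simpleRoot 5)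
    (by decide +kernel)
  have c4 := cutOp_simpleRoot affineE7 4 (simpleRoot 3) (by decide +kernel)
  have c5 := cutOp_simpleRoot affineE7 5 (simpleRoot 3 + simpleRoot 6) (by decide +kernel)
  have c6 := cutOp_simpleRoot affineE7 6 (simpleRoot 5 + simpleRoot 7) (by decide +kernel)
  have c7 := cutOp_simpleRoot affineE7 7 (simpleRoot 6) (by decide +kernel)
  set K := chebKer (adjOp affineE7) 0 18
  have k1 : simpleRoot 1 ∈ K := by rwa [c0] at hK
  have k2 : simpleRoot 2 ∈ K := by rw [← c1]; exact cutOp_mem_chebKer k1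
  have k3 : simpleRoot 3 ∈ K := by
    convert Submodule.sub_mem _ (cutOp_mem_chebKer k2) k1 using 1
    rw [c2]; abel
  have s1 : simpleRoot 4 + simpleRoot 5 ∈ K := by
    convert Submodule.sub_mem _ (cutOp_mem_chebKer k3) k2 using 1
    rw [c3]; abel
  have k6 : simpleRoot 6 ∈ K := by
    convert Submodule.sub_mem _ (Submodule.sub_mem _ (cutOp_mem_chebKer s1) k3) k3 using 1
    rw [map_add, c4, c5]; abel
  have s2 : simpleRoot 5 + simpleRoot 7 ∈ K := by
    rw [← c6]; exact cutOp_mem_chebKer k6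
  have s3 : simpleRoot 4 - simpleRoot 5 + simpleRoot 7 ∈ K := by
    refine mem_chebKer_of_cutOp_eq_zero ?_ (by decide)
    rw [map_add, map_sub, c4, c5, c7]; abel
  have k5 : simpleRoot 5 ∈ K := by
    refine mem_chebKer_of_smul three_ne_zero ?_
    convert Submodule.add_mem _ (Submodule.sub_mem _ s1 s3) s2 using 1
    module
  have k4 : simpleRoot 4 ∈ K := by
    convert Submodule.sub_mem _ s1 k5 using 1
    abel
  have k7 : simpleRoot 7 ∈ K := by
    convert Submodule.sub_mem _ s2 k5 using 1
    abel
  intro i hi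
  fin_cases i
  exacts [absurd rfl hi, k1, k2, k3, k4, k5, k6, k7]

theorem isKostant_affineE8 : IsKostant (adjOp affineE8) 0 30 6 := by
  refine isKostant_of_table (n := 8) affineE8 [
    ![1, 0, 0, 0, 0, 0, 0, 0, 0],
    ![0, 1, 0, 0, 0, 0, 0, 0, 0],
    ![0, 0, 1, 0, 0, 0, 0, 0, 0],
    ![0, 0, 0, 1, 0, 0, 0, 0, 0],
    ![0, 0, 0, 0, 1, 0, 0, 0, 0],
    ![0, 0, 0, 0, 0, 1, 0, 0, 0],
    ![0, 0, 0, 0, 0, 0, 1, 1, 0],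
    ![0, 0, 0, 0, 0, 1, 0, 0, 1],
    ![0, 0, 0, 0, 1, 0, 0, 1, 0],
    ![0, 0, 0, 1, 0, 1, 0, 0, 0],
    ![0, 0, 1, 0, 1, 0, 1, 0, 0],
    ![0, 1, 0, 1, 0, 1, 0, 0, 0],
    ![0, 0, 1, 0, 1, 0, 0, 1, 0],
    ![0, 0, 0, 1, 0, 1, 0, 0, 1],
    ![0, 0, 0, 0, 1, 0, 1, 1, 0],
    ![0, 0, 0, 0, 0, 2, 0, 0, 0]] (by decide) (by decide)
    (by decide +kernel) (by decide +kernel) (by decide +kernel) (by decide +kernel)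
    (by decide +kernel) (by decide +kernel) (by decide +kernel) (by decide +kernel) fun hK => ?_
  have c0 : adjOp affineE8 (simpleRoot 0) = simpleRoot 1 := by
    ext i; rw [adjOp_simpleRoot]; revert i; decide +kernel
  have c1 := cutOp_simpleRoot affineE8 1 (simpleRoot 2) (by decide +kernel)
  have c2 := cutOp_simpleRoot affineE8 2 (simpleRoot 1 + simpleRoot 3) (by decide +kernel)
  have c3 := cutOp_simpleRoot affineE8 3 (simpleRoot 2 + simpleRoot 4) (by decide +kernel)
  have c4 := cutOp_simpleRoot affineE8 4 (simpleRoot 3 + simpleRoot 5) (by decide +kernel)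
  have c5 := cutOp_simpleRoot affineE8 5 (simpleRoot 4 + simpleRoot 6 + simpleRoot 7)
    (by decide +kernel)
  have c6 := cutOp_simpleRoot affineE8 6 (simpleRoot 5) (by decide +kernel)
  have c7 := cutOp_simpleRoot affineE8 7 (simpleRoot 5 + simpleRoot 8) (by decide +kernel)
  have c8 := cutOp_simpleRoot affineE8 8 (simpleRoot 7) (by decide +kernel)
  set K := chebKer (adjOp affineE8) 0 30
  have k1 : simpleRoot 1 ∈ K := by rwa [c0] at hK
  have k2 : simpleRoot 2 ∈ K := by rw [← c1]; exact cutOp_mem_chebKer k1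
  have k3 : simpleRoot 3 ∈ K := by
    convert Submodule.sub_mem _ (cutOp_mem_chebKer k2) k1 using 1
    rw [c2]; abel
  have k4 : simpleRoot 4 ∈ K := by
    convert Submodule.sub_mem _ (cutOp_mem_chebKer k3) k2 using 1
    rw [c3]; abel
  have k5 : simpleRoot 5 ∈ K := by
    convert Submodule.sub_mem _ (cutOp_mem_chebKer k4) k3 using 1
    rw [c4]; abel
  have s1 : simpleRoot 6 + simpleRoot 7 ∈ K := by
    convert Submodule.sub_mem _ (cutOp_mem_chebKer k5) k4 using 1
    rw [c5]; abel
  have k8 : simpleRoot 8 ∈ K := by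
    convert Submodule.sub_mem _ (Submodule.sub_mem _ (cutOp_mem_chebKer s1) k5) k5 using 1
    rw [map_add, c6, c7]; abel
  have k7 : simpleRoot 7 ∈ K := by rw [← c8]; exact cutOp_mem_chebKer k8
  have k6 : simpleRoot 6 ∈ K := by
    convert Submodule.sub_mem _ s1 k7 using 1
    abel
  intro i hi
  fin_cases i
  exacts [absurd rfl hi, k1, k2, k3, k4, k5, k6, k7, k8]

end Exceptional

/-! ### The classification of affine diagrams -/

section Classification

variable {J : Type} [Fintype J] [DecidableEq J]

namespace IsAffineDiagram

variable {b : Matrix J J ℕ} {δ : J → ℕ} {o : J}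

/-- A list of vertices `v` whose neighbours are described by the diagram `M` exhausts the given
diagram, which inherits Kostant's arithmetic from `M`. -/
theorem isKostant_of_model (hA : IsAffineDiagram b δ o) {n h d : ℕ}
    {M : Matrix (Fin (n + 1)) (Fin (n + 1)) ℕ} (hM : IsKostant (adjOp M) 0 h d)
    (v : Fin (n + 1) → J) (hv0 : v 0 = o) (hne : ∀ x, x ≠ 0 → v x ≠ o)
    (hv : ∀ x, adjOp b (simpleRoot (v x)) = ∑ y, (M x y : ℤ) • simpleRoot (v y))
    (hle : ∀ x, δ (v x) ≤ d) (hex : ∃ x, δ (v x) = d) :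
    ∃ h d, IsKostant (adjOp b) o h d ∧ (∀ j, δ j ≤ d) ∧ ∃ j, δ j = d := by
  have hsurj : Function.Surjective v := by
    refine hA.connected (Set.range v) ⟨0, hv0⟩ ?_
    rintro _ ⟨x, rfl⟩ i hi
    by_contra hS
    have h1 := congrFun (hv x) i
    rw [adjOp_simpleRoot, Finset.sum_apply, Finset.sum_eq_zero] at h1
    · exact hi (by exact_mod_cast h1)
    · intro y _
      rw [Pi.smul_apply, simpleRoot_of_ne, smul_zero]
      rintro rfl
      exact hS ⟨y, rfl⟩
  refine ⟨h, d, hM.push v hsurj (fun x => ?_) (fun x => ⟨fun h => ?_, ?_⟩), ?_, ?_⟩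
  · rw [hv]
    simp only [adjOp_simpleRoot]
  · by_contra hx; exact hne x hx h
  · rintro rfl; exact hv0
  · intro j
    obtain ⟨x, rfl⟩ := hsurj j
    exact hle x
  · obtain ⟨x, hx⟩ := hex
    exact ⟨v x, hx⟩

theorem isKostant_of_E6 (hA : IsAffineDiagram b δ o) {v₁ v₂ i j k l : J}
    (h₀ : adjOp b (simpleRoot o) = simpleRoot v₁)
    (h₁ : adjOp b (simpleRoot v₁) = simpleRoot o + simpleRoot v₂)
    (h₂ : adjOp b (simpleRoot v₂) = simpleRoot v₁ + (simpleRoot i + simpleRoot j))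
    (hi : adjOp b (simpleRoot i) = simpleRoot v₂ + simpleRoot k)
    (hj : adjOp b (simpleRoot j) = simpleRoot v₂ + simpleRoot l)
    (hk : adjOp b (simpleRoot k) = simpleRoot i) (hl : adjOp b (simpleRoot l) = simpleRoot j)
    (d₁ : δ v₁ = 2) (d₂ : δ v₂ = 3) (di : δ i = 2) (dj : δ j = 2) (dk : δ k = 1) (dl : δ l = 1) :
    ∃ h d, IsKostant (adjOp b) o h d ∧ (∀ j, δ j ≤ d) ∧ ∃ j, δ j = d := by
  have hδ := hA.special
  have hvi : v₁ ≠ i := by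
    rintro rfl
    have := hA.le_of_double h₂ (simpleRoot_nonneg j)
    omega
  have hvj : v₁ ≠ j := by
    rintro rfl
    rw [add_comm (simpleRoot i)] at h₂
    have := hA.le_of_double h₂ (simpleRoot_nonneg i)
    omega
  have n₁ : v₁ ≠ o := by rintro rfl; omega
  have n₂ : v₂ ≠ o := by rintro rfl; omega
  have ni : i ≠ o := by rintro rfl; omega
  have nj : j ≠ o := by rintro rfl; omega
  have nk : k ≠ o := by rintro rfl; exact hvi (simpleRoot_injective (h₀.symm.trans hk))
  have nl : l ≠ o := by rintro rfl; exact hvj (simpleRoot_injective (h₀.symm.trans hl))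
  refine hA.isKostant_of_model isKostant_affineE6 ![o, v₁, v₂, i, j, k, l] rfl ?_ ?_ ?_ ⟨2, d₂⟩
  · intro x hx
    fin_cases x
    exacts [absurd rfl hx, n₁, n₂, ni, nj, nk, nl]
  · intro x
    fin_cases x <;> simp [Fin.sum_univ_succ, affineE6, edgeMatrix, h₀, h₁, h₂, hi, hj, hk, hl]
  · intro x
    fin_cases x
    exacts [by simp [hδ], d₁.le.trans (by norm_num), d₂.le, di.le.trans (by norm_num),
      dj.le.trans (by norm_num), dk.le.trans (by norm_num), dl.le.trans (by norm_num)]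

theorem isKostant_of_E7 (hA : IsAffineDiagram b δ o) {v₁ v₂ v₃ i j k l : J}
    (h₀ : adjOp b (simpleRoot o) = simpleRoot v₁)
    (h₁ : adjOp b (simpleRoot v₁) = simpleRoot o + simpleRoot v₂)
    (h₂ : adjOp b (simpleRoot v₂) = simpleRoot v₁ + simpleRoot v₃)
    (h₃ : adjOp b (simpleRoot v₃) = simpleRoot v₂ + (simpleRoot i + simpleRoot j))
    (hi : adjOp b (simpleRoot i) = simpleRoot v₃)
    (hj : adjOp b (simpleRoot j) = simpleRoot v₃ + simpleRoot k)
    (hk : adjOp b (simpleRoot k) = simpleRoot j + simpleRoot l)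
    (hl : adjOp b (simpleRoot l) = simpleRoot k)
    (d₁ : δ v₁ = 2) (d₂ : δ v₂ = 3) (d₃ : δ v₃ = 4) (di : δ i = 2) (dj : δ j = 3) (dk : δ k = 2)
    (dl : δ l = 1) :
    ∃ h d, IsKostant (adjOp b) o h d ∧ (∀ j, δ j ≤ d) ∧ ∃ j, δ j = d := by
  have hδ := hA.special
  have hvj : v₂ ≠ j := by
    rintro rfl
    rw [add_comm (simpleRoot i)] at h₃
    have := hA.le_of_double h₃ (simpleRoot_nonneg i)
    omega
  have n₁ : v₁ ≠ o := by rintro rfl; omega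
  have n₂ : v₂ ≠ o := by rintro rfl; omega
  have n₃ : v₃ ≠ o := by rintro rfl; omega
  have ni : i ≠ o := by rintro rfl; omega
  have nj : j ≠ o := by rintro rfl; omega
  have nk : k ≠ o := by rintro rfl; omega
  have nl : l ≠ o := by
    rintro rfl
    obtain rfl := simpleRoot_injective (h₀.symm.trans hl)
    rw [h₁, add_comm] at hk
    exact hvj (simpleRoot_injective (add_right_cancel hk))
  refine hA.isKostant_of_model isKostant_affineE7 ![o, v₁, v₂, v₃, i, j, k, l] rfl ?_ ?_ ?_ ⟨3, d₃⟩
  · intro x hx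
    fin_cases x
    exacts [absurd rfl hx, n₁, n₂, n₃, ni, nj, nk, nl]
  · intro x
    fin_cases x <;> simp [Fin.sum_univ_succ, affineE7, edgeMatrix, h₀, h₁, h₂, h₃, hi, hj, hk, hl]
  · intro x
    fin_cases x
    exacts [by simp [hδ], d₁.le.trans (by norm_num), d₂.le.trans (by norm_num), d₃.le,
      di.le.trans (by norm_num), dj.le.trans (by norm_num), dk.le.trans (by norm_num),
      dl.le.trans (by norm_num)]

theorem isKostant_of_E8 (hA : IsAffineDiagram b δ o) {v₁ v₂ v₃ v₄ v₅ i j k : J}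
    (h₀ : adjOp b (simpleRoot o) = simpleRoot v₁)
    (h₁ : adjOp b (simpleRoot v₁) = simpleRoot o + simpleRoot v₂)
    (h₂ : adjOp b (simpleRoot v₂) = simpleRoot v₁ + simpleRoot v₃)
    (h₃ : adjOp b (simpleRoot v₃) = simpleRoot v₂ + simpleRoot v₄)
    (h₄ : adjOp b (simpleRoot v₄) = simpleRoot v₃ + simpleRoot v₅)
    (h₅ : adjOp b (simpleRoot v₅) = simpleRoot v₄ + (simpleRoot i + simpleRoot j))
    (hi : adjOp b (simpleRoot i) = simpleRoot v₅)
    (hj : adjOp b (simpleRoot j) = simpleRoot v₅ + simpleRoot k)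
    (hk : adjOp b (simpleRoot k) = simpleRoot j)
    (d₁ : δ v₁ = 2) (d₂ : δ v₂ = 3) (d₃ : δ v₃ = 4) (d₄ : δ v₄ = 5) (d₅ : δ v₅ = 6) (di : δ i = 3)
    (dj : δ j = 4) (dk : δ k = 2) :
    ∃ h d, IsKostant (adjOp b) o h d ∧ (∀ j, δ j ≤ d) ∧ ∃ j, δ j = d := by
  have hδ := hA.special
  refine hA.isKostant_of_model isKostant_affineE8 ![o, v₁, v₂, v₃, v₄, v₅, i, j, k] rfl ?_ ?_ ?_
    ⟨5, d₅⟩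
  · intro x hx hxo
    have : δ (![o, v₁, v₂, v₃, v₄, v₅, i, j, k] x) = 1 := by rw [hxo, hδ]
    fin_cases x <;> simp_all
  · intro x
    fin_cases x <;> simp [Fin.sum_univ_succ, affineE8, edgeMatrix, h₀, h₁, h₂, h₃, h₄, h₅, hi, hj,
      hk]
  · intro x
    fin_cases x <;> simp [hδ, d₁, d₂, d₃, d₄, d₅, di, dj, dk]

/-- Every affine diagram satisfies Kostant's arithmetic, with `d` the largest weight. From the
special vertex on, the weights are `1, 2, …` along a chain up to the first branching, and
additivity leaves only the diagrams of type `A`, `D`, `E₆`, `E₇` and `E₈`. -/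
theorem exists_isKostant (hA : IsAffineDiagram b δ o) :
    ∃ h d, IsKostant (adjOp b) o h d ∧ (∀ j, δ j ≤ d) ∧ ∃ j, δ j = d := by
  have hδo := hA.special
  have hwo : weight δ (adjOp b (simpleRoot o)) = 2 := by
    rw [hA.weight_adjOp, weight_simpleRoot, hδo]; rfl
  rcases hA.eq_of_weight_two (adjOp_nonneg (simpleRoot_nonneg o)) hwo with
    ⟨v₁, hT, hδ₁⟩ | ⟨p, q, hT, hp, hq⟩
  swap
  · obtain ⟨⟨h, hK⟩, hall⟩ := hA.isKostant_of_cycle hp hq hT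
    exact ⟨h, 1, hK, fun j => (hall j).le, o, hδo⟩
  set V := walk (adjOp b) (simpleRoot o) (simpleRoot v₁) with hV
  have hTV : ∀ k, adjOp b (V (k + 1)) = V (k + 2) + V k := apply_walk _ _ _
  have hex : ∃ n, ¬ ∃ j, V n = simpleRoot j ∧ δ j = n + 1 := by
    by_contra hno
    push Not at hno
    obtain ⟨j, -, hj⟩ := hno (∑ i, δ i)
    have := Finset.single_le_sum (f := δ) (fun i _ => Nat.zero_le _) (Finset.mem_univ j)
    omega
  classical
  obtain ⟨n, hnot, hmin⟩ : ∃ n, (¬ ∃ j, V n = simpleRoot j ∧ δ j = n + 1) ∧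
      ∀ k < n, ∃ j, V k = simpleRoot j ∧ δ j = k + 1 :=
    ⟨Nat.find hex, Nat.find_spec hex, fun k hk => not_not.1 (Nat.find_min hex hk)⟩
  have hn0 : n ≠ 0 := by rintro rfl; exact hnot ⟨o, rfl, by omega⟩
  have hn1 : n ≠ 1 := by rintro rfl; exact hnot ⟨v₁, rfl, by omega⟩
  obtain ⟨m, rfl⟩ : ∃ m, n = m + 2 := ⟨n - 2, by omega⟩
  have : Nonempty J := ⟨o⟩
  choose! v hv hδv using hmin
  have hv0 : v 0 = o := simpleRoot_injective (hv 0 (by omega)).symm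
  have hv1 : v 1 = v₁ := simpleRoot_injective (hv 1 (by omega)).symm
  have hchain : ∀ k, k < m → adjOp b (simpleRoot (v (k + 1))) =
      simpleRoot (v k) + simpleRoot (v (k + 2)) := by
    intro k hk
    have := hTV k
    rw [hv _ (by omega), hv (k + 2) (by omega), hv k (by omega)] at this
    rw [this, add_comm]
  -- the branch vertex `v (m + 1)` has weight `m + 2`; its further neighbours are `R`
  obtain ⟨R, hR, hRn, hRw⟩ : ∃ R, adjOp b (simpleRoot (v (m + 1))) = simpleRoot (v m) + R ∧
      0 ≤ R ∧ weight δ R = m + 3 := by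
    have h1 : ∃ w : J → ℤ, adjOp b (simpleRoot (v m)) = simpleRoot (v (m + 1)) + w ∧ 0 ≤ w := by
      rcases Nat.eq_zero_or_pos m with rfl | hm
      · exact ⟨0, by rw [hv0, hv1, hT, add_zero], le_rfl⟩
      · have := hchain (m - 1) (by omega)
        rw [show m - 1 + 1 = m by omega, show m - 1 + 2 = m + 1 by omega, add_comm] at this
        exact ⟨_, this, simpleRoot_nonneg _⟩
    obtain ⟨w, h2, h3⟩ := h1
    obtain ⟨R, h4, h5, h6⟩ := hA.adjOp_eq_add h2 h3
    refine ⟨R, h4, h5, ?_⟩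
    rw [h6, hδv m (by omega), hδv (m + 1) (by omega)]
    push_cast
    ring
  have hVR : V (m + 2) = R := by
    have := hTV m
    rw [hv _ (show m + 1 < m + 2 by omega), hR, hv m (by omega), add_comm] at this
    exact (add_right_cancel this).symm
  have hδm := hδv (m + 1) (by omega)
  obtain ⟨i, R₁, hRi, hR₁⟩ := exists_eq_simpleRoot_add hRn (ne_zero_of_weight (δ := δ) (by omega))
  rw [hRi, weight_add, weight_simpleRoot] at hRw
  have hR₁0 : R₁ ≠ 0 := by
    rintro rfl
    refine hnot ⟨i, by rw [hVR, hRi, add_zero], ?_⟩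
    simp only [weight, Pi.zero_apply, mul_zero, Finset.sum_const_zero] at hRw
    omega
  obtain ⟨j, R₂, hRj, hR₂⟩ := exists_eq_simpleRoot_add hR₁ hR₁0
  rw [hRj, weight_add, weight_simpleRoot] at hRw
  rw [hRi, hRj] at hR
  obtain ⟨Ri, hTi, hRin, hRiw⟩ := hA.adjOp_eq_add (i := i) (j := v (m + 1))
    (w := simpleRoot (v m) + (simpleRoot j + R₂)) (by rw [hR]; abel)
    (add_nonneg (simpleRoot_nonneg _) (add_nonneg (simpleRoot_nonneg _) hR₂))
  obtain ⟨Rj, hTj, hRjn, hRjw⟩ := hA.adjOp_eq_add (i := j) (j := v (m + 1))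
    (w := simpleRoot (v m) + (simpleRoot i + R₂)) (by rw [hR]; abel)
    (add_nonneg (simpleRoot_nonneg _) (add_nonneg (simpleRoot_nonneg _) hR₂))
  have hRi0 := hA.weight_nonneg hRin
  have hRj0 := hA.weight_nonneg hRjn
  have hR₂0 := hA.weight_nonneg hR₂
  have hpi := hA.pos i
  have hpj := hA.pos j
  have hfork : ∀ o' R, m = 0 → adjOp b (simpleRoot (v (m + 1))) =
      simpleRoot (v m) + (simpleRoot o' + R) → 0 ≤ R → δ o' = 1 →
      ∃ h d, IsKostant (adjOp b) o h d ∧ (∀ j, δ j ≤ d) ∧ ∃ j, δ j = d := by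
    rintro o' R rfl h1 h2 h3
    rw [hv0, hv1] at h1
    obtain ⟨⟨h, hK⟩, h5, h6⟩ := hA.isKostant_of_fork hT h1 h2 h3
    exact ⟨h, 2, hK, h5, h6⟩
  by_cases hR₂z : R₂ = 0
  swap
  · obtain ⟨k, R₃, rfl, hR₃⟩ := exists_eq_simpleRoot_add hR₂ hR₂z
    obtain ⟨Rk, -, hRkn, hRkw⟩ := hA.adjOp_eq_add (i := k) (j := v (m + 1))
      (w := simpleRoot (v m) + (simpleRoot i + (simpleRoot j + R₃))) (by rw [hR]; abel)
      (add_nonneg (simpleRoot_nonneg _) (add_nonneg (simpleRoot_nonneg _)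
        (add_nonneg (simpleRoot_nonneg _) hR₃)))
    have hRk0 := hA.weight_nonneg hRkn
    have hR₃0 := hA.weight_nonneg hR₃
    rw [weight_add, weight_simpleRoot] at hRw
    exact hfork i (simpleRoot j + (simpleRoot k + R₃)) (by omega) hR (add_nonneg
      (simpleRoot_nonneg _) (add_nonneg (simpleRoot_nonneg _) hR₃)) (by omega)
  subst hR₂z
  rw [add_zero] at hR
  clear hRi hRj hRin hRjn hRiw hRjw hRi0 hRj0 hTi hTj
  simp only [weight, Pi.zero_apply, mul_zero, Finset.sum_const_zero, add_zero] at hRw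
  wlog hij : δ i ≤ δ j generalizing i j
  · exact this j i hpj hpi (by rw [hR]; abel) (by omega) (by omega)
  obtain ⟨Ri, hTi, hRin, hRiw⟩ := hA.adjOp_eq_add (i := i) (j := v (m + 1))
    (w := simpleRoot (v m) + simpleRoot j) (by rw [hR]; abel)
    (add_nonneg (simpleRoot_nonneg _) (simpleRoot_nonneg _))
  obtain ⟨Rj, hTj, hRjn, hRjw⟩ := hA.adjOp_eq_add (i := j) (j := v (m + 1))
    (w := simpleRoot (v m) + simpleRoot i) (by rw [hR]; abel)
    (add_nonneg (simpleRoot_nonneg _) (simpleRoot_nonneg _))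
  have hRi0 := hA.weight_nonneg hRin
  have hRj0 := hA.weight_nonneg hRjn
  rcases Nat.eq_zero_or_pos m with hm0 | hm0
  · exact hfork i (simpleRoot j) hm0 hR (simpleRoot_nonneg j) (by omega)
  have hc0 : adjOp b (simpleRoot (v 1)) = simpleRoot o + simpleRoot (v 2) := by
    have := hchain 0 hm0
    rwa [hv0] at this
  rw [← hv1] at hT
  rcases (show δ i = δ j ∨ δ j = δ i + 1 by omega) with heq | heq
  · -- two arms of equal weight: each continues with a vertex of weight one
    obtain ⟨k, rfl, hk⟩ := hA.eq_simpleRoot_of_weight_one hRin (by omega)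
    obtain ⟨l, rfl, hl⟩ := hA.eq_simpleRoot_of_weight_one hRjn (by omega)
    obtain ⟨Rk, hTk, hRkn, hRkw⟩ := hA.adjOp_eq_add (by rw [hTi, add_comm])
      (simpleRoot_nonneg (v (m + 1)))
    obtain ⟨Rl, hTl, hRln, hRlw⟩ := hA.adjOp_eq_add (by rw [hTj, add_comm])
      (simpleRoot_nonneg (v (m + 1)))
    have hRk0 := hA.weight_nonneg hRkn
    obtain rfl : m = 1 := by omega
    have e1 := hA.eq_zero_of_weight hRkn (by omega)
    have e2 := hA.eq_zero_of_weight hRln (by omega)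
    rw [e1, add_zero] at hTk
    rw [e2, add_zero] at hTl
    exact hA.isKostant_of_E6 hT hc0 hR hTi hTj hTk hTl (hδv 1 (by omega)) (hδv 2 (by omega))
      (by omega) (by omega) hk hl
  · have e1 := hA.eq_zero_of_weight hRin (by omega)
    rw [e1, add_zero] at hTi
    rcases hA.eq_of_weight_two hRjn (by omega) with ⟨k, rfl, hk⟩ | ⟨k, l, rfl, hk, hl⟩
    · obtain ⟨Rk, hTk, hRkn, hRkw⟩ := hA.adjOp_eq_add (by rw [hTj, add_comm])
        (simpleRoot_nonneg (v (m + 1)))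
      have hRk0 := hA.weight_nonneg hRkn
      rcases (show m = 2 ∨ m = 4 by omega) with rfl | rfl
      · obtain ⟨l, rfl, hl⟩ := hA.eq_simpleRoot_of_weight_one hRkn (by omega)
        obtain ⟨Rl, hTl, hRln, hRlw⟩ := hA.adjOp_eq_add (by rw [hTk, add_comm])
          (simpleRoot_nonneg j)
        have e2 := hA.eq_zero_of_weight hRln (by omega)
        rw [e2, add_zero] at hTl
        exact hA.isKostant_of_E7 hT hc0 (hchain 1 (by omega)) hR hTi hTj hTk hTl
          (hδv 1 (by omega)) (hδv 2 (by omega)) (hδv 3 (by omega)) (by omega) (by omega) hk hl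
      · have e2 := hA.eq_zero_of_weight hRkn (by omega)
        rw [e2, add_zero] at hTk
        exact hA.isKostant_of_E8 hT hc0 (hchain 1 (by omega)) (hchain 2 (by omega))
          (hchain 3 (by omega)) hR hTi hTj hTk (hδv 1 (by omega)) (hδv 2 (by omega))
          (hδv 3 (by omega)) (hδv 4 (by omega)) (hδv 5 (by omega)) (by omega) (by omega) hk
    · obtain ⟨Rk, -, hRkn, hRkw⟩ := hA.adjOp_eq_add (i := k) (j := j)
        (w := simpleRoot (v (m + 1)) + simpleRoot l) (by rw [hTj]; abel)
        (add_nonneg (simpleRoot_nonneg _) (simpleRoot_nonneg _))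
      have hRk0 := hA.weight_nonneg hRkn
      omega

end IsAffineDiagram

end Classification

/-! ### Characters of finite groups -/

section Characters

open Representation

variable {H : Type} [Group H] {U : Type} [AddCommGroup U] [Module ℂ U] {W : Type} [AddCommGroup W]
  [Module ℂ W]

theorem eq_bot_or_eq_top_of_isIrreducible {σ : Representation ℂ H U} (hσ : σ.IsIrreducible)
    (p : Submodule ℂ U) (hp : ∀ g, ∀ v ∈ p, σ g v ∈ p) : p = ⊥ ∨ p = ⊤ := by
  rcases hσ.eq_bot_or_eq_top (⟨p, hp⟩ : Subrepresentation σ) with h | h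
  · exact Or.inl (congrArg Subrepresentation.toSubmodule h)
  · exact Or.inr (congrArg Subrepresentation.toSubmodule h)

theorem nontrivial_of_isIrreducible {σ : Representation ℂ H U} (hσ : σ.IsIrreducible) :
    Nontrivial U := by
  by_contra h
  rw [not_nontrivial_iff_subsingleton] at h
  exact hσ.bot_ne_top (Subrepresentation.toSubmodule_injective (Subsingleton.elim _ _))

theorem isIrreducible_of_forall [Nontrivial U] {σ : Representation ℂ H U}
    (h : ∀ p : Submodule ℂ U, (∀ g, ∀ v ∈ p, σ g v ∈ p) → p = ⊥ ∨ p = ⊤) : σ.IsIrreducible where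
  exists_pair_ne := ⟨⊥, ⊤, fun h => bot_ne_top (congrArg Subrepresentation.toSubmodule h)⟩
  eq_bot_or_eq_top A := (h A.toSubmodule A.apply_mem_toSubmodule).imp
    (fun h => Subrepresentation.toSubmodule_injective h)
    fun h => Subrepresentation.toSubmodule_injective h

theorem finiteDimensional_of_isIrreducible [Finite H] {σ : Representation ℂ H U}
    (hσ : σ.IsIrreducible) : FiniteDimensional ℂ U := by
  have := nontrivial_of_isIrreducible hσ
  obtain ⟨v, hv⟩ := exists_ne (0 : U)
  rcases eq_bot_or_eq_top_of_isIrreducible hσ (Submodule.span ℂ (Set.range fun g => σ g v))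
    (fun g u hu => by
      induction hu using Submodule.span_induction with
      | mem x hx =>
        obtain ⟨k, rfl⟩ := hx
        exact Submodule.subset_span ⟨g * k, by simp⟩
      | zero => simp
      | add x y _ _ hx hy => simpa using Submodule.add_mem _ hx hy
      | smul c x _ hx => simpa using Submodule.smul_mem _ c hx) with h | h
  · exact absurd ((Submodule.mem_bot ℂ).mp (h ▸ Submodule.subset_span ⟨1, by simp⟩)) hv
  · exact .of_fg_top (h ▸ Submodule.fg_span (Set.finite_range _))

/-- Every nonzero finite-dimensional module has an irreducible submodule: one of least positive
dimension. -/
theorem exists_isIrreducible_subrepresentation [FiniteDimensional ℂ U] [Nontrivial U]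
    (σ : Representation ℂ H U) :
    ∃ S : Subrepresentation σ, S.toRepresentation.IsIrreducible := by
  obtain ⟨S, hS, hmin⟩ := (measure fun S : Subrepresentation σ =>
    Module.finrank ℂ S.toSubmodule).wf.has_min {S | S.toSubmodule ≠ ⊥} ⟨⊤, top_ne_bot⟩
  have := Submodule.nontrivial_iff_ne_bot.mpr hS
  refine ⟨S, isIrreducible_of_forall fun A hA => ?_⟩
  rw [or_iff_not_imp_left]
  intro hA0
  let B : Subrepresentation σ := ⟨A.map S.toSubmodule.subtype, by
    rintro g _ ⟨v, hv, rfl⟩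
    exact ⟨_, hA g v hv, rfl⟩⟩
  have hB : B.toSubmodule ≠ ⊥ := by
    intro h
    exact hA0 (Submodule.map_injective_of_injective S.toSubmodule.injective_subtype
      (h.trans (Submodule.map_bot _).symm))
  have h1 : Module.finrank ℂ B.toSubmodule = Module.finrank ℂ A :=
    (Submodule.equivMapOfInjective _ S.toSubmodule.injective_subtype _).symm.finrank_eq
  have h2 : ¬ Module.finrank ℂ B.toSubmodule < Module.finrank ℂ S.toSubmodule := hmin B hB
  exact Submodule.eq_top_of_finrank_eq (le_antisymm (Submodule.finrank_le _) (by omega))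

theorem exists_equiv_prod [Finite H] {σ : Representation ℂ H U} (S : Subrepresentation σ) :
    ∃ C : Subrepresentation σ,
      Nonempty ((S.toRepresentation.prod C.toRepresentation).Equiv σ) := by
  obtain ⟨C, hC⟩ := exists_isCompl S
  have hC' : IsCompl S.toSubmodule C.toSubmodule :=
    ⟨disjoint_iff.mpr (congrArg Subrepresentation.toSubmodule hC.inf_eq_bot),
      codisjoint_iff.mpr (congrArg Subrepresentation.toSubmodule hC.sup_eq_top)⟩
  refine ⟨C, ⟨Representation.Equiv.mk (Submodule.prodEquivOfIsCompl _ _ hC') fun g => ?_⟩⟩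
  ext x <;> simp [Subrepresentation.toRepresentation]

theorem character_prod [FiniteDimensional ℂ U] [FiniteDimensional ℂ W]
    (σ : Representation ℂ H U) (τ : Representation ℂ H W) :
    (σ.prod τ).character = σ.character + τ.character := by
  ext g
  exact LinearMap.trace_prodMap' (σ g) (τ g)

/-- The bilinear form `⟨f, g⟩ = |H|⁻¹ ∑ₓ f(x) g(x⁻¹)` on functions on `H`. -/
def charForm (H : Type) [Group H] [Fintype H] : (H → ℂ) →ₗ[ℂ] (H → ℂ) →ₗ[ℂ] ℂ :=
  LinearMap.mk₂ ℂ (fun f g => (Nat.card H : ℂ)⁻¹ * ∑ x, f x * g x⁻¹)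
    (fun _ _ _ => by simp [add_mul, mul_add, Finset.sum_add_distrib])
    (fun _ _ _ => by simp [Finset.mul_sum, mul_assoc, mul_left_comm])
    (fun _ _ _ => by simp [mul_add, Finset.sum_add_distrib])
    (fun _ _ _ => by simp [Finset.mul_sum, mul_left_comm])

theorem charForm_apply [Fintype H] (f g : H → ℂ) :
    charForm H f g = (Nat.card H : ℂ)⁻¹ * ∑ x, f x * g x⁻¹ := rfl

theorem charForm_comm [Fintype H] (f g : H → ℂ) : charForm H f g = charForm H g f := by
  rw [charForm_apply, charForm_apply, ← Equiv.sum_comp (Equiv.inv H)]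
  simp [mul_comm]

theorem charForm_character [Fintype H] [FiniteDimensional ℂ U] [FiniteDimensional ℂ W]
    (σ : Representation ℂ H U) (τ : Representation ℂ H W) :
    charForm H τ.character σ.character = Module.finrank ℂ (σ.IntertwiningMap τ) := by
  have : Invertible (Nat.card H : ℂ) :=
    invertibleOfNonzero (Nat.cast_ne_zero.mpr Nat.card_pos.ne')
  exact card_inv_mul_sum_char_mul_char_eq_finrank σ τ

theorem charForm_character_ne_zero_iff [Fintype H] [FiniteDimensional ℂ U]
    [FiniteDimensional ℂ W] (σ : Representation ℂ H U) (τ : Representation ℂ H W) :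
    charForm H τ.character σ.character ≠ 0 ↔ ∃ f : σ.IntertwiningMap τ, f ≠ 0 := by
  rw [charForm_character, Nat.cast_ne_zero, ← Nat.pos_iff_ne_zero, Module.finrank_pos_iff]
  exact ⟨fun h => exists_ne 0, fun ⟨f, hf⟩ => ⟨f, 0, hf⟩⟩

/-- A finite-dimensional module is determined by its character. -/
theorem nonempty_equiv_of_character_eq [Finite H] [FiniteDimensional ℂ U]
    [FiniteDimensional ℂ W] {σ : Representation ℂ H U} {τ : Representation ℂ H W}
    (h : σ.character = τ.character) : Nonempty (σ.Equiv τ) := by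
  have := Fintype.ofFinite H
  induction hn : Module.finrank ℂ U using Nat.strong_induction_on generalizing U W with
  | _ n ih =>
  have hd : Module.finrank ℂ U = Module.finrank ℂ W := by
    have := congrFun h 1
    rwa [char_one, char_one, Nat.cast_inj] at this
  rcases subsingleton_or_nontrivial U with hU | hU
  · have hW : Subsingleton W := by
      rw [← Module.finrank_zero_iff (R := ℂ), ← hd, Module.finrank_zero_iff]
      exact hU
    exact ⟨Representation.Equiv.mk (LinearEquiv.ofSubsingleton U W) fun g => by
      ext; exact Subsingleton.elim _ _⟩
  -- split off an irreducible submodule of `σ`, and its isomorphic image in `τ`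
  obtain ⟨S, hS⟩ := exists_isIrreducible_subrepresentation σ
  obtain ⟨C, ⟨e⟩⟩ := exists_equiv_prod S
  have hSn := nontrivial_of_isIrreducible hS
  have hne : charForm H τ.character S.toRepresentation.character ≠ 0 := by
    rw [← h, charForm_character_ne_zero_iff]
    refine ⟨⟨S.toSubmodule.subtype, fun g => rfl⟩, fun h0 => ?_⟩
    obtain ⟨x, hx⟩ := exists_ne (0 : S.toSubmodule)
    exact hx (Subtype.ext (congrArg (fun f : S.toRepresentation.IntertwiningMap σ => f x) h0))
  obtain ⟨f, hf⟩ := (charForm_character_ne_zero_iff _ _).mp hne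
  have hfi := (IsIrreducible.injective_or_eq_zero f).resolve_right hf
  let S' : Subrepresentation τ := f.range
  obtain ⟨C', ⟨e'⟩⟩ := exists_equiv_prod S'
  let e₁ : S.toRepresentation.Equiv S'.toRepresentation :=
    Representation.Equiv.mk (LinearEquiv.ofInjective f.toLinearMap hfi) fun g => by
      ext x
      exact IntertwiningMap.isIntertwining _ _ f g x
  have h1 : C.toRepresentation.character = C'.toRepresentation.character := by
    have h2 := char_iso e
    have h3 := char_iso e'
    rw [character_prod] at h2 h3
    rw [← h, ← h2, char_iso e₁] at h3
    exact (add_left_cancel h3).symm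
  have hdim : Module.finrank ℂ C.toSubmodule < n := by
    have h2 := LinearEquiv.finrank_eq e.toLinearEquiv
    rw [Module.finrank_prod] at h2
    have : 0 < Module.finrank ℂ S.toSubmodule := Module.finrank_pos
    omega
  obtain ⟨e₂⟩ := ih _ hdim h1 rfl
  exact ⟨e.symm.trans ((Representation.Equiv.mk
    (e₁.toLinearEquiv.prodCongr e₂.toLinearEquiv) fun g => by
      refine LinearMap.ext fun x => Prod.ext ?_ ?_
      · exact IntertwiningMap.isIntertwining _ _ e₁.toIntertwiningMap g x.1
      · exact IntertwiningMap.isIntertwining _ _ e₂.toIntertwiningMap g x.2).trans e')⟩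

/-- The set of characters of irreducible `H`-modules. -/
def irrChars (H : Type) [Group H] : Set (H → ℂ) :=
  {f | ∃ (U : Type) (_ : AddCommGroup U) (_ : Module ℂ U) (σ : Representation ℂ H U),
    σ.IsIrreducible ∧ σ.character = f}

theorem charForm_irrChars_self [Fintype H] {f : H → ℂ} (hf : f ∈ irrChars H) :
    charForm H f f = 1 := by
  obtain ⟨U, _, _, σ, hσ, rfl⟩ := hf
  have := finiteDimensional_of_isIrreducible hσ
  rw [charForm_character, IsIrreducible.finrank_intertwiningMap_self, Nat.cast_one]

theorem charForm_irrChars_of_ne [Fintype H] {f g : H → ℂ} (hf : f ∈ irrChars H)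
    (hg : g ∈ irrChars H) (hfg : f ≠ g) : charForm H f g = 0 := by
  obtain ⟨U, _, _, σ, hσ, rfl⟩ := hf
  obtain ⟨W, _, _, τ, hτ, rfl⟩ := hg
  have := finiteDimensional_of_isIrreducible hσ
  have := finiteDimensional_of_isIrreducible hτ
  by_contra h
  obtain ⟨φ, hφ⟩ := (charForm_character_ne_zero_iff _ _).mp h
  exact hfg (char_iso (φ.ofBijective
    ((IsIrreducible.bijective_or_eq_zero φ).resolve_right hφ))).symm

/-- A family that is orthogonal with respect to `charForm` and has no isotropic members is linearly
independent. -/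
theorem linearIndependent_of_charForm [Fintype H] {I : Type} {χ : I → H → ℂ}
    (h0 : ∀ i j, i ≠ j → charForm H (χ i) (χ j) = 0) (h1 : ∀ i, charForm H (χ i) (χ i) ≠ 0) :
    LinearIndependent ℂ χ :=
  LinearMap.BilinForm.linearIndependent_of_iIsOrtho (B := charForm H)
    (LinearMap.isOrthoᵢ_def.mpr h0) h1

theorem linearIndependent_irrChars [Fintype H] :
    LinearIndependent ℂ ((↑) : irrChars H → H → ℂ) :=
  linearIndependent_of_charForm
    (fun i j hij => charForm_irrChars_of_ne i.2 j.2 fun h => hij (Subtype.ext h))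
    fun i => by rw [charForm_irrChars_self i.2]; exact one_ne_zero

instance [Finite H] : Finite (irrChars H) :=
  have := Fintype.ofFinite H
  linearIndependent_irrChars.finite

instance [Finite H] : Fintype (irrChars H) := Fintype.ofFinite _

theorem exists_character_eq_sum [Finite H] [FiniteDimensional ℂ U] (σ : Representation ℂ H U) :
    ∃ n : irrChars H → ℕ, σ.character = ∑ χ, n χ • (χ : H → ℂ) := by
  classical
  induction hn : Module.finrank ℂ U using Nat.strong_induction_on generalizing U with
  | _ n ih =>
  rcases subsingleton_or_nontrivial U with hU | hU
  · refine ⟨0, ?_⟩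
    ext g
    simp [character, Subsingleton.elim (σ g) 0]
  obtain ⟨S, hS⟩ := exists_isIrreducible_subrepresentation σ
  obtain ⟨C, ⟨e⟩⟩ := exists_equiv_prod S
  have hSn := nontrivial_of_isIrreducible hS
  have hdim : Module.finrank ℂ C.toSubmodule < n := by
    have h2 := LinearEquiv.finrank_eq e.toLinearEquiv
    rw [Module.finrank_prod] at h2
    have : 0 < Module.finrank ℂ S.toSubmodule := Module.finrank_pos
    omega
  obtain ⟨m, hm⟩ := ih _ hdim C.toRepresentation rfl
  refine ⟨m + Pi.single ⟨_, _, _, _, _, hS, rfl⟩ 1, ?_⟩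
  rw [← char_iso e, character_prod, hm, add_comm]
  simp [add_smul, Finset.sum_add_distrib, Pi.single_apply]

end Characters

/-! ### Multiplicities and characters -/

section Multiplicities

open Representation

variable {H : Type} [Group H] {I : Type} [Fintype I]

theorem trace_lmap {U : I → Type} [∀ i, AddCommGroup (U i)] [∀ i, Module ℂ (U i)]
    [∀ i, FiniteDimensional ℂ (U i)] (f : ∀ i, U i →ₗ[ℂ] U i) :
    LinearMap.trace ℂ _ (DirectSum.lmap f) = ∑ i, LinearMap.trace ℂ _ (f i) := by
  classical
  have h : DirectSum.lmap f =
      ∑ i, (DirectSum.lof ℂ I U i ∘ₗ f i) ∘ₗ DirectSum.component ℂ I U i := by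
    refine DirectSum.linearMap_ext ℂ fun j => LinearMap.ext fun x => ?_
    rw [LinearMap.comp_apply, DirectSum.lmap_lof, LinearMap.comp_apply, LinearMap.sum_apply,
      Finset.sum_eq_single j]
    · simp
    · intro i _ hi
      simp [DirectSum.component.of, hi.symm]
    · simp
  rw [h, map_sum]
  refine Finset.sum_congr rfl fun i _ => ?_
  rw [LinearMap.trace_comp_comm', ← LinearMap.comp_assoc]
  congr 1
  ext x
  simp

theorem character_directSum {U : I → Type} [∀ i, AddCommGroup (U i)] [∀ i, Module ℂ (U i)]
    [∀ i, FiniteDimensional ℂ (U i)] (M : ∀ i, Representation ℂ H (U i)) :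
    (directSum M).character = ∑ i, (M i).character := by
  ext g
  rw [Finset.sum_apply]
  exact trace_lmap fun i => M i g

theorem hasMultiplicities_iff [Finite H] {U : I → Type} [∀ i, AddCommGroup (U i)]
    [∀ i, Module ℂ (U i)] [∀ i, FiniteDimensional ℂ (U i)] (M : ∀ i, Representation ℂ H (U i))
    {X : Type} [AddCommGroup X] [Module ℂ X] [FiniteDimensional ℂ X] (σ : Representation ℂ H X)
    (n : I → ℕ) :
    HasMultiplicities M σ n ↔ σ.character = ∑ i, n i • (M i).character := by
  have h : (directSum fun p : (Σ i, Fin (n i)) => M p.1).character =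
      ∑ i, n i • (M i).character := by
    rw [character_directSum, Fintype.sum_sigma]
    refine Finset.sum_congr rfl fun i _ => ?_
    change ∑ _ : Fin (n i), (M i).character = _
    rw [Finset.sum_const, Finset.card_univ, Fintype.card_fin]
  have : FiniteDimensional ℂ (DirectSum (Σ i, Fin (n i)) fun p => U p.1) := by
    classical
    exact Module.Finite.equiv (DirectSum.linearEquivFunOnFintype ℂ _ fun p : (Σ i, Fin (n i)) =>
      U p.1).symm
  rw [← h]
  exact ⟨fun ⟨e⟩ => char_iso e, nonempty_equiv_of_character_eq⟩

variable {G : Type} {m : I → G → ℂ}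

theorem linearCombination_natCast (n : I → ℕ) :
    Fintype.linearCombination ℤ m (fun i => (n i : ℤ)) = ∑ i, n i • m i := by
  simp [Fintype.linearCombination_apply]

theorem linearCombination_injective (hm : LinearIndependent ℂ m) :
    Function.Injective (Fintype.linearCombination ℤ m) :=
  linearIndependent_iff_injective_fintypeLinearCombination.mp
    (hm.restrict_scalars (by simpa [← zsmul_eq_mul] using Int.cast_injective))

theorem natCast_inj_of_linearIndependent (hm : LinearIndependent ℂ m) {n n' : I → ℕ} :
    ∑ i, n i • m i = ∑ i, n' i • m i ↔ n = n' := by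
  refine ⟨fun h => ?_, fun h => h ▸ rfl⟩
  rw [← linearCombination_natCast, ← linearCombination_natCast] at h
  have := linearCombination_injective hm h
  funext i
  exact_mod_cast congrFun this i

/-- Multiplication by a function `v` that is odd under `z` exchanges the functions that are even and
odd under `z`, so that the digraph of `b` is bipartite. -/
theorem exists_parity {m : I → H → ℂ} {v : H → ℂ} {b : Matrix I I ℕ} (hm : LinearIndependent ℂ m)
    {z : H} (hv : ∀ g, v (z * g) = -v g)
    (hz : ∀ i, (∀ g, m i (z * g) = m i g) ∨ ∀ g, m i (z * g) = -m i g)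
    (hb : ∀ j, v * m j = ∑ i, b j i • m i) :
    ∃ ε : I → ZMod 2, ∀ i j, b i j ≠ 0 → ε j = ε i + 1 := by
  have hs : ∀ i, ∃ e : ZMod 2, ∀ g, m i (z * g) = (-1 : ℂ) ^ e.val * m i g := fun i => by
    rcases hz i with h | h
    · exact ⟨0, fun g => by simp [h g]⟩
    · exact ⟨1, fun g => by simp [h g, ZMod.val_one]⟩
  choose ε hε using hs
  refine ⟨ε, fun j i hij => ?_⟩
  have h0 : ∑ i, ((b j i : ℂ) * ((-1) ^ (ε i).val + (-1) ^ (ε j).val)) • m i = 0 := by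
    funext g
    have h1 := congrFun (hb j) (z * g)
    have h2 := congrFun (hb j) g
    simp only [Pi.mul_apply, hv, hε, Finset.sum_apply, Pi.smul_apply, nsmul_eq_mul,
      Pi.natCast_apply, smul_eq_mul, Pi.zero_apply] at h1 h2 ⊢
    rw [show -v g * ((-1) ^ (ε j).val * m j g) = -(-1) ^ (ε j).val * (v g * m j g) by ring,
      h2] at h1
    simp only [mul_add, add_mul, Finset.sum_add_distrib]
    rw [Finset.sum_congr rfl fun i _ => mul_assoc (b j i : ℂ) _ (m i g), ← h1, Finset.mul_sum,
      ← Finset.sum_add_distrib]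
    exact Finset.sum_eq_zero fun i _ => by ring
  have h1 := (mul_eq_zero.mp (Fintype.linearIndependent_iff.mp hm _ h0 i)).resolve_left
    (Nat.cast_ne_zero.mpr hij)
  generalize ε i = x at h1 ⊢
  generalize ε j = y at h1 ⊢
  fin_cases x <;> fin_cases y <;> first | rfl | (exfalso; norm_num [ZMod.val] at h1)

variable [DecidableEq I] {b : Matrix I I ℕ} {v : G → ℂ}

theorem linearCombination_simpleRoot (i : I) :
    Fintype.linearCombination ℤ m (simpleRoot i) = m i := by
  rw [simpleRoot, Fintype.linearCombination_apply_single, one_smul]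

/-- If `b` is the matrix of multiplication by `v` on the functions `m i`, then `adjOp b` is
multiplication by `v` in the coordinates given by the `m i`. -/
theorem linearCombination_adjOp (hb : ∀ j, v * m j = ∑ i, b j i • m i) (w : I → ℤ) :
    Fintype.linearCombination ℤ m (adjOp b w) = v * Fintype.linearCombination ℤ m w := by
  have : Fintype.linearCombination ℤ m ∘ₗ adjOp b =
      LinearMap.mulLeft ℤ v ∘ₗ Fintype.linearCombination ℤ m := by
    refine LinearMap.pi_ext' fun j => LinearMap.ext_ring ?_
    change Fintype.linearCombination ℤ m (adjOp b (simpleRoot j)) =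
      v * Fintype.linearCombination ℤ m (simpleRoot j)
    rw [linearCombination_simpleRoot, hb, ← linearCombination_natCast]
    congr 1
    funext i
    exact adjOp_simpleRoot b i j
  exact LinearMap.congr_fun this w

theorem exists_isBipartition {ε : I → ZMod 2} (hε : ∀ i j, b i j ≠ 0 → ε j = ε i + 1) (o : I) :
    ∃ P₁ P₂, IsBipartition (cartan b) o P₁ P₂ := by
  have key : ∀ i j, i ≠ j → ε i = ε j → cartan b i j = 0 := by
    intro i j hij h
    have : b j i = 0 := by
      by_contra h0
      have := hε j i h0
      rw [h] at this
      exact absurd (left_eq_add.mp this) one_ne_zero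
    simp [cartan_apply, hij, this]
  have key2 : ∀ x y c : ZMod 2, x ≠ c → y ≠ c → x = y := by decide
  refine ⟨Finset.univ.filter fun i => ε i ≠ ε o,
    (Finset.univ.filter fun i => ε i = ε o).erase o, ?_, ?_, ?_, ?_⟩
  · rw [Finset.disjoint_left]
    intro i h1 h2
    simp_all
  · ext i
    by_cases hi : i = o
    · simp [hi]
    · by_cases h : ε i = ε o <;> simp [hi, h]
  · intro i hi j hj hij
    exact key i j hij (key2 _ _ _ (Finset.mem_filter.mp hi).2 (Finset.mem_filter.mp hj).2)
  · rw [Finset.insert_erase (by simp)]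
    intro i hi j hj hij
    exact key i j hij
      ((Finset.mem_filter.mp hi).2.trans (Finset.mem_filter.mp hj).2.symm)

/-- Kostant's formula for modules `M i` with linearly independent characters, in terms of
characters: if the span of the characters of the `M i` is stable under multiplication by the
character of `V`, if the characters of the `S k` obey the recursion of the symmetric powers, and if
the matrix `b` of `V` in the `M i` satisfies the combinatorial conditions, then the multiplicities
are given by Kostant's formula. -/
theorem kostantFormula_of_characters [Finite H] {U : I → Type} [∀ i, AddCommGroup (U i)]
    [∀ i, Module ℂ (U i)] [∀ i, FiniteDimensional ℂ (U i)]
    {V : Representation ℂ H (Fin 2 → ℂ)} {M : ∀ i, Representation ℂ H (U i)} {Y : ℕ → Type}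
    [∀ k, AddCommGroup (Y k)] [∀ k, Module ℂ (Y k)] [∀ k, FiniteDimensional ℂ (Y k)]
    {S : ∀ k, Representation ℂ H (Y k)} {o : I}
    (hM : LinearIndependent ℂ fun i => (M i).character)
    (hb : ∀ j, V.character * (M j).character = ∑ i, b j i • (M i).character)
    (h0 : (S 0).character = (M o).character)
    (h1 : (S 1).character = V.character * (M o).character)
    (h2 : ∀ k, (S (k + 2)).character = V.character * (S (k + 1)).character - (S k).character)
    (hx : ∀ k, ∃ x : I → ℕ, (S k).character = ∑ i, x i • (M i).character)
    {ε : I → ZMod 2} (hε : ∀ i j, b i j ≠ 0 → ε j = ε i + 1) {h d : ℕ}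
    (hK : IsKostant (adjOp b) o h d) : KostantFormula V M S o d := by
  choose x hx using hx
  have hinj := linearCombination_injective hM
  have hxL : ∀ k, Fintype.linearCombination ℤ (fun i => (M i).character)
      (fun i => (x k i : ℤ)) = (S k).character := fun k => by
    rw [linearCombination_natCast, hx]
  have x0 : (fun i => (x 0 i : ℤ)) = simpleRoot o := hinj (by
    rw [hxL, linearCombination_simpleRoot, h0])
  have x1 : (fun i => (x 1 i : ℤ)) = adjOp b (simpleRoot o) := hinj (by
    rw [hxL, linearCombination_adjOp hb, linearCombination_simpleRoot, h1])
  have x2 : ∀ k, (fun i => (x (k + 2) i : ℤ)) =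
      adjOp b (fun i => (x (k + 1) i : ℤ)) - fun i => (x k i : ℤ) := fun k => hinj (by
    rw [map_sub, linearCombination_adjOp hb, hxL, hxL, hxL, h2])
  have hloop : ∀ i, b i i = 0 := fun i => by
    by_contra hi
    exact one_ne_zero (left_eq_add.mp (hε i i hi))
  refine ⟨b, x, fun j n => ?_, fun k n => ?_, exists_isBipartition hε o, ?_⟩
  · rw [hasMultiplicities_iff, char_tensor, hb, natCast_inj_of_linearIndependent hM, eq_comm]
  · rw [hasMultiplicities_iff, hx, natCast_inj_of_linearIndependent hM, eq_comm]
  · rintro P₁ P₂ hP _ _ _ rfl rfl rfl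
    have hh := coxeterNumber_eq hP hloop hK
    have hX := poincareSeries_eq hP hloop hK x0 x1 x2
    rw [← hh] at hX
    refine ⟨hX, ?_⟩
    rw [hX, zPoly_special hP hloop hK, hh]

end Multiplicities

/-! ### Finite subgroups of SL(2, ℂ) -/

section SpecialLinear

/-- A unipotent element of finite order of `SL(2, ℂ)` is trivial. -/
theorem eq_one_of_trace_eq_two {A : SL(2, ℂ)} (hA : IsOfFinOrder A) (ht : A.1.trace = 2) :
    A = 1 := by
  obtain ⟨n, hn, hAn⟩ := isOfFinOrder_iff_pow_eq_one.mp hA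
  have hd := A.2
  rw [Matrix.det_fin_two] at hd
  rw [Matrix.trace_fin_two] at ht
  set B : Matrix (Fin 2) (Fin 2) ℂ := A.1 - 1 with hB
  have hBB : B * B = 0 := by
    have h1 : A.1 1 1 = 2 - A.1 0 0 := by linear_combination ht
    rw [h1] at hd
    ext i j
    fin_cases i <;> fin_cases j <;> simp [hB, Matrix.mul_apply, Fin.sum_univ_two, h1] <;> first
      | linear_combination -hd
      | ring
  have hpow : ∀ k : ℕ, A.1 ^ k = 1 + (k : ℂ) • B := by
    intro k
    induction k with
    | zero => simp
    | succ k ih =>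
      rw [pow_succ, ih, show A.1 = 1 + B by rw [hB]; abel]
      simp only [mul_add, add_mul, one_mul, mul_one, smul_mul_assoc, hBB, smul_zero]
      push_cast
      rw [add_smul, one_smul]
      abel
  have h1 := hpow n
  rw [← Matrix.SpecialLinearGroup.coe_pow, hAn, Matrix.SpecialLinearGroup.coe_one,
    left_eq_add, smul_eq_zero, Nat.cast_eq_zero] at h1
  exact Subtype.ext (sub_eq_zero.mp (h1.resolve_left hn.ne'))

/-- The only involution of `SL(2, ℂ)` is `-1`. -/
theorem eq_neg_one_of_sq_eq_one {A : SL(2, ℂ)} (hA : A ^ 2 = 1) (h1 : A ≠ 1) : A = -1 := by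
  have hd := A.2
  rw [Matrix.det_fin_two] at hd
  have hinv : A = A⁻¹ := by
    rw [eq_inv_iff_mul_eq_one, ← sq, hA]
  have e : A.1 = A.1.adjugate := by
    conv_lhs => rw [hinv]
    exact Matrix.SpecialLinearGroup.coe_inv A
  rw [Matrix.adjugate_fin_two] at e
  have e00 : A.1 0 0 = A.1 1 1 := by simpa using congrFun (congrFun e 0) 0
  have e01 : A.1 0 1 = 0 := self_eq_neg.mp (by simpa using congrFun (congrFun e 0) 1)
  have e10 : A.1 1 0 = 0 := self_eq_neg.mp (by simpa using congrFun (congrFun e 1) 0)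
  rw [e01, zero_mul, sub_zero, ← e00, mul_self_eq_one_iff] at hd
  rcases hd with hd | hd
  · exfalso
    apply h1
    ext i j
    fin_cases i <;> fin_cases j <;> simp [e01, e10, ← e00, hd]
  · ext i j
    fin_cases i <;> fin_cases j <;> simp [e01, e10, ← e00, hd]

theorem trace_inv_eq_trace (A : SL(2, ℂ)) : (A⁻¹).1.trace = A.1.trace := by
  rw [Matrix.SpecialLinearGroup.coe_inv, Matrix.adjugate_fin_two, Matrix.trace_fin_two,
    Matrix.trace_fin_two]
  simp [add_comm]

variable {H : Type} [Group H]

theorem exists_map_eq_neg_one {ι : H →* SL(2, ℂ)} (hι : Function.Injective ι)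
    (hH : Even (Nat.card H)) [Finite H] : ∃ z, ι z = -1 := by
  obtain ⟨z, hz⟩ := exists_prime_orderOf_dvd_card' 2 hH.two_dvd
  refine ⟨z, eq_neg_one_of_sq_eq_one ?_ fun h => ?_⟩
  · rw [← map_pow, orderOf_dvd_iff_pow_eq_one.mp hz.dvd, map_one]
  · rw [← map_one ι] at h
    rw [hι h, orderOf_one] at hz
    omega

theorem character_stdRep (ι : H →* SL(2, ℂ)) (g : H) :
    Representation.character (stdRep.comp ι) g = (ι g).1.trace :=
  Matrix.trace_toLin'_eq _

theorem map_eq_neg_one_central {ι : H →* SL(2, ℂ)} (hι : Function.Injective ι) {z : H}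
    (hz : ι z = -1) (g : H) : z * g = g * z :=
  hι (by rw [map_mul, map_mul, hz, neg_one_mul, mul_neg_one])

theorem map_eq_neg_one_mul_self {ι : H →* SL(2, ℂ)} (hι : Function.Injective ι) {z : H}
    (hz : ι z = -1) : z * z = 1 :=
  hι (by rw [map_mul, hz, map_one, neg_mul_neg, one_mul])

theorem character_stdRep_mul {ι : H →* SL(2, ℂ)} {z : H} (hz : ι z = -1) (g : H) :
    Representation.character (stdRep.comp ι) (z * g) =
      -Representation.character (stdRep.comp ι) g := by
  rw [character_stdRep, character_stdRep, map_mul, hz, neg_one_mul,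
    Matrix.SpecialLinearGroup.coe_neg, Matrix.trace_neg]

/-- A central involution acts on an irreducible module by `1` or by `-1`. -/
theorem irrChars_even_or_odd {z : H} (hc : ∀ g, z * g = g * z) (hz : z * z = 1) {χ : H → ℂ}
    (hχ : χ ∈ irrChars H) : (∀ g, χ (z * g) = χ g) ∨ ∀ g, χ (z * g) = -χ g := by
  obtain ⟨U, _, _, σ, hσ, rfl⟩ := hχ
  have hcomm : ∀ g v, σ z (σ g v) = σ g (σ z v) := fun g v => by
    rw [← Module.End.mul_apply, ← map_mul, hc, map_mul, Module.End.mul_apply]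
  have hsq : ∀ v, σ z (σ z v) = v := fun v => by
    rw [← Module.End.mul_apply, ← map_mul, hz, map_one, Module.End.one_apply]
  rcases eq_bot_or_eq_top_of_isIrreducible hσ (LinearMap.ker (σ z - 1)) (fun g v hv => by
    rw [LinearMap.mem_ker, LinearMap.sub_apply, Module.End.one_apply, sub_eq_zero] at hv ⊢
    rw [hcomm, hv]) with h | h
  · right
    have h1 : σ z = -1 := by
      ext v
      have h2 : σ z v + v ∈ LinearMap.ker (σ z - 1) := by
        rw [LinearMap.mem_ker, LinearMap.sub_apply, Module.End.one_apply, map_add, hsq]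
        abel
      rw [h, Submodule.mem_bot] at h2
      simpa using eq_neg_of_add_eq_zero_left h2
    intro g
    rw [Representation.character, Representation.character, map_mul, h1, neg_one_mul, map_neg]
  · left
    have h1 : σ z = 1 := sub_eq_zero.mp (LinearMap.ker_eq_top.mp h)
    intro g
    rw [Representation.character, Representation.character, map_mul, h1, one_mul]

theorem character_trivial : (Representation.trivial ℂ H ℂ).character = 1 := by
  ext g
  rw [Representation.character, Representation.isTrivial_def, LinearMap.trace_id]
  simp

theorem one_mem_irrChars : (1 : H → ℂ) ∈ irrChars H := by
  refine ⟨ℂ, inferInstance, inferInstance, Representation.trivial ℂ H ℂ, ?_, ?_⟩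
  · exact isIrreducible_of_forall fun p _ => eq_bot_or_eq_top p
  · exact character_trivial

end SpecialLinear

section McKay

variable {H : Type} [Group H] [Finite H] {ι : H →* SL(2, ℂ)} {I : Type} [Fintype I]
  {χ : I → H → ℂ} {b : Matrix I I ℕ} {o : I}

/-- The McKay graph of a finite subgroup of even order of `SL(2, ℂ)` is connected: some polynomial
in the character of the faithful module `V` is supported at `1`, so that every irreducible module
is contained in a tensor power of `V`. -/
theorem mckay_connected (hι : Function.Injective ι) (hinj : Function.Injective χ)
    (hχ : Set.range χ = irrChars H) (ho : χ o = 1)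
    (hb : ∀ j, Representation.character (stdRep.comp ι) * χ j = ∑ i, b j i • χ i) (S : Set I)
    (hoS : o ∈ S) (hS : ∀ j ∈ S, ∀ i, b j i ≠ 0 → i ∈ S) (i : I) : i ∈ S := by
  classical
  have := Fintype.ofFinite H
  set v := Representation.character (stdRep.comp ι) with hv
  by_contra hi
  have hstable : ∀ f ∈ Submodule.span ℂ (χ '' S), v * f ∈ Submodule.span ℂ (χ '' S) := by
    intro f hf
    induction hf using Submodule.span_induction with
    | mem x hx =>
      obtain ⟨j, hj, rfl⟩ := hx
      rw [hb]
      refine Submodule.sum_mem _ fun k _ => ?_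
      by_cases hk : b j k = 0
      · simp [hk]
      · exact nsmul_mem (Submodule.subset_span (Set.mem_image_of_mem χ (hS j hj k hk))) _
    | zero => simp
    | add x y _ _ hx hy => rw [mul_add]; exact Submodule.add_mem _ hx hy
    | smul c x _ hx => rw [mul_smul_comm]; exact Submodule.smul_mem _ c hx
  -- the product of the `v - v(g)` over `g ≠ 1` is supported at `1`
  have hprod : ∀ s : Finset H,
      (∏ g ∈ s, (v - fun _ => v g)) ∈ Submodule.span ℂ (χ '' S) := by
    intro s
    induction s using Finset.induction_on with
    | empty => exact Submodule.subset_span ⟨o, hoS, by simp [ho]⟩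
    | insert g s hg ih =>
      rw [Finset.prod_insert hg, sub_mul]
      exact Submodule.sub_mem _ (hstable _ ih) (Submodule.smul_mem _ (v g) ih)
  have horth : ∀ f ∈ Submodule.span ℂ (χ '' S), charForm H f (χ i) = 0 := by
    intro f hf
    induction hf using Submodule.span_induction with
    | mem x hx =>
      obtain ⟨j, hj, rfl⟩ := hx
      exact charForm_irrChars_of_ne (hχ ▸ Set.mem_range_self j) (hχ ▸ Set.mem_range_self i)
        (hinj.ne fun h => hi (h ▸ hj))
    | zero => simp
    | add x y _ _ hx hy => rw [map_add, LinearMap.add_apply, hx, hy, add_zero]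
    | smul c x _ hx => rw [map_smul, LinearMap.smul_apply, hx, smul_zero]
  have h0 := horth _ (hprod (Finset.univ.erase 1))
  rw [charForm_apply, Finset.sum_eq_single 1] at h0
  · have hcard : (Nat.card H : ℂ)⁻¹ ≠ 0 := inv_ne_zero (Nat.cast_ne_zero.mpr Nat.card_pos.ne')
    rw [inv_one, mul_eq_zero, or_iff_right hcard, mul_eq_zero, Finset.prod_apply] at h0
    rcases h0 with h0 | h0
    · rw [Finset.prod_eq_zero_iff] at h0
      obtain ⟨g, hg, h⟩ := h0
      refine (Finset.mem_erase.mp hg).1 (hι ?_)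
      rw [map_one]
      refine eq_one_of_trace_eq_two (MonoidHom.isOfFinOrder ι (isOfFinOrder_of_finite g)) ?_
      have h1 : v g = v 1 := (sub_eq_zero.mp h).symm
      rw [← character_stdRep, ← hv, h1, hv, Representation.char_one]
      simp
    · obtain ⟨U, _, _, σ, hσ, h⟩ := (hχ ▸ ⟨i, rfl⟩ : χ i ∈ irrChars H)
      have := finiteDimensional_of_isIrreducible hσ
      have := nontrivial_of_isIrreducible hσ
      rw [← h, Representation.char_one, Nat.cast_eq_zero] at h0
      exact Module.finrank_pos.ne' h0
  · intro g _ hg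
    rw [Finset.prod_apply, Finset.prod_eq_zero (Finset.mem_erase.mpr ⟨hg, Finset.mem_univ g⟩),
      zero_mul]
    exact sub_self _
  · simp

/-- The McKay graph of a finite subgroup of even order of `SL(2, ℂ)`, with the dimensions of the
irreducible modules, is an affine diagram. -/
theorem isAffineDiagram_mckay (hι : Function.Injective ι) (hH : Even (Nat.card H))
    (hinj : Function.Injective χ) (hχ : Set.range χ = irrChars H) (ho : χ o = 1)
    (hb : ∀ j, Representation.character (stdRep.comp ι) * χ j = ∑ i, b j i • χ i) {δ : I → ℕ}
    (hδ : ∀ i, χ i 1 = δ i) : IsAffineDiagram b δ o := by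
  classical
  have := Fintype.ofFinite H
  obtain ⟨z, hz⟩ := exists_map_eq_neg_one hι hH
  have hmem : ∀ i, χ i ∈ irrChars H := fun i => hχ ▸ ⟨i, rfl⟩
  have hform : ∀ i j, charForm H (χ i) (χ j) = if i = j then 1 else 0 := by
    intro i j
    split_ifs with h
    · rw [h, charForm_irrChars_self (hmem j)]
    · exact charForm_irrChars_of_ne (hmem i) (hmem j) (hinj.ne h)
  have hli : LinearIndependent ℂ χ := linearIndependent_of_charForm
    (fun i j hij => by rw [hform, if_neg hij]) fun i => by rw [hform, if_pos rfl]; exact one_ne_zero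
  have hcoef : ∀ j i, (b j i : ℂ) =
      charForm H (Representation.character (stdRep.comp ι) * χ j) (χ i) := by
    intro j i
    simp only [hb, map_sum, map_nsmul, LinearMap.sum_apply, LinearMap.smul_apply, hform]
    simp
  refine ⟨fun i j => ?_, exists_parity hli (character_stdRep_mul hz)
    (fun i => irrChars_even_or_odd (map_eq_neg_one_central hι hz)
      (map_eq_neg_one_mul_self hι hz) (hmem i)) hb, fun j => ?_, fun j => ?_, ?_,
    mckay_connected hι hinj hχ ho hb⟩
  · -- `V` is self-dual
    have : (b i j : ℂ) = b j i := by
      rw [hcoef, hcoef, charForm_comm, charForm_apply, charForm_apply]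
      congr 1
      refine Finset.sum_congr rfl fun g _ => ?_
      rw [Pi.mul_apply, Pi.mul_apply, character_stdRep, character_stdRep, map_inv,
        trace_inv_eq_trace]
      ring
    exact_mod_cast this
  · obtain ⟨U, _, _, σ, hσ, h⟩ := hmem j
    have := finiteDimensional_of_isIrreducible hσ
    have := nontrivial_of_isIrreducible hσ
    have h1 := hδ j
    rw [← h, Representation.char_one, Nat.cast_inj] at h1
    rw [← h1]
    exact Module.finrank_pos
  · have h1 := congrFun (hb j) 1
    rw [Pi.mul_apply, Representation.char_one, hδ, Finset.sum_apply] at h1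
    simp only [Pi.smul_apply, hδ, nsmul_eq_mul, Module.finrank_fin_fun] at h1
    exact_mod_cast h1.symm
  · have h1 := hδ o
    rw [ho, Pi.one_apply] at h1
    exact_mod_cast h1.symm

theorem exists_isKostant_mckay [DecidableEq I] (hι : Function.Injective ι)
    (hH : Even (Nat.card H)) (hinj : Function.Injective χ) (hχ : Set.range χ = irrChars H)
    (ho : χ o = 1)
    (hb : ∀ j, Representation.character (stdRep.comp ι) * χ j = ∑ i, b j i • χ i) :
    ∃ h, IsKostant (adjOp b) o h (maxIrrepDim H) := by
  have hδ : ∀ i, ∃ n : ℕ, χ i 1 = n := by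
    intro i
    obtain ⟨U, _, _, σ, hσ, h⟩ := (hχ ▸ ⟨i, rfl⟩ : χ i ∈ irrChars H)
    have := finiteDimensional_of_isIrreducible hσ
    exact ⟨_, by rw [← h, Representation.char_one]⟩
  choose δ hδ using hδ
  obtain ⟨h, d, hK, hle, j, hj⟩ :=
    (isAffineDiagram_mckay hι hH hinj hχ ho hb hδ).exists_isKostant
  refine ⟨h, ?_⟩
  have : IsGreatest {d : ℕ | ∃ (U : Type) (_ : AddCommGroup U) (_ : Module ℂ U)
      (σ : Representation ℂ H U), σ.IsIrreducible ∧ Module.finrank ℂ U = d} d := by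
    constructor
    · obtain ⟨U, _, _, σ, hσ, h⟩ := (hχ ▸ ⟨j, rfl⟩ : χ j ∈ irrChars H)
      have := finiteDimensional_of_isIrreducible hσ
      have h1 := hδ j
      rw [← h, Representation.char_one, Nat.cast_inj] at h1
      exact ⟨U, _, _, σ, hσ, h1.trans hj⟩
    · rintro _ ⟨U, _, _, σ, hσ, rfl⟩
      have := finiteDimensional_of_isIrreducible hσ
      obtain ⟨i, hi⟩ : σ.character ∈ Set.range χ := hχ ▸ ⟨U, _, _, σ, hσ, rfl⟩
      have h1 := hδ i
      rw [hi, Representation.char_one, Nat.cast_inj] at h1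
      rw [h1]
      exact hle i
  rwa [maxIrrepDim, this.csSup_eq]

end McKay

/-! ### Characters of symmetric powers -/

section SymmetricPowers

variable {U : Type} [AddCommGroup U] [Module ℂ U]

theorem exists_eigenbasis [FiniteDimensional ℂ U] {d : ℕ} (hd : Module.finrank ℂ U = d)
    {f : Module.End ℂ U} {n : ℕ} (hn : n ≠ 0) (hf : f ^ n = 1) :
    ∃ (β : Module.Basis (Fin d) ℂ U) (c : Fin d → ℂ), ∀ i, f (β i) = c i • β i := by
  have hss : f.IsSemisimple := by
    refine Module.End.isSemisimple_of_squarefree_aeval_eq_zero (p := Polynomial.X ^ n - 1) ?_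
      (by simp [hf])
    exact (Polynomial.X_pow_sub_one_separable_iff.mpr (Nat.cast_ne_zero.mpr hn)).squarefree
  have hs : ⊤ ≤ Submodule.span ℂ {v | ∃ μ : ℂ, f v = μ • v} := by
    rw [← hss.iSup_eigenspace_eq_top, iSup_le_iff]
    exact fun μ v hv => Submodule.subset_span ⟨μ, Module.End.mem_eigenspace_iff.mp hv⟩
  let β := Module.Basis.ofSpan hs
  have := Module.Finite.finite_basis β
  have := Fintype.ofFinite ((linearIndepOn_empty ℂ id).extend
    (Set.empty_subset {v | ∃ μ : ℂ, f v = μ • v}))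
  have hβ : ∀ i, ∃ μ : ℂ, f (β i) = μ • β i := fun i =>
    Module.Basis.ofSpan_subset hs (Set.mem_range_self i)
  choose c hc using hβ
  let e := Fintype.equivFinOfCardEq ((Module.finrank_eq_card_basis β).symm.trans hd)
  exact ⟨β.reindex e, c ∘ e.symm, fun i => by simp [hc]⟩

theorem trace_eq_sum_of_eigenbasis {J : Type} [Fintype J] (β : Module.Basis J ℂ U) {c : J → ℂ}
    {f : Module.End ℂ U} (hf : ∀ i, f (β i) = c i • β i) : LinearMap.trace ℂ U f = ∑ i, c i := by
  classical
  rw [LinearMap.trace_eq_matrix_trace ℂ β, Matrix.trace]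
  simp [LinearMap.toMatrix_apply, hf]

theorem det_eq_prod_of_eigenbasis {J : Type} [Fintype J] (β : Module.Basis J ℂ U) {c : J → ℂ}
    {f : Module.End ℂ U} (hf : ∀ i, f (β i) = c i • β i) : LinearMap.det f = ∏ i, c i := by
  classical
  rw [← LinearMap.det_toMatrix β, ← Matrix.det_diagonal]
  congr 1
  ext i j
  rw [LinearMap.toMatrix_apply, hf, Matrix.diagonal_apply]
  by_cases h : i = j
  · simp [h]
  · simp [h]

/-- The monomials `a ^ i * b ^ (k - i)` in the members of a basis `a`, `b` of `U`. -/
def symMonomial (β : Module.Basis (Fin 2) ℂ U) (k : ℕ) (i : Fin (k + 1)) : SymmetricAlgebra ℂ U :=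
  SymmetricAlgebra.ι ℂ U (β 0) ^ (i : ℕ) * SymmetricAlgebra.ι ℂ U (β 1) ^ (k - i)

theorem linearIndependent_symMonomial (β : Module.Basis (Fin 2) ℂ U) (k : ℕ) :
    LinearIndependent ℂ (symMonomial β k) := by
  let e : Fin (k + 1) → Fin 2 →₀ ℕ := fun i => Finsupp.single 0 (i : ℕ) + Finsupp.single 1 (k - i)
  have he : Function.Injective e := by
    intro i j hij
    have := DFunLike.congr_fun hij 0
    simp only [e, Finsupp.add_apply, Finsupp.single_apply] at this
    exact Fin.ext (by simpa using this)
  have h : symMonomial β k = β.symmetricAlgebra ∘ e := by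
    funext i
    rw [Function.comp_apply, Module.Basis.symmetricAlgebra, Module.Basis.map_apply,
      MvPolynomial.coe_basisMonomials, AlgEquiv.toLinearEquiv_apply, AlgEquiv.eq_symm_apply,
      symMonomial]
    rw [map_mul, map_pow, map_pow, SymmetricAlgebra.equivMvPolynomial_ι_apply,
      SymmetricAlgebra.equivMvPolynomial_ι_apply, MvPolynomial.X_pow_eq_monomial,
      MvPolynomial.X_pow_eq_monomial, MvPolynomial.monomial_mul, one_mul]
  rw [h]
  exact β.symmetricAlgebra.linearIndependent.comp e he

theorem span_symMonomial (β : Module.Basis (Fin 2) ℂ U) (k : ℕ) :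
    Submodule.span ℂ (Set.range (symMonomial β k)) = symPow U k := by
  have hι : LinearMap.range (SymmetricAlgebra.ι ℂ U) =
      Submodule.span ℂ {SymmetricAlgebra.ι ℂ U (β 0), SymmetricAlgebra.ι ℂ U (β 1)} := by
    rw [LinearMap.range_eq_map, ← β.span_eq, Submodule.map_span, ← Set.range_comp]
    congr 1
    ext x
    simp [eq_comm]
  refine le_antisymm ?_ ?_
  · rw [Submodule.span_le]
    rintro _ ⟨i, rfl⟩
    have h : symPow U k = symPow U i * symPow U (k - i) := by
      rw [symPow, symPow, symPow, ← pow_add, Nat.add_sub_cancel' (by omega)]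
    rw [h]
    exact Submodule.mul_mem_mul (Submodule.pow_mem_pow _ (LinearMap.mem_range_self _ _) _)
      (Submodule.pow_mem_pow _ (LinearMap.mem_range_self _ _) _)
  · induction k with
    | zero =>
      rw [symPow, pow_zero, Submodule.one_eq_span, Submodule.span_le]
      rintro _ rfl
      exact Submodule.subset_span ⟨0, by simp [symMonomial]⟩
    | succ k ih =>
      rw [symPow, pow_succ]
      refine (mul_le_mul_left ih _).trans ?_
      rw [hι, Submodule.span_mul_span, Submodule.span_le]
      rintro _ ⟨_, ⟨i, rfl⟩, y, hy, rfl⟩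
      rcases hy with rfl | rfl
      · refine Submodule.subset_span ⟨i.succ, ?_⟩
        simp only [symMonomial, Fin.val_succ, Nat.add_sub_add_right, pow_succ]
        ring
      · refine Submodule.subset_span ⟨i.castSucc, ?_⟩
        simp only [symMonomial, Fin.val_castSucc]
        rw [Nat.succ_sub (by omega), pow_succ, mul_assoc]

/-- The monomial basis of `S^k(U)`. -/
def symPowBasis (β : Module.Basis (Fin 2) ℂ U) (k : ℕ) :
    Module.Basis (Fin (k + 1)) ℂ (symPow U k) :=
  (Module.Basis.span (linearIndependent_symMonomial β k)).map
    (LinearEquiv.ofEq _ _ (span_symMonomial β k))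

theorem coe_symPowBasis (β : Module.Basis (Fin 2) ℂ U) (k : ℕ) (i : Fin (k + 1)) :
    (symPowBasis β k i : SymmetricAlgebra ℂ U) = symMonomial β k i := by
  rw [symPowBasis, Module.Basis.map_apply, LinearEquiv.coe_ofEq_apply, Module.Basis.span_apply]

instance (k : ℕ) : FiniteDimensional ℂ (symPow (Fin 2 → ℂ) k) :=
  Module.Finite.of_basis (symPowBasis (Pi.basisFun ℂ (Fin 2)) k)

variable {H : Type} [Group H]

theorem character_symPowRep_of_eigenbasis (σ : Representation ℂ H U) {g : H}
    (β : Module.Basis (Fin 2) ℂ U) {c : Fin 2 → ℂ} (hc : ∀ i, σ g (β i) = c i • β i) (k : ℕ) :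
    (symPowRep σ k).character g = ∑ i ∈ Finset.range (k + 1), c 0 ^ i * c 1 ^ (k - i) := by
  rw [Representation.character, trace_eq_sum_of_eigenbasis (symPowBasis β k)
    (c := fun i => c 0 ^ (i : ℕ) * c 1 ^ (k - i)),
    Fin.sum_univ_eq_sum_range fun i => c 0 ^ i * c 1 ^ (k - i)]
  intro i
  refine Subtype.ext ?_
  change symAlgRep σ g (symPowBasis β k i : SymmetricAlgebra ℂ U) =
    (c 0 ^ (i : ℕ) * c 1 ^ (k - i)) • (symPowBasis β k i : SymmetricAlgebra ℂ U)
  rw [coe_symPowBasis, symMonomial]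
  have h : ∀ x, symAlgRep σ g x = SymmetricAlgebra.lift (SymmetricAlgebra.ι ℂ U ∘ₗ σ g) x :=
    fun _ => rfl
  rw [h, map_mul, map_pow, map_pow, SymmetricAlgebra.lift_ι_apply, SymmetricAlgebra.lift_ι_apply]
  simp only [LinearMap.comp_apply, hc, map_smul, smul_pow, smul_mul_smul_comm]

/-- The eigenvalues `c₀`, `c₁` of an element of finite order of `SL(2, ℂ)` satisfy `c₀ c₁ = 1`, and
the character of `S^k(V)` is the complete homogeneous polynomial of degree `k` in them. -/
theorem character_symPowRep (ι : H →* SL(2, ℂ)) [Finite H] (g : H) :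
    ∃ c₀ c₁ : ℂ, c₀ * c₁ = 1 ∧ Representation.character (stdRep.comp ι) g = c₀ + c₁ ∧
      ∀ k, (symPowRep (stdRep.comp ι) k).character g =
        ∑ i ∈ Finset.range (k + 1), c₀ ^ i * c₁ ^ (k - i) := by
  have hg : ((stdRep.comp ι) g) ^ orderOf g = 1 := by rw [← map_pow, pow_orderOf_eq_one, map_one]
  obtain ⟨β, c, hc⟩ := exists_eigenbasis (Module.finrank_fin_fun ℂ) (orderOf_pos g).ne' hg
  refine ⟨c 0, c 1, ?_, ?_, character_symPowRep_of_eigenbasis _ β hc⟩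
  · rw [← Fin.prod_univ_two, ← det_eq_prod_of_eigenbasis β hc]
    exact (LinearMap.det_toLin' _).trans (ι g).2
  · rw [← Fin.sum_univ_two, ← trace_eq_sum_of_eigenbasis β hc]
    rfl

theorem character_symPowRep_zero (ι : H →* SL(2, ℂ)) [Finite H] :
    (symPowRep (stdRep.comp ι) 0).character = 1 := by
  ext g
  obtain ⟨c₀, c₁, -, -, h⟩ := character_symPowRep ι g
  simp [h]

theorem character_symPowRep_one (ι : H →* SL(2, ℂ)) [Finite H] :
    (symPowRep (stdRep.comp ι) 1).character = Representation.character (stdRep.comp ι) := by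
  ext g
  obtain ⟨c₀, c₁, -, h1, h⟩ := character_symPowRep ι g
  simp [h, h1, Finset.sum_range_succ, add_comm]

theorem character_symPowRep_add_two (ι : H →* SL(2, ℂ)) [Finite H] (k : ℕ) :
    (symPowRep (stdRep.comp ι) (k + 2)).character =
      Representation.character (stdRep.comp ι) * (symPowRep (stdRep.comp ι) (k + 1)).character -
        (symPowRep (stdRep.comp ι) k).character := by
  ext g
  obtain ⟨c₀, c₁, h0, h1, h⟩ := character_symPowRep ι g
  have hs : ∀ n, ∑ i ∈ Finset.range (n + 1 + 1), c₀ ^ i * c₁ ^ (n + 1 - i) =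
      c₁ * ∑ i ∈ Finset.range (n + 1), c₀ ^ i * c₁ ^ (n - i) + c₀ ^ (n + 1) := by
    intro n
    rw [Finset.sum_range_succ, Nat.sub_self, pow_zero, mul_one, Finset.mul_sum]
    congr 1
    refine Finset.sum_congr rfl fun i hi => ?_
    rw [Nat.succ_sub (Nat.lt_succ_iff.mp (Finset.mem_range.mp hi)), pow_succ]
    ring
  rw [Pi.sub_apply, Pi.mul_apply, h1, h, h, h, hs (k + 1), hs k]
  linear_combination (-∑ i ∈ Finset.range (k + 1), c₀ ^ i * c₁ ^ (k - i)) * h0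

end SymmetricPowers

/-! ### Characters of induced modules -/

section Induction

open Representation

/-- The coinvariants of a finite group are a direct summand, cut out by averaging; so traces on them
are averages of traces. -/
theorem trace_coinvariants_map {K E : Type} [Group K] [Fintype K] [AddCommGroup E] [Module ℂ E]
    [FiniteDimensional ℂ E] (τ : Representation ℂ K E) (f : τ.IntertwiningMap τ) :
    LinearMap.trace ℂ _ (Coinvariants.map τ τ f) =
      (Nat.card K : ℂ)⁻¹ * ∑ n, LinearMap.trace ℂ _ (τ n ∘ₗ f.toLinearMap) := by
  have hcard : (Nat.card K : ℂ) ≠ 0 := Nat.cast_ne_zero.mpr Nat.card_pos.ne'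
  -- averaging over `K` gives a section `s` of the projection to the coinvariants
  let s : τ.Coinvariants →ₗ[ℂ] E := Coinvariants.lift τ ((Nat.card K : ℂ)⁻¹ • ∑ n, τ n) fun m => by
    rw [LinearMap.smul_comp, ← Module.End.mul_eq_comp, Finset.sum_mul]
    congr 1
    exact Fintype.sum_equiv (Equiv.mulRight m) _ _ fun n => by
      rw [Equiv.coe_mulRight, map_mul]
  have hs : Coinvariants.mk τ ∘ₗ s = LinearMap.id := by
    refine Coinvariants.hom_ext (LinearMap.ext fun x => ?_)
    change Coinvariants.mk τ (((Nat.card K : ℂ)⁻¹ • ∑ n, τ n) x) = Coinvariants.mk τ x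
    rw [LinearMap.smul_apply, LinearMap.sum_apply, map_smul, map_sum]
    simp only [Coinvariants.mk_self_apply, Finset.sum_const, Finset.card_univ]
    rw [← Nat.card_eq_fintype_card, ← Nat.cast_smul_eq_nsmul ℂ, smul_smul, inv_mul_cancel₀ hcard,
      one_smul]
  rw [← LinearMap.comp_id (Coinvariants.map τ τ f), ← hs, ← LinearMap.comp_assoc,
    LinearMap.trace_comp_comm', Coinvariants.map_comp_mk, ← LinearMap.comp_assoc]
  change LinearMap.trace ℂ E (((Nat.card K : ℂ)⁻¹ • ∑ n, τ n) ∘ₗ f.toLinearMap) = _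
  rw [LinearMap.smul_comp, map_smul, ← Module.End.mul_eq_comp, Finset.sum_mul, map_sum, smul_eq_mul]
  rfl

/-- The conjugate `n ↦ χ (x n x⁻¹)` of a function on a normal subgroup `N`. -/
def conjFun {H : Type} [Group H] {N : Subgroup H} [N.Normal] (x : H) (χ : N → ℂ) : N → ℂ :=
  fun n => χ (MulAut.conjNormal x n)

theorem conjFun_mem_irrChars {H : Type} [Group H] {N : Subgroup H} [N.Normal] (x : H)
    {χ : N → ℂ} (hχ : χ ∈ irrChars N) :
    conjFun x χ ∈ irrChars N := by
  obtain ⟨U, _, _, σ, hσ, rfl⟩ := hχ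
  have := nontrivial_of_isIrreducible hσ
  refine ⟨U, _, _, σ.comp (MulAut.conjNormal x : N ≃* N).toMonoidHom,
    isIrreducible_of_forall fun p hp => ?_, rfl⟩
  refine eq_bot_or_eq_top_of_isIrreducible hσ p fun n v hv => ?_
  have := hp ((MulAut.conjNormal x : N ≃* N).symm n) v hv
  simpa using this

variable {H : Type} [Group H] [Fintype H] [DecidableEq H] (N : Subgroup H) [Fintype N]

/-- Induction of functions from the subgroup `N` to `H`: the value at `g` of the function induced
from `χ` is `|N|⁻¹` times the sum of the values of `χ` at the conjugates `x g x⁻¹` that lie in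
`N`. -/
def indFun : (N → ℂ) →ₗ[ℂ] (H → ℂ) where
  toFun χ g := (Nat.card N : ℂ)⁻¹ * ∑ n : N, ∑ x : H, if (n : H) * x = x * g then χ n else 0
  map_add' χ χ' := by
    ext g
    simp only [Pi.add_apply, ← mul_add, ← Finset.sum_add_distrib, ite_add_ite, add_zero]
  map_smul' c χ := by
    ext g
    simp only [Pi.smul_apply, smul_eq_mul, RingHom.id_apply, ← mul_ite_zero, ← Finset.mul_sum]
    ring

theorem indFun_apply (χ : N → ℂ) (g : H) : indFun N χ g =
    (Nat.card N : ℂ)⁻¹ * ∑ n : N, ∑ x : H, if (n : H) * x = x * g then χ n else 0 := rfl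

theorem character_ind {U : Type} [AddCommGroup U] [Module ℂ U] [FiniteDimensional ℂ U]
    (φ : Representation ℂ N U) : (ind N φ).character = indFun N φ.character := by
  ext g
  refine (trace_coinvariants_map _ _).trans ?_
  rw [indFun_apply]
  congr 1
  refine Finset.sum_congr rfl fun n _ => ?_
  have h : LinearMap.trace ℂ (MonoidAlgebra ℂ H) (((leftRegular ℂ H).comp N.subtype) n ∘ₗ
      MonoidAlgebra.mapDomainLinearMap ℂ ℂ fun x => x * g⁻¹) =
      ∑ x : H, if (n : H) * x = x * g then 1 else 0 := by
    rw [LinearMap.trace_eq_matrix_trace ℂ (MonoidAlgebra.basis H ℂ), Matrix.trace]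
    refine Finset.sum_congr rfl fun x _ => ?_
    rw [Matrix.diag_apply, LinearMap.toMatrix_apply]
    have h1 : MonoidAlgebra.basis H ℂ x = MonoidAlgebra.single x 1 := rfl
    rw [h1, LinearMap.comp_apply, MonoidAlgebra.mapDomainLinearMap_single, MonoidHom.comp_apply,
      ofMulAction_single]
    change (MonoidAlgebra.single ((n : H) * (x * g⁻¹)) (1 : ℂ)).coeff x = _
    rw [MonoidAlgebra.coeff_single, Finsupp.single_apply]
    refine if_congr ?_ rfl rfl
    rw [← mul_assoc, mul_inv_eq_iff_eq_mul]
  change LinearMap.trace ℂ _ (TensorProduct.map (((leftRegular ℂ H).comp N.subtype) n) (φ n) ∘ₗ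
    LinearMap.rTensor U (MonoidAlgebra.mapDomainLinearMap ℂ ℂ fun x => x * g⁻¹)) = _
  rw [LinearMap.map_comp_rTensor, LinearMap.trace_tensorProduct', h, Finset.sum_mul]
  simp only [ite_mul, one_mul, zero_mul]
  rfl

variable {N}

/-- The projection formula. -/
theorem indFun_mul {v : H → ℂ} (hv : ∀ x g, v (x * g * x⁻¹) = v g) (χ : N → ℂ) :
    indFun N ((fun n : N => v n) * χ) = v * indFun N χ := by
  ext g
  rw [Pi.mul_apply, indFun_apply, indFun_apply, mul_left_comm, Finset.mul_sum]
  simp only [Finset.mul_sum, mul_ite, mul_zero]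
  congr 2 with n
  refine Finset.sum_congr rfl fun x _ => ?_
  split_ifs with h
  · rw [Pi.mul_apply, ← hv x g, ← h, mul_inv_cancel_right]
  · rfl

/-- Frobenius reciprocity. -/
theorem charForm_indFun {v : H → ℂ} (hv : ∀ x g, v (x * g * x⁻¹) = v g) (χ : N → ℂ) :
    charForm H (indFun N χ) v = charForm N χ fun n => v n := by
  have hcard : (Nat.card H : ℂ) ≠ 0 := Nat.cast_ne_zero.mpr Nat.card_pos.ne'
  rw [charForm_apply, charForm_apply]
  simp only [indFun_apply, mul_assoc, ← Finset.mul_sum]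
  rw [mul_left_comm]
  congr 1
  rw [inv_mul_eq_iff_eq_mul₀ hcard]
  simp only [Finset.sum_mul]
  rw [Finset.sum_comm, Finset.mul_sum]
  refine Finset.sum_congr rfl fun n _ => ?_
  have key : ∀ x : H, ∑ g, (if (n : H) * x = x * g then χ n else 0) * v g⁻¹ =
      χ n * v (n⁻¹ : N) := by
    intro x
    rw [Finset.sum_eq_single (x⁻¹ * n * x), if_pos (by group), ← hv x]
    · congr 2
      simp [mul_assoc]
    · intro g _ hg
      rw [if_neg, zero_mul]
      intro h
      exact hg (by rw [mul_assoc, h, inv_mul_cancel_left])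
    · simp
  rw [Finset.sum_comm, Finset.sum_congr rfl fun x _ => key x, Finset.sum_const, Finset.card_univ,
    nsmul_eq_mul, Nat.card_eq_fintype_card]

theorem indFun_conjFun [N.Normal] (x : H) (χ : N → ℂ) :
    indFun N (conjFun x χ) = indFun N χ := by
  ext g
  rw [indFun_apply, indFun_apply]
  congr 1
  refine Fintype.sum_equiv (MulAut.conjNormal x : N ≃* N).toEquiv _ _ fun n => ?_
  refine Fintype.sum_equiv (Equiv.mulLeft x) _ _ fun y => ?_
  have : ((MulAut.conjNormal x : N ≃* N).toEquiv n : H) = x * n * x⁻¹ := MulAut.conjNormal_apply x n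
  rw [this]
  simp only [Equiv.coe_mulLeft, mul_assoc, inv_mul_cancel_left, mul_right_inj]
  rfl

theorem indFun_coe [N.Normal] (χ : N → ℂ) :
    (fun n : N => indFun N χ n) = (Nat.card N : ℂ)⁻¹ • ∑ x : H, conjFun x χ := by
  ext n
  rw [indFun_apply, Pi.smul_apply, smul_eq_mul, Finset.sum_apply, Finset.sum_comm]
  congr 1
  refine Finset.sum_congr rfl fun x _ => ?_
  rw [Finset.sum_eq_single (MulAut.conjNormal x n), if_pos]
  · rfl
  · simp
  · intro m _ hm
    rw [if_neg]
    intro h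
    refine hm (Subtype.ext ?_)
    rw [MulAut.conjNormal_apply, ← h, mul_inv_cancel_right]
  · simp

theorem indFun_conj (χ : N → ℂ) (y g : H) : indFun N χ (y * g * y⁻¹) = indFun N χ g := by
  rw [indFun_apply, indFun_apply]
  congr 1
  refine Finset.sum_congr rfl fun n _ => ?_
  refine Fintype.sum_equiv (Equiv.mulRight y) _ _ fun x => ?_
  simp only [Equiv.coe_mulRight, ← mul_assoc, ← eq_mul_inv_iff_mul_eq]

theorem charForm_indFun_indFun [N.Normal] (χ χ' : N → ℂ) :
    charForm H (indFun N χ) (indFun N χ') =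
      (Nat.card N : ℂ)⁻¹ * ∑ x : H, charForm N χ (conjFun x χ') := by
  rw [charForm_indFun (indFun_conj χ'), indFun_coe, map_smul, map_sum, smul_eq_mul]

theorem charForm_indFun_eq_zero [N.Normal] {χ χ' : N → ℂ} (hχ : χ ∈ irrChars N)
    (hχ' : χ' ∈ irrChars N) (h : indFun N χ ≠ indFun N χ') :
    charForm H (indFun N χ) (indFun N χ') = 0 := by
  rw [charForm_indFun_indFun, Finset.sum_eq_zero, mul_zero]
  intro x _
  refine charForm_irrChars_of_ne hχ (conjFun_mem_irrChars x hχ') fun h0 => h ?_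
  rw [h0, indFun_conjFun]

theorem charForm_indFun_self_ne_zero [N.Normal] {χ : N → ℂ} (hχ : χ ∈ irrChars N) :
    charForm H (indFun N χ) (indFun N χ) ≠ 0 := by
  rw [charForm_indFun_indFun]
  refine mul_ne_zero (inv_ne_zero (Nat.cast_ne_zero.mpr Nat.card_pos.ne')) ?_
  have h : ∀ x : H, charForm N χ (conjFun x χ) = if χ = conjFun x χ then 1 else 0 := by
    intro x
    split_ifs with h
    · rw [← h, charForm_irrChars_self hχ]
    · exact charForm_irrChars_of_ne hχ (conjFun_mem_irrChars x hχ) h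
  rw [Finset.sum_congr rfl fun x _ => h x, Finset.sum_boole, Nat.cast_ne_zero,
    Finset.card_ne_zero]
  refine ⟨1, Finset.mem_filter.mpr ⟨Finset.mem_univ _, ?_⟩⟩
  ext n
  simp [conjFun]

theorem indFun_even_or_odd {z : N} (hc : ∀ g : H, z * g = g * z) {χ : N → ℂ}
    (hχ : (∀ n, χ (z * n) = χ n) ∨ ∀ n, χ (z * n) = -χ n) :
    (∀ g, indFun N χ (z * g) = indFun N χ g) ∨ ∀ g, indFun N χ (z * g) = -indFun N χ g := by
  have key : ∀ g, indFun N χ (z * g) = indFun N (fun n => χ (z * n)) g := by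
    intro g
    rw [indFun_apply, indFun_apply]
    congr 1
    refine (Fintype.sum_equiv (Equiv.mulLeft z) _ _ fun n => ?_).symm
    refine Finset.sum_congr rfl fun x _ => ?_
    refine if_congr ?_ rfl rfl
    rw [Equiv.coe_mulLeft, Subgroup.coe_mul, ← mul_assoc x, ← hc x, mul_assoc, mul_assoc,
      mul_right_inj]
  refine hχ.imp (fun h g => ?_) fun h g => ?_
  · rw [key, funext h]
  · rw [key, show (fun n => χ (z * n)) = -χ from funext h, map_neg, Pi.neg_apply]

end Induction

/-! ### Kostant's formula in the three cases -/

section Cases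

open Representation

variable {H : Type} [Group H] [Finite H] {I : Type}

theorem linearIndependent_of_range_eq {χ : I → H → ℂ} (hinj : Function.Injective χ)
    (hχ : Set.range χ = irrChars H) : LinearIndependent ℂ χ := by
  have := Fintype.ofFinite H
  exact linearIndependent_irrChars.comp (fun i => ⟨χ i, hχ ▸ Set.mem_range_self i⟩)
    fun i j h => hinj (congrArg Subtype.val h)

variable [Fintype I] [DecidableEq I]

theorem sum_smul_comp {J A : Type} [Fintype J] [AddCommMonoid A] (p : J → I) (n : J → ℕ)
    (m : I → A) : ∑ j, n j • m (p j) = ∑ i, (∑ j with p j = i, n j) • m i := by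
  rw [← Finset.sum_fiberwise (s := Finset.univ) (g := p)]
  refine Finset.sum_congr rfl fun i _ => ?_
  rw [Finset.sum_smul]
  exact Finset.sum_congr rfl fun j hj => by rw [(Finset.mem_filter.mp hj).2]

theorem IsIrreducibleSystem.exists_character_eq_sum {W : I → Type} [∀ i, AddCommGroup (W i)]
    [∀ i, Module ℂ (W i)] {ρ : ∀ i, Representation ℂ H (W i)} (hρ : IsIrreducibleSystem ρ)
    {U : Type} [AddCommGroup U] [Module ℂ U] [FiniteDimensional ℂ U] (σ : Representation ℂ H U) :
    ∃ n : I → ℕ, σ.character = ∑ i, n i • (ρ i).character := by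
  have hp : ∀ χ : irrChars H, ∃ i, (χ : H → ℂ) = (ρ i).character := by
    rintro ⟨_, U, _, _, τ, hτ, rfl⟩
    obtain ⟨i, ⟨e⟩⟩ := hρ.exhaustive U τ hτ
    exact ⟨i, char_iso e⟩
  choose p hp using hp
  obtain ⟨n, hn⟩ := McKaySlodowy.exists_character_eq_sum σ
  simp only [hp] at hn
  exact ⟨_, hn.trans (sum_smul_comp p n fun i => (ρ i).character)⟩

theorem exists_mckay_matrix (V : Representation ℂ H (Fin 2 → ℂ)) :
    ∃ B : Matrix (irrChars H) (irrChars H) ℕ, ∀ χ : irrChars H,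
      V.character * (χ : H → ℂ) = ∑ χ', B χ χ' • (χ' : H → ℂ) := by
  have h : ∀ χ : irrChars H, ∃ n : irrChars H → ℕ,
      V.character * (χ : H → ℂ) = ∑ χ', n χ' • (χ' : H → ℂ) := by
    rintro ⟨_, U, _, _, τ, hτ, rfl⟩
    have := finiteDimensional_of_isIrreducible hτ
    rw [← char_tensor]
    exact exists_character_eq_sum _
  choose B hB using h
  exact ⟨B, hB⟩

variable {ι : H →* SL(2, ℂ)}

/-- The McKay graph of `H` itself is an affine diagram. -/
theorem kostantFormula_of_isIrreducibleSystem (hι : Function.Injective ι)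
    (hH : Even (Nat.card H)) {W : I → Type} [∀ i, AddCommGroup (W i)] [∀ i, Module ℂ (W i)]
    {ρ : ∀ i, Representation ℂ H (W i)} (hρ : IsIrreducibleSystem ρ) {o : I}
    (ho : Nonempty ((ρ o).Equiv (Representation.trivial ℂ H ℂ))) :
    KostantFormula (stdRep.comp ι) ρ (fun k => symPowRep (stdRep.comp ι) k) o
      (maxIrrepDim H) := by
  have hfd : ∀ i, FiniteDimensional ℂ (W i) := fun i =>
    finiteDimensional_of_isIrreducible (hρ.irreducible i)
  have hinj : Function.Injective fun i => (ρ i).character := fun i j h =>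
    hρ.inequivalent i j (nonempty_equiv_of_character_eq h)
  have hχ : Set.range (fun i => (ρ i).character) = irrChars H := by
    ext f
    constructor
    · rintro ⟨i, rfl⟩
      exact ⟨W i, _, _, ρ i, hρ.irreducible i, rfl⟩
    · rintro ⟨U, _, _, σ, hσ, rfl⟩
      obtain ⟨i, ⟨e⟩⟩ := hρ.exhaustive U σ hσ
      exact ⟨i, (char_iso e).symm⟩
  have ho1 : (ρ o).character = 1 := by
    obtain ⟨e⟩ := ho
    rw [char_iso e, character_trivial]
  have hb : ∀ j, ∃ n : I → ℕ, Representation.character (stdRep.comp ι) * (ρ j).character =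
      ∑ i, n i • (ρ i).character := fun j => by
    rw [← char_tensor]
    exact hρ.exists_character_eq_sum _
  choose b hb using hb
  have hli := linearIndependent_of_range_eq hinj hχ
  obtain ⟨h, hK⟩ := exists_isKostant_mckay (b := b) hι hH hinj hχ ho1 hb
  obtain ⟨z, hz⟩ := exists_map_eq_neg_one hι hH
  obtain ⟨ε, hε⟩ := exists_parity hli (b := b) (character_stdRep_mul hz)
    (fun i => irrChars_even_or_odd (map_eq_neg_one_central hι hz)
      (map_eq_neg_one_mul_self hι hz) (hχ ▸ Set.mem_range_self i)) hb
  refine kostantFormula_of_characters (b := b) hli hb ?_ ?_ (character_symPowRep_add_two ι)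
    (fun k => hρ.exists_character_eq_sum _) hε hK
  · rw [character_symPowRep_zero, ho1]
  · rw [character_symPowRep_one, ho1, mul_one]

variable {N : Subgroup H}

/-- The diagram of the induced modules is the quotient of the McKay graph of `N` that identifies
irreducible modules with isomorphic induced modules. -/
theorem kostantFormula_of_isInductionSystem [N.Normal] (hι : Function.Injective ι)
    (hN : Even (Nat.card N)) {W : I → Type} [∀ i, AddCommGroup (W i)] [∀ i, Module ℂ (W i)]
    {φ : ∀ i, Representation ℂ N (W i)} (hφ : IsInductionSystem N φ) {o : I}
    (ho : Nonempty ((φ o).Equiv (Representation.trivial ℂ N ℂ))) :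
    KostantFormula (stdRep.comp ι) (fun i => ind N (φ i))
      (fun k => ind N (res N (symPowRep (stdRep.comp ι) k))) o (maxIrrepDim N) := by
  classical
  have := Fintype.ofFinite H
  have := Fintype.ofFinite N
  have hfd : ∀ i, FiniteDimensional ℂ (W i) := fun i =>
    finiteDimensional_of_isIrreducible (hφ.irreducible i)
  set v := Representation.character (stdRep.comp ι) with hv
  have hvconj : ∀ x g, v (x * g * x⁻¹) = v g := fun x g => char_conj _ g x
  set m : I → H → ℂ := fun i => (ind N (φ i)).character with hm
  have hmφ : ∀ i, m i = indFun N (φ i).character := fun i => character_ind N (φ i)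
  have hφmem : ∀ i, (φ i).character ∈ irrChars N := fun i =>
    ⟨W i, _, _, φ i, hφ.irreducible i, rfl⟩
  have hminj : Function.Injective m := fun i j h =>
    hφ.inequivalent i j (nonempty_equiv_of_character_eq h)
  have hli : LinearIndependent ℂ m := by
    refine linearIndependent_of_charForm (fun i j hij => ?_) fun i => ?_
    · have h := hminj.ne hij
      rw [hmφ, hmφ] at h ⊢
      exact charForm_indFun_eq_zero (hφmem i) (hφmem j) h
    · rw [hmφ]
      exact charForm_indFun_self_ne_zero (hφmem i)
  -- induction maps the irreducible characters of `N` onto the members of the family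
  have hp : ∀ χ : irrChars N, ∃ i, indFun N χ = m i := by
    rintro ⟨_, U, _, _, τ, hτ, rfl⟩
    have := finiteDimensional_of_isIrreducible hτ
    obtain ⟨i, ⟨e⟩⟩ := hφ.exhaustive U τ hτ
    exact ⟨i, by rw [← character_ind]; exact char_iso e⟩
  choose p hp using hp
  have hpφ : ∀ i, p ⟨_, hφmem i⟩ = i := fun i => hminj (by rw [← hp, hmφ])
  have hind : ∀ n : irrChars N → ℕ, indFun N (∑ χ, n χ • (χ : N → ℂ)) =
      ∑ i, (∑ χ with p χ = i, n χ) • m i := fun n => by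
    rw [map_sum, ← sum_smul_comp p n m]
    exact Finset.sum_congr rfl fun χ _ => by rw [map_nsmul, hp]
  have hιN : Function.Injective (ι.comp N.subtype) := hι.comp N.subtype_injective
  have hvN : Representation.character (stdRep.comp (ι.comp N.subtype)) = fun n : N => v n := rfl
  obtain ⟨B, hB⟩ := exists_mckay_matrix (stdRep.comp (ι.comp N.subtype))
  have hvm : ∀ χ : irrChars N, v * m (p χ) = ∑ i, (∑ χ' with p χ' = i, B χ χ') • m i := fun χ => by
    rw [← hp, ← indFun_mul hvconj, ← hvN, hB, hind]
  let b : Matrix I I ℕ := fun j i => ∑ χ' with p χ' = i, B ⟨_, hφmem j⟩ χ'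
  have hb : ∀ j, v * m j = ∑ i, b j i • m i := fun j => by
    have := hvm ⟨_, hφmem j⟩
    rwa [hpφ] at this
  have ho1 : (φ o).character = 1 := by
    obtain ⟨e⟩ := ho
    rw [char_iso e, character_trivial]
  have hmo : m o = indFun N 1 := by rw [hmφ, ho1]
  let o' : irrChars N := ⟨1, one_mem_irrChars⟩
  obtain ⟨h, hK⟩ := exists_isKostant_mckay (b := B) (o := o') hιN hN Subtype.val_injective
    Subtype.range_val rfl hB
  have hKb : IsKostant (adjOp b) o h (maxIrrepDim N) := by
    refine hK.push p (fun i => ⟨_, hpφ i⟩) (fun χ => ?_) fun χ => ⟨fun hχ => ?_, ?_⟩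
    · apply linearCombination_injective hli
      rw [linearCombination_adjOp hb, linearCombination_simpleRoot, hvm, ← sum_smul_comp, map_sum]
      refine Finset.sum_congr rfl fun χ' _ => ?_
      rw [map_smul, linearCombination_simpleRoot, adjOp_simpleRoot, natCast_zsmul]
    · by_contra hne
      have h1 : indFun N χ = indFun N 1 := by rw [hp, hχ, hmo]
      have h2 := charForm_indFun_self_ne_zero χ.2
      nth_rw 2 [h1] at h2
      rw [charForm_indFun_indFun] at h2
      refine h2 (mul_eq_zero_of_right _ (Finset.sum_eq_zero fun x _ => ?_))
      exact charForm_irrChars_of_ne χ.2 one_mem_irrChars fun h => hne (Subtype.ext h)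
    · rintro rfl
      exact hminj (by rw [← hp, hmo])
  obtain ⟨z, hz⟩ := exists_map_eq_neg_one hιN hN
  have hzH : ι z = -1 := hz
  obtain ⟨ε, hε⟩ := exists_parity hli (b := b) (z := (z : H)) (character_stdRep_mul hzH)
    (fun i => by
      rw [hmφ]
      exact indFun_even_or_odd (map_eq_neg_one_central hι hzH)
        (irrChars_even_or_odd (map_eq_neg_one_central hιN hz) (map_eq_neg_one_mul_self hιN hz)
          (hφmem i))) hb
  have hS : ∀ k, (ind N (res N (symPowRep (stdRep.comp ι) k))).character =
      indFun N fun n : N => (symPowRep (stdRep.comp ι) k).character n := fun k =>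
    character_ind N _
  refine kostantFormula_of_characters (b := b) hli hb ?_ ?_ (fun k => ?_) (fun k => ?_) hε hKb
  · rw [hS, character_symPowRep_zero]
    exact hmo.symm
  · change _ = v * m o
    rw [hS, character_symPowRep_one, hmo, ← indFun_mul hvconj, mul_one]
  · rw [hS, hS, hS, character_symPowRep_add_two, ← hv, ← indFun_mul hvconj, ← map_sub]
    rfl
  · obtain ⟨n, hn⟩ := exists_character_eq_sum (res N (symPowRep (stdRep.comp ι) k))
    exact ⟨_, by rw [character_ind, hn, hind]⟩

/-- The lattice of the restricted modules embeds into that of the McKay graph of `N`, by decomposing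
a restricted module into irreducible `N`-modules. As the restrictions are separated, distinct
restricted modules have disjoint supports. -/
theorem kostantFormula_of_isRestrictionSystem (hι : Function.Injective ι)
    (hN : Even (Nat.card N)) (hsep : RestrictionsSeparate N) {W : I → Type}
    [∀ i, AddCommGroup (W i)] [∀ i, Module ℂ (W i)] {ρ : ∀ i, Representation ℂ H (W i)}
    (hρ : IsRestrictionSystem N ρ) {o : I}
    (ho : Nonempty ((res N (ρ o)).Equiv (Representation.trivial ℂ N ℂ))) :
    KostantFormula (res N (stdRep.comp ι)) (fun i => res N (ρ i))
      (fun k => res N (symPowRep (stdRep.comp ι) k)) o (maxIrrepDim N) := by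
  classical
  have := Fintype.ofFinite N
  have hfd : ∀ i, FiniteDimensional ℂ (W i) := fun i =>
    finiteDimensional_of_isIrreducible (hρ.irreducible i)
  have hιN : Function.Injective (ι.comp N.subtype) := hι.comp N.subtype_injective
  set v := Representation.character (stdRep.comp (ι.comp N.subtype)) with hv
  set m : I → N → ℂ := fun i => (res N (ρ i)).character with hm
  have horth : ∀ i j, i ≠ j → charForm N (m i) (m j) = 0 := by
    intro i j hij
    by_contra h
    obtain ⟨f, hf⟩ := (charForm_character_ne_zero_iff _ _).mp h
    exact hij (hρ.inequivalent j i
      (hsep _ _ _ _ (hρ.irreducible j) (hρ.irreducible i) ⟨f, hf⟩)).symm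
  have hself : ∀ i, charForm N (m i) (m i) ≠ 0 := by
    intro i
    have := nontrivial_of_isIrreducible (hρ.irreducible i)
    rw [charForm_character_ne_zero_iff]
    obtain ⟨x, hx⟩ := exists_ne (0 : W i)
    exact ⟨IntertwiningMap.id _, fun h0 =>
      hx (congrArg (fun f : (res N (ρ i)).IntertwiningMap (res N (ρ i)) => f x) h0)⟩
  have hli : LinearIndependent ℂ m := linearIndependent_of_charForm horth hself
  -- the restriction of an `H`-module is a sum of members of the family
  have hp : ∀ χ : irrChars H, ∃ i, (fun n : N => (χ : H → ℂ) n) = m i := by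
    rintro ⟨_, U, _, _, τ, hτ, rfl⟩
    obtain ⟨i, ⟨e⟩⟩ := hρ.exhaustive U τ hτ
    exact ⟨i, char_iso e⟩
  choose p hp using hp
  have hdec : ∀ {U : Type} [AddCommGroup U] [Module ℂ U] [FiniteDimensional ℂ U]
      (σ : Representation ℂ H U), ∃ n : I → ℕ, (res N σ).character = ∑ i, n i • m i := by
    intro U _ _ _ σ
    obtain ⟨n, hn⟩ := exists_character_eq_sum σ
    refine ⟨_, Eq.trans ?_ (sum_smul_comp p n m)⟩
    ext x
    have := congrFun hn x
    rw [Finset.sum_apply] at this ⊢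
    refine this.trans (Finset.sum_congr rfl fun χ _ => ?_)
    rw [← hp]
    rfl
  have hb : ∀ j, ∃ n : I → ℕ, v * m j = ∑ i, n i • m i := fun j => by
    obtain ⟨n, hn⟩ := hdec (Representation.tprod (stdRep.comp ι) (ρ j))
    refine ⟨n, hn ▸ ?_⟩
    ext x
    exact (congrFun (char_tensor (stdRep.comp ι) (ρ j)) x).symm
  choose b hb using hb
  obtain ⟨B, hB⟩ := exists_mckay_matrix (stdRep.comp (ι.comp N.subtype))
  have ho1 : m o = 1 := by
    obtain ⟨e⟩ := ho
    exact (char_iso e).trans character_trivial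
  let o' : irrChars N := ⟨1, one_mem_irrChars⟩
  obtain ⟨h, hK⟩ := exists_isKostant_mckay (b := B) (o := o') hιN hN Subtype.val_injective
    Subtype.range_val rfl hB
  -- the multiplicities of the irreducible `N`-modules in the members of the family
  have hn : ∀ i, ∃ n : irrChars N → ℕ, m i = ∑ χ, n χ • (χ : N → ℂ) := fun i =>
    exists_character_eq_sum _
  choose n hn using hn
  have hdisj : ∀ i j χ, i ≠ j → n i χ ≠ 0 → n j χ = 0 := by
    intro i j χ hij hi
    have h1 := horth i j hij
    have h2 : charForm N (m i) (m j) = ((∑ χ, n i χ * n j χ : ℕ) : ℂ) := by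
      rw [hn i, hn j]
      simp only [map_sum, map_nsmul, LinearMap.sum_apply, LinearMap.smul_apply]
      push_cast
      refine Finset.sum_congr rfl fun χ _ => ?_
      rw [Finset.sum_eq_single χ, charForm_irrChars_self χ.2]
      · simp [mul_comm]
      · intro χ' _ hne
        have h3 := charForm_irrChars_of_ne χ'.2 χ.2 fun h => hne (Subtype.ext h)
        simp [h3]
      · simp
    rw [h1] at h2
    have h3 := (Finset.sum_eq_zero_iff.mp (Nat.cast_eq_zero.mp h2.symm)) χ (Finset.mem_univ χ)
    exact (mul_eq_zero.mp h3).resolve_left hi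
  let f : (I → ℤ) →ₗ[ℤ] (irrChars N → ℤ) := Fintype.linearCombination ℤ fun i χ => (n i χ : ℤ)
  have hf : ∀ w χ, f w χ = ∑ i, w i * n i χ := fun w χ => by
    simp [f, Fintype.linearCombination_apply]
  have hfL : ∀ w, Fintype.linearCombination ℤ ((↑) : irrChars N → N → ℂ) (f w) =
      Fintype.linearCombination ℤ m w := by
    intro w
    simp only [f, Fintype.linearCombination_apply ℤ _ w, map_sum, map_smul,
      linearCombination_natCast, hn]
  have hinj := linearCombination_injective (linearIndependent_irrChars (H := N))
  have hfo : f (simpleRoot o) = simpleRoot o' := hinj (by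
    rw [hfL, linearCombination_simpleRoot, linearCombination_simpleRoot, ho1])
  have hno : n o o' = 1 := by
    have h1 := congrFun hfo o'
    rw [hf, Finset.sum_eq_single o] at h1
    · simpa [simpleRoot] using h1
    · intro i _ hi
      simp [simpleRoot, hi]
    · simp
  have hKb : IsKostant (adjOp b) o h (maxIrrepDim N) := by
    refine hK.pull f (fun w => hinj ?_) hfo (fun w => ?_) fun w hw i => ?_
    · rw [hfL, linearCombination_adjOp hb, linearCombination_adjOp hB, hfL]
    · rw [hf, Finset.sum_eq_single o, hno, Nat.cast_one, mul_one]
      · intro i _ hi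
        rw [hdisj o i o' hi.symm (by rw [hno]; exact one_ne_zero), Nat.cast_zero, mul_zero]
      · simp
    · obtain ⟨χ, hχ⟩ : ∃ χ, n i χ ≠ 0 := by
        by_contra! h0
        refine hself i ?_
        rw [hn i]
        simp [h0]
      have h1 := hw χ
      rw [hf, Finset.sum_eq_single i] at h1
      · exact nonneg_of_mul_nonneg_left h1 (by positivity)
      · intro j _ hj
        rw [hdisj i j χ hj.symm hχ, Nat.cast_zero, mul_zero]
      · simp
  obtain ⟨z, hz⟩ := exists_map_eq_neg_one hιN hN
  obtain ⟨ε, hε⟩ := exists_parity hli (b := b) (z := z) (character_stdRep_mul hz)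
    (fun i => by
      have hzH : ι z = -1 := hz
      refine (irrChars_even_or_odd (map_eq_neg_one_central hι hzH)
        (map_eq_neg_one_mul_self hι hzH) ⟨W i, _, _, ρ i, hρ.irreducible i, rfl⟩).imp ?_ ?_ <;>
      exact fun h x => h x) hb
  have hS : ∀ k, (res N (symPowRep (stdRep.comp ι) k)).character =
      fun x : N => (symPowRep (stdRep.comp ι) k).character x := fun k => rfl
  refine kostantFormula_of_characters (b := b) hli hb ?_ ?_ (fun k => ?_) (fun k => hdec _) hε hKb
  · rw [hS, character_symPowRep_zero]
    exact ho1.symm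
  · change _ = v * m o
    rw [hS, character_symPowRep_one, ho1, mul_one]
    rfl
  · rw [hS, character_symPowRep_add_two]
    rfl

end Cases

/-! ### Distinguished pairs -/

section Distinguished

open Representation

theorem card_specialLinearGroup_three : Nat.card SL(2, ZMod 3) = 24 := by
  let e : SL(2, ZMod 3) ≃ {p : (ZMod 3 × ZMod 3) × (ZMod 3 × ZMod 3) //
      p.1.1 * p.2.2 - p.1.2 * p.2.1 = 1} :=
    { toFun := fun A => ⟨((A.1 0 0, A.1 0 1), (A.1 1 0, A.1 1 1)),
        (Matrix.det_fin_two A.1).symm.trans A.2⟩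
      invFun := fun p => ⟨!![p.1.1.1, p.1.1.2; p.1.2.1, p.1.2.2], by
        rw [Matrix.det_fin_two_of]
        exact p.2⟩
      left_inv := fun A => by
        ext i j
        fin_cases i <;> fin_cases j <;> rfl
      right_inv := fun p => rfl }
  rw [Nat.card_congr e, Nat.card_eq_fintype_card]
  decide +kernel

variable {H : Type} [Group H]

theorem mul_comm_of_card_le_four [Finite H] (h : Nat.card H ≤ 4) (a b : H) : a * b = b * a := by
  have h0 : 0 < Nat.card H := Nat.card_pos
  obtain h1 | h1 | h1 | h1 : Nat.card H = 1 ∨ Nat.card H = 2 ∨ Nat.card H = 3 ∨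
    Nat.card H = 2 ^ 2 := by omega
  · have := (Nat.card_eq_one_iff_unique.mp h1).1
    exact Subsingleton.elim _ _
  · have := Fact.mk Nat.prime_two
    have := isCyclic_of_prime_card h1
    exact IsCyclic.commGroup.mul_comm a b
  · have := Fact.mk Nat.prime_three
    have := isCyclic_of_prime_card h1
    exact IsCyclic.commGroup.mul_comm a b
  · have := Fact.mk Nat.prime_two
    exact isMulCommutative_iff.mp (IsPGroup.isMulCommutative_of_card_eq_prime_sq h1) a b

/-- Only orders matter: `SL(2, 𝔽₃)`, the binary tetrahedral group, has order `24`, and `C_{2n}` has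
index `4` in `D_{2n}`. -/
theorem IsDistinguishedPair.index_le_four [Finite H] {N : Subgroup H}
    (hN : IsDistinguishedPair N) : N.index ≤ 4 := by
  have hmul := N.card_mul_index
  have hpos : 0 < Nat.card N := Nat.card_pos
  have hQ : ∀ n, 1 ≤ n → Nat.card (QuaternionGroup n) = 4 * n := fun n hn => by
    have : NeZero n := ⟨by omega⟩
    rw [Nat.card_eq_fintype_card, QuaternionGroup.card]
  have hC : ∀ n, Nat.card (Multiplicative (ZMod (2 * n))) = 2 * n := fun n =>
    (Nat.card_congr Multiplicative.toAdd).trans (Nat.card_zmod _)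
  rcases hN with rfl | ⟨n, hn, ⟨e⟩, ⟨e'⟩⟩ | ⟨n, hn, ⟨e⟩, ⟨e'⟩⟩ | ⟨n, hn, ⟨e⟩, ⟨e'⟩⟩ |
    ⟨⟨e⟩, h⟩ | ⟨⟨e⟩, ⟨e'⟩⟩
  · simp
  · rw [Nat.card_congr e.toEquiv, Nat.card_congr e'.toEquiv, hQ _ (by omega),
      hQ _ (by omega)] at hmul
    have : n * N.index = n * 2 := by linarith
    rw [Nat.eq_of_mul_eq_mul_left (by omega) this]
    omega
  · rw [Nat.card_congr e.toEquiv, Nat.card_congr e'.toEquiv, hC, hQ _ (by omega)] at hmul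
    have : n * N.index = n * 2 := by linarith
    rw [Nat.eq_of_mul_eq_mul_left (by omega) this]
    omega
  · rw [Nat.card_congr e.toEquiv, Nat.card_congr e'.toEquiv, hC, hQ _ (by omega)] at hmul
    have : n * N.index = n * 4 := by linarith
    rw [Nat.eq_of_mul_eq_mul_left (by omega) this]
  · omega
  · rw [Nat.card_congr e.toEquiv, Nat.card_congr e'.toEquiv, hQ _ (by omega),
      card_specialLinearGroup_three] at hmul
    omega

theorem exists_common_eigenvector (hcomm : ∀ a b : H, a * b = b * a) {E : Type} [AddCommGroup E]
    [Module ℂ E] [FiniteDimensional ℂ E] [Nontrivial E] (τ : Representation ℂ H E) :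
    ∃ v ≠ 0, ∀ g, ∃ c : ℂ, τ g v = c • v := by
  have : IsMulCommutative H := isMulCommutative_iff.mpr hcomm
  obtain ⟨S, hS⟩ := exists_isIrreducible_subrepresentation τ
  obtain ⟨v, hv0, hv⟩ := finrank_eq_one_iff'.mp
    (IsIrreducible.finrank_eq_one_of_isMulCommutative S.toRepresentation)
  refine ⟨v, fun h => hv0 (Subtype.ext h), fun g => ?_⟩
  obtain ⟨c, hc⟩ := hv (S.toRepresentation g v)
  exact ⟨c, congrArg Subtype.val hc.symm⟩

/-- If `H ⧸ N` is commutative, then the nonzero space of `N`-maps between two irreducible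
`H`-modules contains an eigenvector of `H ⧸ N`; its kernel and its range are `H`-submodules, so that
it is an isomorphism of `N`-modules. -/
theorem restrictionsSeparate_of_mul_comm [Finite H] {N : Subgroup H} [N.Normal]
    (hcomm : ∀ a b : H ⧸ N, a * b = b * a) : RestrictionsSeparate N := by
  intro U U' _ _ _ _ σ σ' hσ hσ' ⟨f, hf⟩
  have := finiteDimensional_of_isIrreducible hσ
  have := finiteDimensional_of_isIrreducible hσ'
  let τ := quotientToInvariants (linHom σ σ') N
  have hnt : Nontrivial (invariants ((linHom σ σ').comp N.subtype)) := by
    refine ⟨⟨f.toLinearMap, fun n => ?_⟩, 0, fun h => hf ?_⟩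
    · ext u
      have := IntertwiningMap.isIntertwining _ _ f n (σ (n : H)⁻¹ u)
      simpa using this.symm
    · exact IntertwiningMap.ext (congrArg Subtype.val h)
  obtain ⟨F, hF0, hF⟩ := exists_common_eigenvector hcomm τ
  set F' : U →ₗ[ℂ] U' := F.1 with hF'
  have hF'0 : F' ≠ 0 := fun h => hF0 (Subtype.ext h)
  have hinv : ∀ (n : N) u, F' (σ n u) = σ' n (F' u) := by
    intro n u
    have h1 : σ' n ∘ₗ F' ∘ₗ σ (n : H)⁻¹ = F' := F.2 n
    have h2 := LinearMap.congr_fun h1 (σ n u)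
    simpa using h2.symm
  have heig : ∀ h : H, ∃ c : ℂ, ∀ u, σ' h (F' u) = c • F' (σ h u) := by
    intro h
    obtain ⟨c, hc⟩ := hF (h : H ⧸ N)
    refine ⟨c, fun u => ?_⟩
    have h1 : c • F' = σ' h ∘ₗ F' ∘ₗ σ h⁻¹ :=
      congrArg Subtype.val hc.symm
    have h2 := LinearMap.congr_fun h1 (σ h u)
    simpa using h2.symm
  have hker : LinearMap.ker F' = ⊥ := by
    refine (eq_bot_or_eq_top_of_isIrreducible hσ _ fun h u hu => ?_).resolve_right fun h =>
      hF'0 (LinearMap.ker_eq_top.mp h)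
    obtain ⟨c, hc⟩ := heig h⁻¹
    have h1 := hc (σ h u)
    rw [inv_self_apply, LinearMap.mem_ker.mp hu, smul_zero] at h1
    exact LinearMap.mem_ker.mpr ((map_eq_zero_iff _ (σ'.apply_bijective h⁻¹).1).mp h1)
  have hrange : LinearMap.range F' = ⊤ := by
    refine (eq_bot_or_eq_top_of_isIrreducible hσ' _ fun h u hu => ?_).resolve_left fun h =>
      hF'0 (LinearMap.range_eq_bot.mp h)
    obtain ⟨w, rfl⟩ := hu
    obtain ⟨c, hc⟩ := heig h
    exact ⟨c • σ h w, by rw [map_smul, hc]⟩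
  exact ⟨Representation.Equiv.mk
    (LinearEquiv.ofBijective F' ⟨LinearMap.ker_eq_bot.mp hker, LinearMap.range_eq_top.mp hrange⟩)
    fun n => LinearMap.ext fun u => hinv n u⟩

theorem IsDistinguishedPair.restrictionsSeparate [Finite H] {N : Subgroup H} [N.Normal]
    (hN : IsDistinguishedPair N) : RestrictionsSeparate N :=
  restrictionsSeparate_of_mul_comm (mul_comm_of_card_le_four hN.index_le_four)

end Distinguished

end McKaySlodowy

end

theorem mainTheorem1 (G : Subgroup SL(2, ℂ)) [Finite G] (N : Subgroup G) [N.Normal]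
    (hN : Even (Nat.card N)) :
    -- the distinguished pairs have separated restrictions
    (McKaySlodowy.IsDistinguishedPair N → McKaySlodowy.RestrictionsSeparate N) ∧
    -- the restricted modules
    (McKaySlodowy.RestrictionsSeparate N →
      ∀ (I : Type) [Fintype I] [DecidableEq I] (W : I → Type) [∀ i, AddCommGroup (W i)]
        [∀ i, Module ℂ (W i)] (ρ : ∀ i, Representation ℂ G (W i)),
        McKaySlodowy.IsRestrictionSystem N ρ →
        ∀ o : I, Nonempty ((McKaySlodowy.res N (ρ o)).Equiv (Representation.trivial ℂ N ℂ)) →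
          McKaySlodowy.KostantFormula
            (McKaySlodowy.res N (McKaySlodowy.res G McKaySlodowy.stdRep))
            (fun i => McKaySlodowy.res N (ρ i))
            (fun k => McKaySlodowy.res N
              (McKaySlodowy.symPowRep (McKaySlodowy.res G McKaySlodowy.stdRep) k))
            o (McKaySlodowy.maxIrrepDim N)) ∧
    -- the induced modules
    (∀ (I : Type) [Fintype I] [DecidableEq I] (W : I → Type) [∀ i, AddCommGroup (W i)]
        [∀ i, Module ℂ (W i)] (φ : ∀ i, Representation ℂ N (W i)),
        McKaySlodowy.IsInductionSystem N φ →
        ∀ o : I, Nonempty ((φ o).Equiv (Representation.trivial ℂ N ℂ)) →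
          McKaySlodowy.KostantFormula
            (McKaySlodowy.res G McKaySlodowy.stdRep)
            (fun i => McKaySlodowy.ind N (φ i))
            (fun k => McKaySlodowy.ind N (McKaySlodowy.res N
              (McKaySlodowy.symPowRep (McKaySlodowy.res G McKaySlodowy.stdRep) k)))
            o (McKaySlodowy.maxIrrepDim N)) ∧
    -- the irreducible modules of a single group
    (∀ (I : Type) [Fintype I] [DecidableEq I] (W : I → Type) [∀ i, AddCommGroup (W i)]
        [∀ i, Module ℂ (W i)] (ρ : ∀ i, Representation ℂ G (W i)),
        McKaySlodowy.IsIrreducibleSystem ρ →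
        ∀ o : I, Nonempty ((ρ o).Equiv (Representation.trivial ℂ G ℂ)) →
          McKaySlodowy.KostantFormula
            (McKaySlodowy.res G McKaySlodowy.stdRep) ρ
            (fun k => McKaySlodowy.symPowRep (McKaySlodowy.res G McKaySlodowy.stdRep) k)
            o (McKaySlodowy.maxIrrepDim G)) := by
  have hG : Even (Nat.card G) := even_iff_two_dvd.mpr
    (hN.two_dvd.trans (Subgroup.card_subgroup_dvd_card N))
  have hι : Function.Injective G.subtype := G.subtype_injective
  exact ⟨fun h => h.restrictionsSeparate,
    fun hsep I _ _ W _ _ ρ hρ o ho =>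
      McKaySlodowy.kostantFormula_of_isRestrictionSystem hι hN hsep hρ ho,
    fun I _ _ W _ _ φ hφ o ho => McKaySlodowy.kostantFormula_of_isInductionSystem hι hN hφ ho,
    fun I _ _ W _ _ ρ hρ o ho => McKaySlodowy.kostantFormula_of_isIrreducibleSystem hι hG hρ ho⟩
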